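/- Let $W$ be a finite Coxeter group with simple generators $S$, reflections $T$ and length function $l$; an inversion of $w\in W$ is a reflection $t\in T$ with $l(tw)<l(w)$. A Coxeter element is an element $c$ of $W$ having a reduced word in which every element of $S$ occurs exactly once; $s\in S$ is initial in $c$ if it is the first letter of some reduced word for $c$ (and then $scs$ is again a Coxeter element). Sortable elements. Fix a reduced word $a_1\cdots a_n$ for the Coxeter element $c$. The $c$-sorting word of $w\in W$ is the lexicographically first (as a sequence of positions) subword of the half-infinite word $a_1\cdots a_n|a_1\cdots a_n|a_1\cdots a_n|\cdots$ that is a reduced word for $w$. The element $w$ is $c$-sortable if the sets of letters that its $c$-sorting word takes from the first, second, third, $\ldots$ copy of $a_1\cdots a_n$ form a sequence decreasing under inclusion. Orientations. An irreducible rank-two parabolic subgroup $W'$ is a conjugate of a subgroup generated by two noncommuting elements of $S$. Its canonical generators are its two reflections whose hyperplanes define facets of the region $R'\supseteq R$ of the arrangement of $W'$, where $R$ is the base region of the Coxeter arrangement of $W$. Two distinct reflections are adjacent if their hyperplanes define facets of a common region of the Coxeter arrangement. An orientation of $W$ is a directed graph on $T$ in which $t_1\to t_2$ implies that $t_1$ and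 $t_2$ are adjacent and do not commute, and which induces a directed cycle on the set of all reflections of $W'$, for every irreducible rank-two parabolic subgroup $W'$. There is a unique family of orientations of $W$, indexed by the Coxeter elements $c$ (with edges written $t_1\xrightarrow{c}t_2$), such that for every Coxeter element $c$ and every $s$ initial in $c$: (i) $s\xrightarrow{c}t$ whenever $s$ and $t$ are the canonical generators of an irreducible rank-two parabolic subgroup; (ii) if $t_1\xrightarrow{c}t_2$ then $st_1s\xrightarrow{scs}st_2s$. Its member at $c$ is called the $c$-orientation. An element $w\in W$ is $c$-aligned if for every irreducible rank-two parabolic subgroup with canonical generators $t_1,t_2$ and $c$-orientation $t_1\xrightarrow{c}t_2$, if $t_2t_1t_2$ is an inversion of $w$ then so is $t_1$. **Theorem.** For every Coxeter element $c$ of $W$, every reduced word $a_1\cdots a_n$ for $c$ and every $w\in W$: $w$ is $c$-sortable (with respect to $a_1\cdots a_n$) if and only if $w$ is $c$-aligned. -/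

import Mathlib

namespace CoxeterSystem

variable {B W : Type*} [Group W] {M : CoxeterMatrix B} (cs : CoxeterSystem M W)

/-! ### Coxeter elements and sortable elements -/

/-- `a` is a reduced word for `w`. -/
def IsReducedWordFor (a : List B) (w : W) : Prop :=
  cs.IsReduced a ∧ cs.wordProd a = w

/-- `c` has a reduced word in which every simple generator occurs exactly once. -/
def IsCoxeterElement (c : W) : Prop :=
  ∃ a : List B, cs.IsReducedWordFor a c ∧ a.Nodup ∧ ∀ i : B, i ∈ a

/-- The simple generator indexed by `i` is the first letter of some reduced word for `c`. -/
def IsInitial (c : W) (i : B) : Prop :=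
  ∃ a : List B, cs.IsReducedWordFor (i :: a) c

/-- Positions in the half-infinite word `a | a | a | ⋯`: the pair `(r, j)` is the `j`-th letter of
the `r`-th copy of `a`, and positions are ordered from left to right. -/
abbrev InftyPos (a : List B) : Type := ℕ ×ₗ Fin a.length

/-- The letter at a position of the half-infinite word `a | a | a | ⋯`. -/
def inftyLetter (a : List B) (x : InftyPos a) : B := a.get (ofLex x).2

/-- The sequence of positions `p` picks out a subword of `a | a | a | ⋯` that is a reduced word
for `w`. -/
def IsReducedSubword (a : List B) (w : W) (p : List (InftyPos a)) : Prop :=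
  p.Pairwise (· < ·) ∧ cs.IsReducedWordFor (p.map (inftyLetter a)) w

/-- The sequence of positions `p` is the lexicographically first one giving a reduced word for `w`
as a subword of `a | a | a | ⋯`, i.e. it is the sorting word of `w` with respect to `a`.
(The order on lists is the lexicographic one.) -/
def IsSortingWord (a : List B) (w : W) (p : List (InftyPos a)) : Prop :=
  cs.IsReducedSubword a w p ∧ ∀ q, cs.IsReducedSubword a w q → p ≤ q

/-- The set of letters that the subword at positions `p` takes from the `r`-th copy of `a`. -/
def block (a : List B) (p : List (InftyPos a)) (r : ℕ) : Set B :=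
  {i | ∃ x ∈ p, (ofLex x).1 = r ∧ inftyLetter a x = i}

/-- `w` is `c`-sortable, where `a` is the chosen reduced word for `c`: the sorting word of `w`
defines a sequence of subsets that is decreasing under inclusion. -/
def IsSortable (a : List B) (w : W) : Prop :=
  ∃ p, cs.IsSortingWord a w p ∧ ∀ r, block a p (r + 1) ⊆ block a p r

/-! ### Rank-two parabolic subgroups and their canonical generators -/

/-- The standard parabolic subgroup generated by the simple generators indexed by `J`. -/
def standardParabolic (J : Set B) : Subgroup W :=
  Subgroup.closure (cs.simple '' J)

/-- `H` is conjugate to a standard parabolic subgroup generated by two distinct simple generators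
that do not commute. -/
def IsIrreducibleRankTwoParabolic (H : Subgroup W) : Prop :=
  ∃ (g : W) (i j : B), i ≠ j ∧ ¬ Commute (cs.simple i) (cs.simple j) ∧
    H = (cs.standardParabolic {i, j}).map (MulAut.conj g).toMonoidHom

/-- The canonical generators of a parabolic subgroup `H`: the reflections `t` in `H` whose
hyperplane bounds the region of the arrangement of `H` that contains the base region `R`. That is,
the hyperplane of `t` is the only hyperplane of `H` that separates `R` from `tR`; and the hyperplane
of `r` separates `R` from `tR` exactly if `r` is an inversion of `t`. -/
def canonicalGenerators (H : Subgroup W) : Set W :=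
  {t | cs.IsReflection t ∧ t ∈ H ∧ ∀ r ∈ H, cs.IsLeftInversion t r → r = t}

/-! ### Orientations -/

/-- Two distinct reflections are adjacent if their hyperplanes define facets of a common region of
the Coxeter arrangement. The regions are the `wR` for `w` in `W`, and the facets of `wR` are defined
by the reflections `w s w⁻¹` for `s` simple. -/
def AreAdjacent (t₁ t₂ : W) : Prop :=
  t₁ ≠ t₂ ∧ ∃ (w : W) (i j : B), t₁ = w * cs.simple i * w⁻¹ ∧ t₂ = w * cs.simple j * w⁻¹

/-- The directed graph induced by `E` on the vertex set `X` is a directed cycle (through all the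
vertices in `X`; here `X` is going to be finite, so that `n ≠ 0`). -/
def IsDirectedCycleOn (E : W → W → Prop) (X : Set W) : Prop :=
  ∃ (n : ℕ) (e : ZMod n ≃ X), ∀ k l : ZMod n, E (e k) (e l) ↔ l = k + 1

/-- `E` is the edge relation of an orientation of `W`, a directed graph on the reflections. -/
structure IsOrientation (E : W → W → Prop) : Prop where
  isReflection : ∀ t₁ t₂, E t₁ t₂ → cs.IsReflection t₁ ∧ cs.IsReflection t₂
  adjacent : ∀ t₁ t₂, E t₁ t₂ → cs.AreAdjacent t₁ t₂ ∧ ¬ Commute t₁ t₂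
  cycle : ∀ H : Subgroup W, cs.IsIrreducibleRankTwoParabolic H →
    IsDirectedCycleOn E {t | cs.IsReflection t ∧ t ∈ H}

/-- `O` is a family of orientations of `W`, indexed by the Coxeter elements, that satisfies the two
requirements characterizing the `c`-orientations. -/
structure IsCOrientationFamily (O : {c : W // cs.IsCoxeterElement c} → W → W → Prop) : Prop where
  isOrientation : ∀ c, cs.IsOrientation (O c)
  initial : ∀ (c : {c : W // cs.IsCoxeterElement c}) (i : B), cs.IsInitial c i →
    ∀ H : Subgroup W, cs.IsIrreducibleRankTwoParabolic H →
      ∀ t : W, cs.canonicalGenerators H = {cs.simple i, t} → O c (cs.simple i) t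
  conj : ∀ (c c' : {c : W // cs.IsCoxeterElement c}) (i : B), cs.IsInitial c i →
    (c' : W) = cs.simple i * c * cs.simple i →
      ∀ t₁ t₂ : W, O c t₁ t₂ →
        O c' (cs.simple i * t₁ * cs.simple i) (cs.simple i * t₂ * cs.simple i)

/-- `w` is aligned with respect to the orientation `E`. -/
def IsAligned (E : W → W → Prop) (w : W) : Prop :=
  ∀ H : Subgroup W, cs.IsIrreducibleRankTwoParabolic H →
    ∀ t₁ t₂ : W, cs.canonicalGenerators H = {t₁, t₂} → E t₁ t₂ →
      cs.IsLeftInversion w (t₂ * t₁ * t₂) → cs.IsLeftInversion w t₁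

end CoxeterSystem

/-! ### The geometric representation -/

/-! The proof takes place in the geometric representation, where reflections correspond to positive
roots and t is an inversion of w exactly when w⁻¹ makes its root negative
(`HasRoot.isLeftInversion_iff`). A word a for c defines an Euler form, a triangular half of the Tits
form; let ω_a be its skew-symmetrization. The sign of ω_a(x, y) on the two simple roots of a
rank-two parabolic subgroup orients that subgroup. Moving the first letter i of a to the end
transports ω_a by s_i (`skewForm_rotate`), and ω_a(α_i, y) > 0 whenever α_i, y are such a pair of
simple roots (`IsCanonicalPair.skewForm_pos`): these are the two axioms of the c-orientations. As 1
− c is invertible, ω_a depends on c only (`eulerForm_eq_of_wordProd_eq`). Moreover no root stays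
positive under all powers of c⁻¹, so under repeated rotation every pair eventually contains the root
of the first letter (`IsCanonicalPair.rotation_induction`); this gives ω_a(x, y) ≠ 0 and the
uniqueness of the family.

Sortability obeys a recursion on the first letter s of the word (`isSortable_iff_isRecSortable`). If
s is a left descent of w, pass to sw and the rotated word; if not, delete s from the word. Alignment
obeys the same recursion. The descent case is the rotation of ω_a. In the other case one must show
that an aligned w lies in the parabolic subgroup without s. Write w = uv with u in that subgroup and
v minimal. By induction u is sortable, so its inversions have an order β₁, …, β_k with ω_a(β_p, β_q)
≥ 0 for p < q (`IsRecSortable.exists_word`). If v ≠ 1, then w⁻¹ makes uα_s negative. But uα_s arises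
from α_s by successive reflections of some θ in β_q, trivial or with ω_a(θ, β_q) > 0, so alignment
pulls negativity back to α_s and s would be a descent of w (`IsRootAligned.rep_not_nonpos`). -/

open Real in
/-- The matrix of the Tits form, normalized so that simple roots have square length `2`. -/
noncomputable def CoxeterMatrix.gram {B : Type*} (M : CoxeterMatrix B) (i j : B) : ℝ :=
  -2 * cos (π / M i j)

namespace CoxeterMatrix

variable {B : Type*} (M : CoxeterMatrix B)

theorem gram_self (i : B) : M.gram i i = 2 := by simp [gram]

theorem gram_comm (i j : B) : M.gram i j = M.gram j i := by simp [gram, M.symmetric i j]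

/-- The entry `M i j = 0` stands for infinite order. Division by zero then gives the angle 0 and the
Gram entry −2, which is the right value. -/
theorem cos_angle_nonneg {i j : B} (h : i ≠ j) : 0 ≤ Real.cos (Real.pi / M i j) := by
  have h1 := M.off_diagonal i j h
  rcases Nat.eq_zero_or_pos (M i j) with h0 | h0
  · simp [h0]
  · have h2 : (2 : ℝ) ≤ M i j := by exact_mod_cast (by omega : 2 ≤ M i j)
    apply Real.cos_nonneg_of_neg_pi_div_two_le_of_le
    · have := Real.pi_pos
      have : 0 ≤ Real.pi / M i j := by positivity
      linarith
    · exact div_le_div_of_nonneg_left Real.pi_pos.le (by norm_num) h2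

theorem gram_nonpos {i j : B} (h : i ≠ j) : M.gram i j ≤ 0 := by
  have := M.cos_angle_nonneg h
  unfold gram
  linarith

/-- The Tits form. -/
noncomputable def form : (B →₀ ℝ) →ₗ[ℝ] (B →₀ ℝ) →ₗ[ℝ] ℝ :=
  Finsupp.linearCombination ℝ fun i => Finsupp.linearCombination ℝ fun j => M.gram i j

@[simp] theorem form_single_single (i j : B) (a b : ℝ) :
    M.form (Finsupp.single i a) (Finsupp.single j b) = a * (b * M.gram i j) := by
  simp [form]

theorem form_comm (x y : B →₀ ℝ) : M.form x y = M.form y x := by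
  have : M.form = M.form.flip := by
    ext i j
    simp [M.gram_comm i j]
  conv_lhs => rw [this]
  rfl

/-- The simple reflection of the geometric representation. -/
noncomputable def simpleRefl (i : B) : Module.End ℝ (B →₀ ℝ) :=
  LinearMap.id - (M.form (Finsupp.single i 1)).smulRight (Finsupp.single i 1)

theorem simpleRefl_apply (i : B) (x : B →₀ ℝ) :
    M.simpleRefl i x = x - M.form (Finsupp.single i 1) x • Finsupp.single i 1 := rfl

theorem simpleRefl_simpleRefl (i : B) (x : B →₀ ℝ) : M.simpleRefl i (M.simpleRefl i x) = x := by
  simp only [simpleRefl_apply, map_sub, map_smul, form_single_single, gram_self]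
  module

/-- `sinSeq (2 * cos θ) k = sin (k * θ) / sin θ`. -/
def _root_.CoxeterSystem.sinSeq (κ : ℝ) : ℕ → ℝ
  | 0 => 0
  | 1 => 1
  | k + 2 => κ * sinSeq κ (k + 1) - sinSeq κ k

open CoxeterSystem

theorem _root_.CoxeterSystem.sinSeq_mul_sin (θ : ℝ) : ∀ k : ℕ,
    sinSeq (2 * Real.cos θ) k * Real.sin θ = Real.sin (k * θ)
  | 0 => by simp [sinSeq]
  | 1 => by simp [sinSeq]
  | k + 2 => by
    have h1 := CoxeterSystem.sinSeq_mul_sin θ (k + 1)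
    have h2 := CoxeterSystem.sinSeq_mul_sin θ k
    rw [sinSeq, sub_mul, h2, mul_assoc, h1]
    have e1 : ((k + 2 : ℕ) : ℝ) * θ = ((k + 1 : ℕ) : ℝ) * θ + θ := by push_cast; ring
    have e2 : (k : ℝ) * θ = ((k + 1 : ℕ) : ℝ) * θ - θ := by push_cast; ring
    rw [e1, e2, Real.sin_add, Real.sin_sub]
    ring

theorem _root_.CoxeterSystem.sinSeq_two : ∀ k : ℕ, sinSeq 2 k = k
  | 0 => by simp [sinSeq]
  | 1 => by simp [sinSeq]
  | k + 2 => by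
    rw [sinSeq, CoxeterSystem.sinSeq_two (k + 1), CoxeterSystem.sinSeq_two k]
    push_cast
    ring

theorem sin_angle_pos {i j : B} (h : i ≠ j) (h0 : M i j ≠ 0) :
    0 < Real.sin (Real.pi / M i j) := by
  have h1 := M.off_diagonal i j h
  have h2 : (2 : ℝ) ≤ M i j := by exact_mod_cast (by omega : 2 ≤ M i j)
  have := Real.pi_pos
  apply Real.sin_pos_of_pos_of_lt_pi
  · positivity
  · rw [div_lt_iff₀ (by linarith)]
    nlinarith

/-- For k ≤ m the angle kπ/m stays in [0, π]. For infinite order the sequence is k itself. -/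
theorem sinSeq_gram_nonneg {i j : B} (h : i ≠ j) (k : ℕ) (hk : M i j = 0 ∨ k ≤ M i j) :
    0 ≤ sinSeq (-M.gram i j) k := by
  have e : -M.gram i j = 2 * Real.cos (Real.pi / M i j) := by simp [gram]
  rw [e]
  by_cases h0 : M i j = 0
  · simp [h0, sinSeq_two]
  · replace hk := hk.resolve_left h0
    have h1 := sinSeq_mul_sin (Real.pi / M i j) k
    have h2 := M.sin_angle_pos h h0
    have h3 : 0 ≤ Real.sin (k * (Real.pi / M i j)) := by
      have := Real.pi_pos
      have hM : (0 : ℝ) < M i j := by exact_mod_cast Nat.pos_of_ne_zero h0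
      apply Real.sin_nonneg_of_nonneg_of_le_pi
      · positivity
      · rw [mul_div_assoc', div_le_iff₀ hM]
        have : (k : ℝ) ≤ M i j := by exact_mod_cast hk
        nlinarith
    rw [← h1] at h3
    exact nonneg_of_mul_nonneg_left h3 h2

theorem simpleRefl_comb {i j : B} (a b : ℝ) :
    M.simpleRefl j (a • Finsupp.single i 1 + b • Finsupp.single j 1) =
      a • Finsupp.single i 1 + (-M.gram i j * a - b) • Finsupp.single j 1 := by
  simp only [simpleRefl_apply, map_add, map_smul, form_single_single, gram_self,
    M.gram_comm j i]
  module

theorem simpleRefl_mul_pow_apply (i j : B) (k : ℕ) :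
    ((M.simpleRefl i * M.simpleRefl j) ^ k) (Finsupp.single i 1) =
      sinSeq (-M.gram i j) (2 * k + 1) • Finsupp.single i 1 +
        sinSeq (-M.gram i j) (2 * k) • Finsupp.single j 1 := by
  induction k with
  | zero => simp [sinSeq]
  | succ k ih =>
    rw [pow_succ', Module.End.mul_apply, ih, Module.End.mul_apply, simpleRefl_comb, add_comm,
      simpleRefl_comb, add_comm, M.gram_comm j i]
    rfl

/-- On the plane of the two simple roots the product is a rotation by 2π/m, and it fixes the
orthogonal complement of that plane. -/
theorem simpleRefl_mul_pow_self (i j : B) :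
    (M.simpleRefl i * M.simpleRefl j) ^ M i j = 1 := by
  rcases eq_or_ne i j with rfl | hij
  · ext x : 2
    simp [simpleRefl_simpleRefl]
  by_cases h0 : M i j = 0
  · simp [h0]
  have key : ∀ i j : B, i ≠ j → M i j ≠ 0 →
      ((M.simpleRefl i * M.simpleRefl j) ^ M i j) (Finsupp.single i 1) = Finsupp.single i 1 := by
    intro i j hij h0
    have hs := M.sin_angle_pos hij h0
    have hM : (M i j : ℝ) ≠ 0 := by exact_mod_cast h0
    have e : -M.gram i j = 2 * Real.cos (Real.pi / M i j) := by simp [gram]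
    have h1 := sinSeq_mul_sin (Real.pi / M i j) (2 * M i j + 1)
    have h2 := sinSeq_mul_sin (Real.pi / M i j) (2 * M i j)
    have e1 : ((2 * M i j + 1 : ℕ) : ℝ) * (Real.pi / M i j) =
        Real.pi / M i j + 2 * Real.pi := by push_cast; field_simp; ring
    have e2 : ((2 * M i j : ℕ) : ℝ) * (Real.pi / M i j) = 2 * Real.pi := by
      push_cast; field_simp
    rw [e1, Real.sin_add_two_pi] at h1
    rw [e2, Real.sin_two_pi] at h2
    rw [simpleRefl_mul_pow_apply, e, mul_right_cancel₀ hs.ne' (h1.trans (one_mul _).symm),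
      (mul_eq_zero.1 h2).resolve_right hs.ne']
    simp
  have hinv : (M.simpleRefl j * M.simpleRefl i) * (M.simpleRefl i * M.simpleRefl j) = 1 := by
    ext x : 2
    simp [simpleRefl_simpleRefl]
  have hinv' : (M.simpleRefl i * M.simpleRefl j) * (M.simpleRefl j * M.simpleRefl i) = 1 := by
    ext x : 2
    simp [simpleRefl_simpleRefl]
  have hc : Commute (M.simpleRefl i * M.simpleRefl j) (M.simpleRefl j * M.simpleRefl i) :=
    hinv'.trans hinv.symm
  have hi := key i j hij h0
  have hj : ((M.simpleRefl i * M.simpleRefl j) ^ M i j) (Finsupp.single j 1) =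
      Finsupp.single j 1 := by
    have h := key j i hij.symm (by rwa [M.symmetric])
    rw [M.symmetric] at h
    -- The power of the inverse product fixes this vector; the two powers cancel.
    nth_rw 1 [← h]
    rw [← Module.End.mul_apply, ← hc.mul_pow, hinv']
    simp
  have hperp : ∀ (k : ℕ) (z : B →₀ ℝ), M.form (Finsupp.single i 1) z = 0 →
      M.form (Finsupp.single j 1) z = 0 → ((M.simpleRefl i * M.simpleRefl j) ^ k) z = z := by
    intro k z h1 h2
    induction k with
    | zero => rfl
    | succ k ih =>
      rw [pow_succ', Module.End.mul_apply, ih, Module.End.mul_apply, simpleRefl_apply M j, h2]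
      simp [simpleRefl_apply, h1]
  have hs := M.sin_angle_pos hij h0
  set g := M.gram i j with hg
  -- The Gram determinant of the plane. It is nonzero, so v splits into a vector of the plane, with
  -- p and q from Cramer's rule, and an orthogonal one.
  have hdet : 4 - g ^ 2 ≠ 0 := by
    have : 4 - g ^ 2 = 4 * Real.sin (Real.pi / M i j) ^ 2 := by
      rw [Real.sin_sq, hg, gram]; ring
    rw [this]
    positivity
  refine LinearMap.ext fun v => ?_
  set A := M.form (Finsupp.single i 1) v with hA
  set C := M.form (Finsupp.single j 1) v with hC
  set p := (2 * A - g * C) / (4 - g ^ 2) with hp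
  set q := (2 * C - g * A) / (4 - g ^ 2) with hq
  have hz := hperp (M i j) (v - p • Finsupp.single i 1 - q • Finsupp.single j 1)
    (by
      simp only [map_sub, map_smul, form_single_single, gram_self, ← hA, ← hg, smul_eq_mul]
      rw [hp, hq]; field_simp; ring)
    (by
      simp only [map_sub, map_smul, form_single_single, gram_self, ← hC, M.gram_comm j i, ← hg,
        smul_eq_mul]
      rw [hp, hq]; field_simp; ring)
  rw [map_sub, map_sub, map_smul, map_smul, hi, hj] at hz
  simpa using hz

end CoxeterMatrix

/-! ### The action of W and the positivity of roots -/

namespace CoxeterSystem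

variable {B W : Type*} [Group W] {M : CoxeterMatrix B} (cs : CoxeterSystem M W)

theorem isLiftable_simpleRefl : M.IsLiftable M.simpleRefl :=
  fun i j => M.simpleRefl_mul_pow_self i j

/-- The geometric representation. -/
noncomputable def rep : W →* Module.End ℝ (B →₀ ℝ) :=
  cs.lift ⟨M.simpleRefl, isLiftable_simpleRefl⟩

theorem rep_simple (i : B) (x : B →₀ ℝ) : cs.rep (cs.simple i) x =
    x - M.form (Finsupp.single i 1) x • Finsupp.single i 1 := by
  rw [rep, lift_apply_simple cs isLiftable_simpleRefl, CoxeterMatrix.simpleRefl_apply]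

theorem rep_simple_eq (i : B) : cs.rep (cs.simple i) = M.simpleRefl i := by
  rw [rep, lift_apply_simple cs isLiftable_simpleRefl]

theorem rep_mul (u v : W) (x : B →₀ ℝ) : cs.rep (u * v) x = cs.rep u (cs.rep v x) := by
  simp

@[simp] theorem rep_inv_rep (w : W) (x : B →₀ ℝ) : cs.rep w⁻¹ (cs.rep w x) = x := by
  rw [← rep_mul]; simp

@[simp] theorem rep_rep_inv (w : W) (x : B →₀ ℝ) : cs.rep w (cs.rep w⁻¹ x) = x := by
  rw [← rep_mul]; simp

@[simp] theorem rep_simple_rep_simple (i : B) (x : B →₀ ℝ) :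
    cs.rep (cs.simple i) (cs.rep (cs.simple i) x) = x := by
  rw [← rep_mul]; simp

theorem rep_simple_self (i : B) :
    cs.rep (cs.simple i) (Finsupp.single i 1) = -Finsupp.single i 1 := by
  rw [rep_simple, CoxeterMatrix.form_single_single, M.gram_self]
  module

theorem form_rep_rep (w : W) (x y : B →₀ ℝ) : M.form (cs.rep w x) (cs.rep w y) = M.form x y := by
  induction w using cs.simple_induction_left with
  | one => simp
  | mul_simple_left w i ih =>
    rw [rep_mul, rep_mul, rep_simple, rep_simple, ← ih]
    simp only [map_sub, map_smul, LinearMap.sub_apply, LinearMap.smul_apply,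
      CoxeterMatrix.form_single_single, M.gram_self, smul_eq_mul,
      M.form_comm (cs.rep w x) (Finsupp.single i 1)]
    ring

theorem rep_alternatingWord (i j : B) (k : ℕ) :
    cs.rep (cs.wordProd (alternatingWord i j k)) (Finsupp.single i 1) =
      if Even k then sinSeq (-M.gram i j) (k + 1) • Finsupp.single i 1 +
        sinSeq (-M.gram i j) k • Finsupp.single j 1
      else sinSeq (-M.gram i j) k • Finsupp.single i 1 +
        sinSeq (-M.gram i j) (k + 1) • Finsupp.single j 1 := by
  induction k with
  | zero => simp [sinSeq, alternatingWord]
  | succ k ih =>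
    rw [alternatingWord_succ', wordProd_cons, rep_mul, ih, rep_simple_eq]
    by_cases hk : Even k
    · have : ¬ Even (k + 1) := by simpa [Nat.even_add_one] using hk
      simp only [if_pos hk, if_neg this]
      rw [M.simpleRefl_comb]
      rfl
    · have : Even (k + 1) := by simpa [Nat.even_add_one] using hk
      simp only [if_neg hk, if_pos this]
      rw [add_comm, M.simpleRefl_comb, add_comm, M.gram_comm j i]
      rfl

theorem nonneg_comb {x y : B →₀ ℝ} (hx : 0 ≤ x) (hy : 0 ≤ y) {a b : ℝ} (ha : 0 ≤ a) (hb : 0 ≤ b) :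
    0 ≤ a • x + b • y :=
  add_nonneg (smul_nonneg ha hx) (smul_nonneg hb hy)

/-- Split off from w, for a right descent j, the longest alternating word in i and j that ends in j.
Both letters are ascents of the shorter factor v, so induction applies to v, and the coefficients in
the plane are values of `sinSeq`. -/
theorem rep_single_nonneg (w : W) (i : B) (h : cs.length w < cs.length (w * cs.simple i)) :
    0 ≤ cs.rep w (Finsupp.single i 1) := by
  induction hn : cs.length w using Nat.strong_induction_on generalizing w i with
  | _ n ih =>
    subst hn
    by_cases hw : w = 1
    · subst hw
      simp
    obtain ⟨j, hj⟩ := cs.exists_rightDescent_of_ne_one hw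
    have hij : i ≠ j := by
      rintro rfl
      exact absurd hj (by unfold IsRightDescent; omega)
    let P : ℕ → Prop := fun k =>
      cs.length (w * (cs.wordProd (alternatingWord i j k))⁻¹) + k = cs.length w
    classical
    let k := Nat.findGreatest P (cs.length w)
    have h1 : P 1 := by
      have := (cs.isRightDescent_iff).1 hj
      simpa [P, alternatingWord, wordProd] using this
    have hlw : 1 ≤ cs.length w := by
      have := (cs.isRightDescent_iff).1 hj
      omega
    have hk1 : 1 ≤ k := Nat.le_findGreatest hlw h1
    have hPk : P k := Nat.findGreatest_spec hlw h1
    have hPk' : ¬ P (k + 1) := by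
      intro hP
      have : k + 1 ≤ cs.length w := by have := hP; simp only [P] at this; omega
      have := Nat.le_findGreatest this hP
      change k + 1 ≤ k at this
      omega
    set v := w * (cs.wordProd (alternatingWord i j k))⁻¹ with hv
    have hPk2 : cs.length v + k = cs.length w := hPk
    have hwv : w = v * cs.wordProd (alternatingWord i j k) := by simp [hv]
    -- the two ascents of `v`
    have asc1 : cs.length v < cs.length (v * cs.simple (if Even k then j else i)) := by
      have e : w * (cs.wordProd (alternatingWord i j (k + 1)))⁻¹ =
          v * cs.simple (if Even k then j else i) := by
        rw [alternatingWord_succ', wordProd_cons, mul_inv_rev, inv_simple, ← mul_assoc]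
      have : cs.length (v * cs.simple (if Even k then j else i)) + (k + 1) ≠ cs.length w := by
        rw [← e]; exact hPk'
      rcases cs.length_mul_simple v (if Even k then j else i) with h | h <;> omega
    have asc2 : cs.length v < cs.length (v * cs.simple (if Even k then i else j)) := by
      obtain ⟨k', hk'⟩ : ∃ k', k = k' + 1 := ⟨k - 1, by omega⟩
      have e : w = v * cs.simple (if Even k then i else j) *
          cs.wordProd (alternatingWord i j k') := by
        have hif : (if Even k then i else j) = if Even k' then j else i := by
          rw [hk']
          by_cases h : Even k' <;> simp [h, Nat.even_add_one]
        rw [hif, mul_assoc, ← wordProd_cons, ← alternatingWord_succ', ← hk']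
        exact hwv
      have l1 := cs.length_mul_le (v * cs.simple (if Even k then i else j))
        (cs.wordProd (alternatingWord i j k'))
      have l2 := cs.length_wordProd_le (alternatingWord i j k')
      rw [length_alternatingWord] at l2
      rw [← e] at l1
      rcases cs.length_mul_simple v (if Even k then i else j) with h | h <;> omega
    have hvi : 0 ≤ cs.rep v (Finsupp.single i 1) := by
      refine ih _ (by omega) v i ?_ rfl
      split_ifs at asc1 asc2 <;> assumption
    have hvj : 0 ≤ cs.rep v (Finsupp.single j 1) := by
      refine ih _ (by omega) v j ?_ rfl
      split_ifs at asc1 asc2 <;> assumption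
    -- If the alternating word had full length, the braid relation would let it end in i, making i a
    -- descent of w.
    have hkM : M i j = 0 ∨ k + 1 ≤ M i j := by
      by_contra! hcon
      obtain ⟨hM0, hMk⟩ := hcon
      have hred : cs.IsReduced (alternatingWord i j k) := by
        have l1 := cs.length_mul_le v (cs.wordProd (alternatingWord i j k))
        have l2 := cs.length_wordProd_le (alternatingWord i j k)
        rw [length_alternatingWord] at l2
        rw [← hwv] at l1
        rw [IsReduced, length_alternatingWord]
        omega
      have hkeq : k = M i j := by
        by_contra hne
        exact cs.not_isReduced_alternatingWord i j hM0 (by omega) hred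
      have hM1 : ∃ m, M i j = m + 1 := ⟨M i j - 1, by omega⟩
      obtain ⟨m, hm⟩ := hM1
      have e : cs.wordProd (alternatingWord i j k) =
          cs.wordProd (alternatingWord i j m) * cs.simple i := by
        have := cs.wordProd_braidWord_eq i j
        rwa [braidWord, braidWord, M.symmetric j i, ← hkeq, hkeq.trans hm,
          alternatingWord_succ j i, wordProd_concat, ← hm, ← hkeq] at this
      have l1 := cs.length_mul_le v (cs.wordProd (alternatingWord i j m))
      have l2 := cs.length_wordProd_le (alternatingWord i j m)
      rw [length_alternatingWord] at l2
      have : w * cs.simple i = v * cs.wordProd (alternatingWord i j m) := by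
        rw [hwv, e, mul_assoc, cs.simple_mul_simple_cancel_right]
      rw [this] at h
      omega
    have q1 := M.sinSeq_gram_nonneg hij k (by omega)
    have q2 := M.sinSeq_gram_nonneg hij (k + 1) hkM
    rw [hwv, rep_mul, rep_alternatingWord]
    split_ifs <;> rw [map_add, map_smul, map_smul] <;> exact nonneg_comb hvi hvj ‹_› ‹_›

end CoxeterSystem

/-! ### Roots and inversions -/

namespace CoxeterSystem

variable {B W : Type*} [Group W] {M : CoxeterMatrix B} (cs : CoxeterSystem M W)

/-- `x` is a root of the geometric representation. -/
def IsRoot (x : B →₀ ℝ) : Prop := ∃ w i, x = cs.rep w (Finsupp.single i 1)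

/-- `x` is a root such that `t` is the reflection along `x`. -/
def HasRoot (t : W) (x : B →₀ ℝ) : Prop :=
  ∃ w i, t = w * cs.simple i * w⁻¹ ∧ x = cs.rep w (Finsupp.single i 1)

variable {cs}

theorem isRoot_single (i : B) : cs.IsRoot (Finsupp.single i 1) := ⟨1, i, by simp⟩

theorem hasRoot_simple (i : B) : cs.HasRoot (cs.simple i) (Finsupp.single i 1) :=
  ⟨1, i, by simp, by simp⟩

theorem HasRoot.isRoot {t : W} {x : B →₀ ℝ} (h : cs.HasRoot t x) : cs.IsRoot x := by
  obtain ⟨w, i, -, h⟩ := h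
  exact ⟨w, i, h⟩

theorem HasRoot.isReflection {t : W} {x : B →₀ ℝ} (h : cs.HasRoot t x) : cs.IsReflection t := by
  obtain ⟨w, i, h, -⟩ := h
  exact ⟨w, i, h⟩

theorem IsRoot.exists_hasRoot {x : B →₀ ℝ} (h : cs.IsRoot x) : ∃ t, cs.HasRoot t x := by
  obtain ⟨w, i, h⟩ := h
  exact ⟨_, w, i, rfl, h⟩

theorem IsRoot.rep {x : B →₀ ℝ} (h : cs.IsRoot x) (g : W) : cs.IsRoot (cs.rep g x) := by
  obtain ⟨w, i, rfl⟩ := h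
  exact ⟨g * w, i, (cs.rep_mul _ _ _).symm⟩

theorem HasRoot.conj {t : W} {x : B →₀ ℝ} (h : cs.HasRoot t x) (g : W) :
    cs.HasRoot (g * t * g⁻¹) (cs.rep g x) := by
  obtain ⟨w, i, rfl, rfl⟩ := h
  exact ⟨g * w, i, by group, (cs.rep_mul _ _ _).symm⟩

theorem HasRoot.conj_simple {t : W} {x : B →₀ ℝ} (h : cs.HasRoot t x) (i : B) :
    cs.HasRoot (cs.simple i * t * cs.simple i) (cs.rep (cs.simple i) x) := by
  simpa using h.conj (cs.simple i)

theorem HasRoot.neg {t : W} {x : B →₀ ℝ} (h : cs.HasRoot t x) : cs.HasRoot t (-x) := by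
  obtain ⟨w, i, rfl, rfl⟩ := h
  refine ⟨w * cs.simple i, i, by simp [mul_assoc], ?_⟩
  rw [rep_mul, rep_simple_self, map_neg]

theorem IsRoot.form_self {x : B →₀ ℝ} (h : cs.IsRoot x) : M.form x x = 2 := by
  obtain ⟨w, i, rfl⟩ := h
  simp [form_rep_rep, M.gram_self]

theorem IsRoot.ne_zero {x : B →₀ ℝ} (h : cs.IsRoot x) : x ≠ 0 := by
  rintro rfl
  have := h.form_self
  simp at this

theorem HasRoot.rep_apply {t : W} {x : B →₀ ℝ} (h : cs.HasRoot t x) (y : B →₀ ℝ) :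
    cs.rep t y = y - M.form x y • x := by
  obtain ⟨w, i, rfl, rfl⟩ := h
  rw [rep_mul, rep_mul, rep_simple, map_sub, map_smul, rep_rep_inv]
  rw [← cs.form_rep_rep w (Finsupp.single i 1), rep_rep_inv]

theorem HasRoot.rep_self {t : W} {x : B →₀ ℝ} (h : cs.HasRoot t x) : cs.rep t x = -x := by
  rw [h.rep_apply, h.isRoot.form_self]
  module

theorem IsRoot.nonneg_or_nonpos {x : B →₀ ℝ} (h : cs.IsRoot x) : 0 ≤ x ∨ x ≤ 0 := by
  obtain ⟨w, i, rfl⟩ := h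
  rcases cs.length_mul_simple w i with h | h
  · exact .inl (cs.rep_single_nonneg w i (by omega))
  · right
    have := cs.rep_single_nonneg (w * cs.simple i) i (by simp; omega)
    rw [rep_mul, rep_simple_self, map_neg] at this
    exact neg_nonneg.1 this

theorem IsRoot.not_nonpos {x : B →₀ ℝ} (h : cs.IsRoot x) (h0 : 0 ≤ x) : ¬ x ≤ 0 :=
  fun h1 => h.ne_zero (le_antisymm h1 h0)

theorem IsRoot.not_nonpos_iff {x : B →₀ ℝ} (h : cs.IsRoot x) : ¬ x ≤ 0 ↔ 0 ≤ x :=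
  ⟨fun h1 => h.nonneg_or_nonpos.resolve_right h1, h.not_nonpos⟩

theorem IsReflection.exists_hasRoot {t : W} (h : cs.IsReflection t) :
    ∃ x, cs.HasRoot t x ∧ 0 ≤ x := by
  obtain ⟨w, i, rfl⟩ := h
  have h : cs.HasRoot (w * cs.simple i * w⁻¹) (cs.rep w (Finsupp.single i 1)) := ⟨w, i, rfl, rfl⟩
  rcases h.isRoot.nonneg_or_nonpos with h0 | h0
  · exact ⟨_, h, h0⟩
  · exact ⟨_, h.neg, neg_nonneg.2 h0⟩

theorem IsRoot.eq_or_eq_neg_of_smul {x y : B →₀ ℝ} (hx : cs.IsRoot x) (hy : cs.IsRoot y) {c : ℝ}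
    (h : x = c • y) : c = 1 ∨ c = -1 := by
  have h1 := hx.form_self
  rw [h] at h1
  simp only [map_smul, LinearMap.smul_apply, smul_eq_mul, hy.form_self] at h1
  have : (c - 1) * (c + 1) = 0 := by linarith
  rcases mul_eq_zero.1 this with h | h
  · left; linarith
  · right; linarith

theorem IsRoot.eq_of_smul {x y : B →₀ ℝ} (hx : cs.IsRoot x) (hy : cs.IsRoot y) (hx0 : 0 ≤ x)
    (hy0 : 0 ≤ y) {c : ℝ} (h : x = c • y) : x = y := by
  rcases hx.eq_or_eq_neg_of_smul hy h with rfl | rfl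
  · simpa using h
  · exfalso
    rw [h] at hx0
    exact hy.not_nonpos hy0 (by simpa using hx0)

theorem rep_simple_apply_of_ne {i j : B} (h : j ≠ i) (x : B →₀ ℝ) :
    cs.rep (cs.simple i) x j = x j := by
  simp [rep_simple, h.symm]

theorem IsRoot.eq_single {x : B →₀ ℝ} (hx : cs.IsRoot x) (h0 : 0 ≤ x) {i : B}
    (h : ∀ j, j ≠ i → x j = 0) : x = Finsupp.single i 1 := by
  refine hx.eq_of_smul (isRoot_single i) h0 (by simp) (c := x i) ?_
  ext j
  by_cases hj : j = i
  · simp [hj]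
  · simp [h j hj, Ne.symm hj]

/-- A simple reflection changes a single coordinate, so all the others must vanish. -/
theorem IsRoot.eq_single_of_rep_nonpos {x : B →₀ ℝ} (hx : cs.IsRoot x) (h0 : 0 ≤ x) {i : B}
    (h : cs.rep (cs.simple i) x ≤ 0) : x = Finsupp.single i 1 := by
  refine hx.eq_single h0 fun j hj => ?_
  have h1 := h j
  rw [rep_simple_apply_of_ne hj] at h1
  exact le_antisymm h1 (h0 j)

theorem IsRoot.rep_simple_nonneg {x : B →₀ ℝ} (hx : cs.IsRoot x) (h0 : 0 ≤ x) {i : B}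
    (h : x ≠ Finsupp.single i 1) : 0 ≤ cs.rep (cs.simple i) x :=
  (hx.rep _).nonneg_or_nonpos.resolve_right fun h1 => h (hx.eq_single_of_rep_nonpos h0 h1)

/-- A right descent of w ≠ 1 has its root sent to a negative one. Hence the representation is
faithful, which turns later identities in W into identities of linear maps. -/
theorem eq_one_of_rep_nonneg {w : W} (h : ∀ i, 0 ≤ cs.rep w (Finsupp.single i 1)) : w = 1 := by
  by_contra hw
  obtain ⟨i, hi⟩ := cs.exists_rightDescent_of_ne_one hw
  rw [isRightDescent_iff] at hi
  have := cs.rep_single_nonneg (w * cs.simple i) i (by simp; omega)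
  rw [rep_mul, rep_simple_self, map_neg] at this
  exact ((isRoot_single i).rep w).not_nonpos (h i) (neg_nonneg.1 this)

theorem eq_one_of_rep_eq_self {w : W} (h : ∀ x, cs.rep w x = x) : w = 1 :=
  eq_one_of_rep_nonneg (cs := cs) fun i => by rw [h]; simp

theorem eq_of_rep_eq {u v : W} (h : ∀ x, cs.rep u x = cs.rep v x) : u = v := by
  have : v⁻¹ * u = 1 := eq_one_of_rep_eq_self (cs := cs) fun x => by rw [rep_mul, h, rep_inv_rep]
  exact (inv_mul_eq_one.1 this).symm

theorem HasRoot.unique {t t' : W} {x : B →₀ ℝ} (h : cs.HasRoot t x) (h' : cs.HasRoot t' x) :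
    t = t' :=
  eq_of_rep_eq (cs := cs) fun y => by rw [h.rep_apply, h'.rep_apply]

theorem HasRoot.eq_smul {t : W} {x y : B →₀ ℝ} (h : cs.HasRoot t x) (h' : cs.HasRoot t y) :
    x = (M.form y x / 2) • y := by
  have h1 := h.rep_self
  rw [h'.rep_apply, sub_eq_iff_eq_add] at h1
  have h2 : (2 : ℝ) • x = M.form y x • y := by
    rw [two_smul]
    nth_rw 1 [h1]
    abel
  rw [div_eq_inv_mul, mul_smul, ← h2, smul_smul]
  simp

theorem HasRoot.eq {t : W} {x y : B →₀ ℝ} (h : cs.HasRoot t x) (h' : cs.HasRoot t y)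
    (hx : 0 ≤ x) (hy : 0 ≤ y) : x = y :=
  h.isRoot.eq_of_smul h'.isRoot hx hy (h.eq_smul h')

/-- Strip a left descent i from w: either x is its root, so that t is the simple reflection, or s_i
keeps x positive and the claim passes to s_i w. -/
theorem HasRoot.length_mul_lt {t w : W} {x : B →₀ ℝ} (h : cs.HasRoot t x) (h0 : 0 ≤ x)
    (hw : cs.rep w⁻¹ x ≤ 0) : cs.length (t * w) < cs.length w := by
  induction hn : cs.length w using Nat.strong_induction_on generalizing w t x with
  | _ n ih =>
    subst hn
    by_cases hw1 : w = 1
    · subst hw1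
      exact absurd (by simpa using hw) (h.isRoot.not_nonpos h0)
    obtain ⟨i, hi⟩ := cs.exists_leftDescent_of_ne_one hw1
    rw [isLeftDescent_iff] at hi
    by_cases hx : x = Finsupp.single i 1
    · subst hx
      rw [h.unique (hasRoot_simple i)]
      omega
    · have h1 := h.isRoot.rep_simple_nonneg h0 hx
      have h2 := ih (cs.length (cs.simple i * w)) (by omega) (h.conj_simple i) h1
        (w := cs.simple i * w) (by rwa [mul_inv_rev, inv_simple, rep_mul, rep_simple_rep_simple])
        rfl
      rw [mul_assoc, cs.simple_mul_simple_cancel_left, mul_assoc] at h2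
      have h3 := cs.length_simple_mul (t * w) i
      omega

theorem HasRoot.isLeftInversion_iff {t w : W} {x : B →₀ ℝ} (h : cs.HasRoot t x) (h0 : 0 ≤ x) :
    cs.IsLeftInversion w t ↔ cs.rep w⁻¹ x ≤ 0 := by
  refine ⟨fun h1 => ?_, fun h1 => ⟨h.isReflection, h.length_mul_lt h0 h1⟩⟩
  by_contra h2
  -- If w⁻¹x is positive, then (tw)⁻¹x is negative, so that w would be shorter than tw.
  rw [(h.isRoot.rep _).not_nonpos_iff] at h2
  have h3 := h.length_mul_lt (w := t * w) h0 (by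
    rw [mul_inv_rev, h.isReflection.inv, rep_mul, h.rep_self, map_neg]
    exact neg_nonpos.2 h2)
  rw [← mul_assoc, h.isReflection.mul_self, one_mul] at h3
  exact absurd h1.2 (by omega)

theorem length_simple_mul_lt_iff (w : W) (i : B) :
    cs.length (cs.simple i * w) < cs.length w ↔ cs.rep w⁻¹ (Finsupp.single i 1) ≤ 0 := by
  rw [← (hasRoot_simple i).isLeftInversion_iff (by simp)]
  exact ⟨fun h => ⟨cs.isReflection_simple i, h⟩, fun h => h.2⟩

variable (cs) in
theorem simple_injective : Function.Injective cs.simple := by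
  intro i j h
  have h1 := (hasRoot_simple (cs := cs) i).eq (h ▸ hasRoot_simple j) (by simp) (by simp)
  exact (Finsupp.single_left_inj one_ne_zero).1 h1

/-! ### Standard parabolic subgroups -/

theorem rep_apply_of_notMem {J : Set B} {w : W} (hw : w ∈ cs.standardParabolic J) {i : B}
    (hi : i ∉ J) (x : B →₀ ℝ) : cs.rep w x i = x i := by
  induction hw using Subgroup.closure_induction generalizing x with
  | mem w hw =>
    obtain ⟨j, hj, rfl⟩ := hw
    exact rep_simple_apply_of_ne (by rintro rfl; exact hi hj) x
  | one => simp
  | mul u v _ _ hu hv => rw [rep_mul, hu, hv]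
  | inv u _ hu => rw [← hu, rep_rep_inv]

theorem simple_mem_standardParabolic {J : Set B} {i : B} (hi : i ∈ J) :
    cs.simple i ∈ cs.standardParabolic J :=
  Subgroup.subset_closure ⟨i, hi, rfl⟩

theorem standardParabolic_mono {J K : Set B} (h : J ⊆ K) :
    cs.standardParabolic J ≤ cs.standardParabolic K :=
  Subgroup.closure_mono (Set.image_mono h)

theorem wordProd_mem_standardParabolic {J : Set B} {a : List B} (h : ∀ i ∈ a, i ∈ J) :
    cs.wordProd a ∈ cs.standardParabolic J := by
  induction a with
  | nil => exact one_mem _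
  | cons i a ih =>
    rw [wordProd_cons]
    exact mul_mem (simple_mem_standardParabolic (h i (by simp)))
      (ih fun j hj => h j (by simp [hj]))

/-- Right descents in J are stripped from w as long as there are any. -/
theorem exists_min_coset_rep (J : Set B) (w : W) : ∃ v u, u ∈ cs.standardParabolic J ∧ w = v * u ∧
    ∀ j ∈ J, 0 ≤ cs.rep v (Finsupp.single j 1) := by
  induction hn : cs.length w using Nat.strong_induction_on generalizing w with
  | _ n ih =>
    subst hn
    by_cases h : ∀ j ∈ J, 0 ≤ cs.rep w (Finsupp.single j 1)
    · exact ⟨w, 1, one_mem _, by simp, h⟩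
    · push Not at h
      obtain ⟨j, hj, hj'⟩ := h
      have hl : cs.length (w * cs.simple j) < cs.length w := by
        rcases cs.length_mul_simple w j with h | h
        · exact absurd (cs.rep_single_nonneg w j (by omega)) hj'
        · omega
      obtain ⟨v, u, hu, e, hv⟩ := ih _ hl (w * cs.simple j) rfl
      refine ⟨v, u * cs.simple j, mul_mem hu (simple_mem_standardParabolic hj), ?_, hv⟩
      rw [← mul_assoc, ← e, cs.simple_mul_simple_cancel_right]

theorem exists_min_coset_rep' (J : Set B) (w : W) : ∃ u v, u ∈ cs.standardParabolic J ∧ w = u * v ∧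
    ∀ j ∈ J, 0 ≤ cs.rep v⁻¹ (Finsupp.single j 1) := by
  obtain ⟨v, u, hu, e, hv⟩ := exists_min_coset_rep (cs := cs) J w⁻¹
  exact ⟨u⁻¹, v⁻¹, inv_mem hu, by rw [← mul_inv_rev, ← e, inv_inv], by simpa using hv⟩

theorem rep_nonneg_of_supported {J : Set B} {v : W}
    (hv : ∀ j ∈ J, 0 ≤ cs.rep v (Finsupp.single j 1)) {x : B →₀ ℝ} (hx : 0 ≤ x)
    (hJ : ∀ i ∉ J, x i = 0) : 0 ≤ cs.rep v x := by
  rw [← Finsupp.sum_single x, Finsupp.sum, map_sum]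
  refine Finset.sum_nonneg fun i hi => ?_
  have hiJ : i ∈ J := by
    by_contra h
    exact (Finsupp.mem_support_iff.1 hi) (hJ i h)
  rw [← mul_one (x i), ← smul_eq_mul, ← Finsupp.smul_single, map_smul]
  exact smul_nonneg (hx i) (hv i hiJ)

/-- The letters of a reduced word of an element of a standard parabolic subgroup. -/
theorem IsReduced.mem_of_mem_standardParabolic {J : Set B} {a : List B} (ha : cs.IsReduced a)
    (h : cs.wordProd a ∈ cs.standardParabolic J) : ∀ i ∈ a, i ∈ J := by
  induction a with
  | nil => simp
  | cons i a ih =>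
    have ha' : cs.IsReduced a := by simpa using ha.drop 1
    have hi : i ∈ J := by
      by_contra hi
      have h1 : cs.length (cs.simple i * cs.wordProd (i :: a)) <
          cs.length (cs.wordProd (i :: a)) := by
        rw [ha.eq, wordProd_cons, cs.simple_mul_simple_cancel_left, ha'.eq]
        simp
      rw [length_simple_mul_lt_iff] at h1
      have h2 := h1 i
      rw [rep_apply_of_notMem (inv_mem h) hi] at h2
      norm_num at h2
    have := ih ha' (by
      rw [← cs.simple_mul_simple_cancel_left i (w := cs.wordProd a), ← wordProd_cons]
      exact mul_mem (simple_mem_standardParabolic hi) h)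
    simpa [hi] using this

/-! ### Fixed vectors -/

/-- Such an x is fixed by W. The sum over W kills every simple root, because right multiplication by
s_i changes its sign there; yet it multiplies x by the order of W. -/
theorem eq_zero_of_form_eq_zero [Finite W] (cs : CoxeterSystem M W) {x : B →₀ ℝ}
    (h : ∀ i, M.form (Finsupp.single i 1) x = 0) : x = 0 := by
  have := Fintype.ofFinite W
  have hfix : ∀ w, cs.rep w x = x := by
    intro w
    induction w using cs.simple_induction_left with
    | one => simp
    | mul_simple_left w i ih => rw [rep_mul, ih, rep_simple, h i]; simp
  have hS : ∑ w : W, cs.rep w = 0 := by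
    refine Finsupp.lhom_ext' fun i => LinearMap.ext_ring ?_
    have h1 : (∑ w : W, cs.rep w) (Finsupp.single i 1) =
        -(∑ w : W, cs.rep w) (Finsupp.single i 1) := by
      conv_lhs => rw [LinearMap.sum_apply, ← Equiv.sum_comp (Equiv.mulRight (cs.simple i))]
      rw [LinearMap.sum_apply, ← Finset.sum_neg_distrib]
      refine Finset.sum_congr rfl fun w _ => ?_
      rw [Equiv.coe_mulRight, rep_mul, rep_simple_self, map_neg]
    simpa using self_eq_neg.1 h1
  have h2 : (∑ w : W, cs.rep w) x = 0 := by rw [hS]; rfl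
  rw [LinearMap.sum_apply, Finset.sum_congr rfl fun w _ => hfix w, Finset.sum_const,
    ← Nat.cast_smul_eq_nsmul ℝ, smul_eq_zero] at h2
  exact h2.resolve_left (by simp)

/-- The letters are distinct, so only the first one changes its own coordinate. A vector fixed by
the product is therefore fixed by the first letter and by the rest. -/
theorem form_eq_zero_of_rep_wordProd_eq_self {a : List B} (ha : a.Nodup) {x : B →₀ ℝ}
    (h : cs.rep (cs.wordProd a) x = x) : ∀ i ∈ a, M.form (Finsupp.single i 1) x = 0 := by
  induction a with
  | nil => simp
  | cons i a ih =>
    rw [List.nodup_cons] at ha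
    rw [wordProd_cons, rep_mul] at h
    have h1 : cs.rep (cs.wordProd a) x = cs.rep (cs.simple i) x := by
      rw [← h, rep_simple_rep_simple, h]
    have h2 : cs.rep (cs.wordProd a) x i = x i :=
      rep_apply_of_notMem (J := {j | j ∈ a}) (wordProd_mem_standardParabolic (by simp)) ha.1 x
    have h3 : M.form (Finsupp.single i 1) x = 0 := by
      rw [h1, rep_simple] at h2
      simpa using h2
    have h4 : cs.rep (cs.wordProd a) x = x := by
      rw [h1, rep_simple, h3]
      simp
    have := ih ha.2 h4
    simpa [h3] using this

theorem eq_zero_of_rep_wordProd_eq_self [Finite W] {a : List B} (ha : a.Nodup) (hf : ∀ i, i ∈ a)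
    {x : B →₀ ℝ} (h : cs.rep (cs.wordProd a) x = x) : x = 0 :=
  eq_zero_of_form_eq_zero cs fun i => form_eq_zero_of_rep_wordProd_eq_self ha h i (hf i)

/-- Otherwise the sum over the orbit under c⁻¹ is a fixed vector, hence zero, while its terms are
nonnegative and nonzero. -/
theorem exists_rep_pow_not_nonneg [Finite W] {a : List B} (ha : a.Nodup) (hf : ∀ i, i ∈ a)
    {x : B →₀ ℝ} (hx : cs.IsRoot x) : ∃ k : ℕ, ¬ 0 ≤ cs.rep ((cs.wordProd a)⁻¹ ^ k) x := by
  by_contra! hcon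
  set c := cs.wordProd a with hc
  set N := orderOf c⁻¹ with hN
  have hNpos : 0 < N := orderOf_pos _
  set y := ∑ k ∈ Finset.range N, cs.rep (c⁻¹ ^ k) x with hy
  have hfix : cs.rep c⁻¹ y = y := by
    have h1 : cs.rep c⁻¹ y = ∑ k ∈ Finset.range N, cs.rep (c⁻¹ ^ (k + 1)) x := by
      rw [hy, map_sum]
      exact Finset.sum_congr rfl fun k _ => by rw [pow_succ', rep_mul]
    have h2 := Finset.sum_range_succ' (fun k => cs.rep (c⁻¹ ^ k) x) N
    rw [Finset.sum_range_succ, pow_orderOf_eq_one, pow_zero] at h2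
    rw [h1]
    exact (add_right_cancel h2).symm
  have hy0 : y = 0 := by
    refine eq_zero_of_rep_wordProd_eq_self (cs := cs) ha hf ?_
    rw [← hc]
    nth_rw 1 [← hfix]
    rw [rep_rep_inv]
  have h3 := (Finset.sum_eq_zero_iff_of_nonneg (fun k _ => hcon k)).1 hy0 0 (by simpa using hNpos)
  exact hx.ne_zero (by simpa using h3)

end CoxeterSystem

/-! ### Irreducible rank-two parabolic subgroups -/

namespace CoxeterSystem

variable {B W : Type*} [Group W] {M : CoxeterMatrix B} (cs : CoxeterSystem M W)

/-- `x` and `y` are the simple roots of an irreducible rank-two parabolic subsystem. -/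
def IsCanonicalPair (x y : B →₀ ℝ) : Prop :=
  ∃ (g : W) (i j : B), i ≠ j ∧ M.gram i j ≠ 0 ∧ x = cs.rep g (Finsupp.single i 1) ∧
    y = cs.rep g (Finsupp.single j 1) ∧ 0 ≤ x ∧ 0 ≤ y

variable {cs}

theorem commute_simple_iff {i j : B} (hij : i ≠ j) :
    Commute (cs.simple i) (cs.simple j) ↔ M.gram i j = 0 := by
  constructor
  · intro h
    have h1 : cs.rep (cs.simple i * cs.simple j) (Finsupp.single i 1) j =
        cs.rep (cs.simple j * cs.simple i) (Finsupp.single i 1) j := by rw [h.eq]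
    simp [rep_simple, M.gram_comm j i, hij, M.gram_self] at h1
    linarith
  · intro h
    refine eq_of_rep_eq (cs := cs) fun x => ?_
    simp only [rep_mul, rep_simple, map_sub, map_smul, CoxeterMatrix.form_single_single, h,
      M.gram_comm j i]
    module

namespace IsCanonicalPair

variable {x y : B →₀ ℝ} (h : cs.IsCanonicalPair x y)
include h

theorem symm : cs.IsCanonicalPair y x := by
  obtain ⟨g, i, j, hij, hg, hx, hy, hx0, hy0⟩ := h
  exact ⟨g, j, i, hij.symm, by rwa [M.gram_comm], hy, hx, hy0, hx0⟩

theorem isRoot_left : cs.IsRoot x := by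
  obtain ⟨g, i, j, hij, hg, hx, hy, hx0, hy0⟩ := h
  exact ⟨g, i, hx⟩

theorem isRoot_right : cs.IsRoot y := h.symm.isRoot_left

theorem nonneg_left : 0 ≤ x := by
  obtain ⟨g, i, j, hij, hg, hx, hy, hx0, hy0⟩ := h
  exact hx0

theorem nonneg_right : 0 ≤ y := h.symm.nonneg_left

theorem form_neg : M.form x y < 0 := by
  obtain ⟨g, i, j, hij, hg, rfl, rfl, hx0, hy0⟩ := h
  rw [form_rep_rep]
  simpa using lt_of_le_of_ne (M.gram_nonpos hij) hg

theorem ne : x ≠ y := by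
  rintro rfl
  have := h.form_neg
  rw [h.isRoot_left.form_self] at this
  norm_num at this

/-- After transport by g⁻¹ the coefficients are coordinates of a root. -/
theorem coeff_sign {z : B →₀ ℝ} (hz : cs.IsRoot z) {a b : ℝ} (e : z = a • x + b • y) :
    (0 ≤ a ∧ 0 ≤ b) ∨ (a ≤ 0 ∧ b ≤ 0) := by
  obtain ⟨g, i, j, hij, hg, rfl, rfl, hx0, hy0⟩ := h
  have e1 : cs.rep g⁻¹ z = a • Finsupp.single i 1 + b • Finsupp.single j 1 := by
    rw [e]; simp only [map_add, map_smul, rep_inv_rep]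
  have h1 := (hz.rep g⁻¹).nonneg_or_nonpos
  rw [e1] at h1
  rcases h1 with h1 | h1
  · left
    have h2 := h1 i
    have h3 := h1 j
    simp [hij, hij.symm] at h2 h3
    exact ⟨h2, h3⟩
  · right
    have h2 := h1 i
    have h3 := h1 j
    simp [hij, hij.symm] at h2 h3
    exact ⟨h2, h3⟩

theorem coeff_nonneg {z : B →₀ ℝ} (hz : cs.IsRoot z) (hz0 : 0 ≤ z) {a b : ℝ}
    (e : z = a • x + b • y) : 0 ≤ a ∧ 0 ≤ b := by
  refine (h.coeff_sign hz e).resolve_right fun h1 => hz.not_nonpos hz0 ?_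
  rw [e, ← neg_nonneg, neg_add, ← neg_smul, ← neg_smul]
  exact nonneg_comb h.nonneg_left h.nonneg_right (by linarith) (by linarith)

/-- The transition matrix and its inverse both have nonnegative entries, so the matrix is monomial;
and a positive root is determined by its ray. -/
theorem eq_or_eq {x' y' : B →₀ ℝ} (h' : cs.IsCanonicalPair x' y')
    (hx : x' ∈ Submodule.span ℝ {x, y}) (hy : y' ∈ Submodule.span ℝ {x, y}) :
    (x' = x ∧ y' = y) ∨ (x' = y ∧ y' = x) := by
  obtain ⟨a, b, e1⟩ := Submodule.mem_span_pair.1 hx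
  obtain ⟨c, d, e2⟩ := Submodule.mem_span_pair.1 hy
  have n1 := h.coeff_nonneg h'.isRoot_left h'.nonneg_left e1.symm
  have n2 := h.coeff_nonneg h'.isRoot_right h'.nonneg_right e2.symm
  have s1 : d • x' + (-b) • y' = (a * d - b * c) • x := by rw [← e1, ← e2]; module
  have s2 : (-c) • x' + a • y' = (a * d - b * c) • y := by rw [← e1, ← e2]; module
  have hdet : a * d - b * c ≠ 0 := by
    intro h0
    rw [h0, zero_smul] at s1 s2
    have t1 : d • x' = b • y' := by
      rw [neg_smul, add_neg_eq_zero] at s1; exact s1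
    have t2 : c • x' = a • y' := by
      rw [neg_smul, add_comm, add_neg_eq_zero] at s2; exact s2.symm
    have key : ∀ p q : ℝ, p • x' = q • y' → p ≠ 0 → False := by
      intro p q e hp
      apply h'.ne
      refine h'.isRoot_left.eq_of_smul h'.isRoot_right h'.nonneg_left h'.nonneg_right
        (c := p⁻¹ * q) ?_
      rw [mul_smul, ← e, smul_smul, inv_mul_cancel₀ hp, one_smul]
    by_cases hd : d = 0
    · by_cases hc : c = 0
      · rw [hc, hd] at e2
        exact h'.isRoot_right.ne_zero (by rw [← e2]; simp)
      · exact key c a t2 hc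
    · exact key d b t1 hd
  have r1 : x = (d / (a * d - b * c)) • x' + (-b / (a * d - b * c)) • y' := by
    rw [div_eq_inv_mul, div_eq_inv_mul, mul_smul, mul_smul, ← smul_add, s1, smul_smul,
      inv_mul_cancel₀ hdet, one_smul]
  have r2 : y = (-c / (a * d - b * c)) • x' + (a / (a * d - b * c)) • y' := by
    rw [div_eq_inv_mul, div_eq_inv_mul, mul_smul, mul_smul, ← smul_add, s2, smul_smul,
      inv_mul_cancel₀ hdet, one_smul]
  have m1 := h'.coeff_nonneg h.isRoot_left h.nonneg_left r1
  have m2 := h'.coeff_nonneg h.isRoot_right h.nonneg_right r2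
  -- The entries of the inverse are d, −b, −c, a over the determinant, so its sign decides which
  -- pair vanishes.
  rcases lt_or_gt_of_ne hdet with hneg | hpos
  · right
    have hd : d = 0 := by
      by_contra hd
      exact absurd m1.1 (not_le.2 (div_neg_of_pos_of_neg (lt_of_le_of_ne n2.2 (Ne.symm hd)) hneg))
    have ha : a = 0 := by
      by_contra ha
      exact absurd m2.2 (not_le.2 (div_neg_of_pos_of_neg (lt_of_le_of_ne n1.1 (Ne.symm ha)) hneg))
    exact ⟨h'.isRoot_left.eq_of_smul h.isRoot_right h'.nonneg_left h.nonneg_right (c := b)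
        (by rw [← e1, ha]; simp),
      h'.isRoot_right.eq_of_smul h.isRoot_left h'.nonneg_right h.nonneg_left (c := c)
        (by rw [← e2, hd]; simp)⟩
  · left
    have hb : b = 0 := by
      by_contra hb
      exact absurd m1.2 (not_le.2 (div_neg_of_neg_of_pos
        (neg_neg_of_pos (lt_of_le_of_ne n1.2 (Ne.symm hb))) hpos))
    have hc : c = 0 := by
      by_contra hc
      exact absurd m2.1 (not_le.2 (div_neg_of_neg_of_pos
        (neg_neg_of_pos (lt_of_le_of_ne n2.1 (Ne.symm hc))) hpos))
    exact ⟨h'.isRoot_left.eq_of_smul h.isRoot_left h'.nonneg_left h.nonneg_left (c := a)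
        (by rw [← e1, hb]; simp),
      h'.isRoot_right.eq_of_smul h.isRoot_right h'.nonneg_right h.nonneg_right (c := d)
        (by rw [← e2, hc]; simp)⟩

end IsCanonicalPair

theorem rep_sub_self_mem_span {x y : B →₀ ℝ} {t₁ t₂ h : W} (h₁ : cs.HasRoot t₁ x)
    (h₂ : cs.HasRoot t₂ y) (hh : h ∈ Subgroup.closure {t₁, t₂}) (v : B →₀ ℝ) :
    cs.rep h v - v ∈ Submodule.span ℝ {x, y} := by
  have hx : x ∈ Submodule.span ℝ {x, y} := Submodule.subset_span (by simp)
  have hy : y ∈ Submodule.span ℝ {x, y} := Submodule.subset_span (by simp)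
  induction hh using Subgroup.closure_induction generalizing v with
  | mem t ht =>
    rcases ht with rfl | rfl
    · rw [h₁.rep_apply, sub_sub_cancel_left]
      exact neg_mem (Submodule.smul_mem _ _ hx)
    · rw [h₂.rep_apply, sub_sub_cancel_left]
      exact neg_mem (Submodule.smul_mem _ _ hy)
  | one => simp
  | mul a b _ _ ha hb =>
    rw [rep_mul, ← sub_add_sub_cancel _ (cs.rep b v)]
    exact add_mem (ha _) (hb _)
  | inv a _ ha =>
    have := ha (cs.rep a⁻¹ v)
    rw [rep_rep_inv] at this
    rw [← neg_sub]
    exact neg_mem this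

/-- Elements of the group move vectors only within the plane, and t moves z by −2z. -/
theorem HasRoot.mem_span {x y z : B →₀ ℝ} {t₁ t₂ t : W} (h : cs.HasRoot t z)
    (h₁ : cs.HasRoot t₁ x) (h₂ : cs.HasRoot t₂ y) (hh : t ∈ Subgroup.closure {t₁, t₂}) :
    z ∈ Submodule.span ℝ {x, y} := by
  have h3 := rep_sub_self_mem_span h₁ h₂ hh z
  rw [h.rep_self] at h3
  have : z = (-1 / 2 : ℝ) • (-z - z) := by module
  rw [this]
  exact Submodule.smul_mem _ _ h3

theorem rep_mem_span {x y z : B →₀ ℝ} {t₁ t₂ h : W} (h₁ : cs.HasRoot t₁ x)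
    (h₂ : cs.HasRoot t₂ y) (hh : h ∈ Subgroup.closure {t₁, t₂})
    (hz : z ∈ Submodule.span ℝ {x, y}) : cs.rep h z ∈ Submodule.span ℝ {x, y} := by
  rw [← sub_add_cancel (cs.rep h z) z]
  exact add_mem (rep_sub_self_mem_span h₁ h₂ hh z) hz

theorem map_conj_standardParabolic_pair (g : W) (i j : B) :
    (cs.standardParabolic {i, j}).map (MulAut.conj g).toMonoidHom =
      Subgroup.closure {g * cs.simple i * g⁻¹, g * cs.simple j * g⁻¹} := by
  rw [standardParabolic, MonoidHom.map_closure]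
  congr 1
  simp [Set.image_insert_eq]

theorem map_conj_mul_of_mem {H : Subgroup W} {u : W} (hu : u ∈ H) (v : W) :
    H.map (MulAut.conj (v * u)).toMonoidHom = H.map (MulAut.conj v).toMonoidHom := by
  ext z
  simp only [Subgroup.mem_map, MulEquiv.coe_toMonoidHom, MulAut.conj_apply]
  constructor
  · rintro ⟨a, ha, rfl⟩
    exact ⟨u * a * u⁻¹, mul_mem (mul_mem hu ha) (inv_mem hu), by group⟩
  · rintro ⟨a, ha, rfl⟩
    exact ⟨u⁻¹ * a * u, mul_mem (mul_mem (inv_mem hu) ha) hu, by group⟩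

/-- A minimal coset representative gives the same conjugate and makes both roots positive. -/
theorem IsIrreducibleRankTwoParabolic.exists_canonicalPair {H : Subgroup W}
    (hH : cs.IsIrreducibleRankTwoParabolic H) : ∃ x y t₁ t₂, cs.IsCanonicalPair x y ∧
      cs.HasRoot t₁ x ∧ cs.HasRoot t₂ y ∧ H = Subgroup.closure {t₁, t₂} := by
  obtain ⟨g, i, j, hij, hc, rfl⟩ := hH
  obtain ⟨v, u, hu, rfl, hv⟩ := exists_min_coset_rep (cs := cs) {i, j} g
  refine ⟨_, _, _, _, ⟨v, i, j, hij, by rwa [Ne, ← commute_simple_iff (cs := cs) hij], rfl, rfl,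
    hv i (by simp), hv j (by simp)⟩, ⟨v, i, rfl, rfl⟩, ⟨v, j, rfl, rfl⟩, ?_⟩
  rw [map_conj_mul_of_mem hu, map_conj_standardParabolic_pair]

theorem IsCanonicalPair.isIrreducibleRankTwoParabolic {x y : B →₀ ℝ} {t₁ t₂ : W}
    (h : cs.IsCanonicalPair x y) (h₁ : cs.HasRoot t₁ x) (h₂ : cs.HasRoot t₂ y) :
    cs.IsIrreducibleRankTwoParabolic (Subgroup.closure {t₁, t₂}) := by
  obtain ⟨g, i, j, hij, hg, rfl, rfl, -, -⟩ := h
  refine ⟨g, i, j, hij, by rwa [commute_simple_iff hij], ?_⟩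
  rw [map_conj_standardParabolic_pair, h₁.unique ⟨g, i, rfl, rfl⟩, h₂.unique ⟨g, j, rfl, rfl⟩]

/-- The reflection t₁ changes only the coefficient of x, so it can make a positive root of the plane
negative only if the coefficient of y is zero. -/
theorem IsCanonicalPair.left_mem_canonicalGenerators {x y : B →₀ ℝ} {t₁ t₂ : W}
    (h : cs.IsCanonicalPair x y) (h₁ : cs.HasRoot t₁ x) (h₂ : cs.HasRoot t₂ y) :
    t₁ ∈ cs.canonicalGenerators (Subgroup.closure {t₁, t₂}) := by
  refine ⟨h₁.isReflection, Subgroup.subset_closure (by simp), fun r hr hinv => ?_⟩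
  obtain ⟨z, hz, hz0⟩ := hinv.1.exists_hasRoot
  rw [hz.isLeftInversion_iff hz0, h₁.isReflection.inv] at hinv
  obtain ⟨a, b, e⟩ := Submodule.mem_span_pair.1 (hz.mem_span h₁ h₂ hr)
  have n := h.coeff_nonneg hz.isRoot hz0 e.symm
  have e2 : cs.rep t₁ z = (a - M.form x z) • x + b • y := by
    rw [h₁.rep_apply]
    nth_rw 1 [← e]
    module
  have hb : b = 0 := by
    rcases h.coeff_sign (hz.isRoot.rep t₁) e2 with hs | hs
    · exfalso
      refine (hz.isRoot.rep t₁).not_nonpos ?_ hinv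
      rw [e2]
      exact nonneg_comb h.nonneg_left h.nonneg_right hs.1 hs.2
    · linarith [hs.2, n.2]
  have hzx : z = x := hz.isRoot.eq_of_smul h.isRoot_left hz0 h.nonneg_left (c := a)
    (by rw [← e, hb]; simp)
  exact (hzx ▸ hz).unique h₁

theorem IsCanonicalPair.canonicalGenerators_eq {x y : B →₀ ℝ} {t₁ t₂ : W}
    (h : cs.IsCanonicalPair x y) (h₁ : cs.HasRoot t₁ x) (h₂ : cs.HasRoot t₂ y) :
    cs.canonicalGenerators (Subgroup.closure {t₁, t₂}) = {t₁, t₂} := by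
  have hm1 := h.left_mem_canonicalGenerators h₁ h₂
  have hm2 := h.symm.left_mem_canonicalGenerators h₂ h₁
  rw [Set.pair_comm t₂] at hm2
  refine Set.Subset.antisymm ?_ ?_
  · rintro t ⟨ht, htH, hmin⟩
    by_contra hne
    simp only [Set.mem_insert_iff, Set.mem_singleton_iff, not_or] at hne
    obtain ⟨z, hz, hz0⟩ := ht.exists_hasRoot
    obtain ⟨a, b, e⟩ := Submodule.mem_span_pair.1 (hz.mem_span h₁ h₂ htH)
    have n := h.coeff_nonneg hz.isRoot hz0 e.symm
    -- By minimality a third reflection t keeps x and y positive, hence also its own root z,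
    -- although tz = −z.
    have p1 : 0 ≤ cs.rep t x := by
      rw [← (h.isRoot_left.rep t).not_nonpos_iff]
      intro hneg
      refine hne.1 (hmin t₁ hm1.2.1 ((h₁.isLeftInversion_iff h.nonneg_left).2 ?_)).symm
      rwa [ht.inv]
    have p2 : 0 ≤ cs.rep t y := by
      rw [← (h.isRoot_right.rep t).not_nonpos_iff]
      intro hneg
      refine hne.2 (hmin t₂ hm2.2.1 ((h₂.isLeftInversion_iff h.nonneg_right).2 ?_)).symm
      rwa [ht.inv]
    have p3 : 0 ≤ cs.rep t z := by
      rw [← e, map_add, map_smul, map_smul]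
      exact nonneg_comb p1 p2 n.1 n.2
    rw [hz.rep_self] at p3
    exact hz.isRoot.not_nonpos hz0 (neg_nonneg.1 p3)
  · rintro t (rfl | rfl)
    · exact hm1
    · exact hm2

theorem IsCanonicalPair.not_commute {x y : B →₀ ℝ} {t₁ t₂ : W}
    (h : cs.IsCanonicalPair x y) (h₁ : cs.HasRoot t₁ x) (h₂ : cs.HasRoot t₂ y) :
    ¬ Commute t₁ t₂ := by
  obtain ⟨g, i, j, hij, hg, rfl, rfl, -, -⟩ := h
  rw [h₁.unique ⟨g, i, rfl, rfl⟩, h₂.unique ⟨g, j, rfl, rfl⟩, Commute.conj_iff,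
    commute_simple_iff hij]
  exact hg

end CoxeterSystem

/-! ### Orientations of rank-two parabolic subgroups -/

namespace CoxeterSystem

variable {B W : Type*} [Group W] {M : CoxeterMatrix B} {cs : CoxeterSystem M W}

/-! ### The dihedral action on the plane of two roots -/

section Dihedral

variable {x y : B →₀ ℝ} {t₁ t₂ : W}

theorem left_conj_zpow_mul (h1 : t₁ * t₁ = 1) (h2 : t₂ * t₂ = 1) (k : ℤ) :
    t₁ * ((t₁ * t₂) ^ k * t₁) * t₁⁻¹ = (t₁ * t₂) ^ (-k) * t₁ := by
  have i1 : t₁⁻¹ = t₁ := inv_eq_of_mul_eq_one_left h1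
  have i2 : t₂⁻¹ = t₂ := inv_eq_of_mul_eq_one_left h2
  have e : t₁ * (t₁ * t₂) ^ k * t₁⁻¹ = (t₁ * t₂) ^ (-k) := by
    rw [← conj_zpow, zpow_neg, ← inv_zpow, mul_inv_rev, i1, i2, ← mul_assoc, h1, one_mul]
  rw [← e]
  group

theorem right_conj_zpow_mul (h1 : t₁ * t₁ = 1) (h2 : t₂ * t₂ = 1) (k : ℤ) :
    t₂ * ((t₁ * t₂) ^ k * t₁) * t₂⁻¹ = (t₁ * t₂) ^ (-k - 2) * t₁ := by
  have i1 : t₁⁻¹ = t₁ := inv_eq_of_mul_eq_one_left h1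
  have i2 : t₂⁻¹ = t₂ := inv_eq_of_mul_eq_one_left h2
  have e : t₂ * (t₁ * t₂) ^ k * t₂⁻¹ = (t₁ * t₂) ^ (-k) := by
    rw [← conj_zpow, zpow_neg, ← inv_zpow, mul_inv_rev, i1, i2, mul_assoc t₂, mul_assoc t₁, h2,
      mul_one]
  have e2 : t₂ * t₁ = (t₁ * t₂) ^ (-1 : ℤ) := by rw [zpow_neg_one, mul_inv_rev, i1, i2]
  calc t₂ * ((t₁ * t₂) ^ k * t₁) * t₂⁻¹ = (t₂ * (t₁ * t₂) ^ k * t₂⁻¹) * (t₂ * t₁) * t₂⁻¹ := by group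
    _ = (t₁ * t₂) ^ (-k) * (t₁ * t₂) ^ (-1 : ℤ) * ((t₂ * t₁) * t₁⁻¹) := by
        rw [e, e2, ← e2]
        congr 1
        rw [mul_assoc t₂, mul_inv_cancel, mul_one, i2]
    _ = (t₁ * t₂) ^ (-k) * (t₁ * t₂) ^ (-1 : ℤ) * ((t₁ * t₂) ^ (-1 : ℤ) * t₁) := by rw [e2, i1]
    _ = (t₁ * t₂) ^ (-k - 2) * t₁ := by
        rw [← mul_assoc, ← zpow_add, ← zpow_add]
        congr 2
        ring

/-- The action of a dihedral group on its generators. -/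
theorem exists_conj_eq_zpow_mul (h₁ : cs.HasRoot t₁ x) (h₂ : cs.HasRoot t₂ y) {h : W}
    (hh : h ∈ Subgroup.closure {t₁, t₂}) : ∃ (k : ℤ) (a b c d ε : ℝ),
      cs.rep h x = a • x + b • y ∧ cs.rep h y = c • x + d • y ∧ a * d - b * c = ε ∧
      h * t₁ * h⁻¹ = (t₁ * t₂) ^ k * t₁ ∧
      ((ε = 1 ∧ h * t₂ * h⁻¹ = (t₁ * t₂) ^ (k - 1) * t₁) ∨
        (ε = -1 ∧ h * t₂ * h⁻¹ = (t₁ * t₂) ^ (k + 1) * t₁)) := by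
  have s1 := h₁.isReflection.mul_self
  have s2 := h₂.isReflection.mul_self
  -- In the numbering (t₁t₂)^k t₁ the reflection t₁ has index 0 and t₂ index −1. The determinant ε
  -- of h tells whether conjugation by h preserves or reverses the cyclic order.
  let P : W → Prop := fun h => ∃ (k : ℤ) (a b c d ε : ℝ),
    cs.rep h x = a • x + b • y ∧ cs.rep h y = c • x + d • y ∧ a * d - b * c = ε ∧
    h * t₁ * h⁻¹ = (t₁ * t₂) ^ k * t₁ ∧
    ((ε = 1 ∧ h * t₂ * h⁻¹ = (t₁ * t₂) ^ (k - 1) * t₁) ∨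
      (ε = -1 ∧ h * t₂ * h⁻¹ = (t₁ * t₂) ^ (k + 1) * t₁))
  change P h
  have L : ∀ h, P h → P (t₁ * h) := by
    rintro h ⟨k, a, b, c, d, ε, e1, e2, e3, e4, e5⟩
    have c1 : ∀ t, (t₁ * h) * t * (t₁ * h)⁻¹ = t₁ * (h * t * h⁻¹) * t₁⁻¹ := fun t => by group
    refine ⟨-k, -a - M.form x y * b, b, -c - M.form x y * d, d, -ε, ?_, ?_, ?_, ?_, ?_⟩
    · rw [rep_mul, e1, h₁.rep_apply]
      simp only [map_add, map_smul, h₁.isRoot.form_self, smul_eq_mul]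
      module
    · rw [rep_mul, e2, h₁.rep_apply]
      simp only [map_add, map_smul, h₁.isRoot.form_self, smul_eq_mul]
      module
    · rw [← e3]; ring
    · rw [c1, e4, left_conj_zpow_mul s1 s2]
    · rcases e5 with ⟨e, e5⟩ | ⟨e, e5⟩
      · right
        rw [c1, e5, left_conj_zpow_mul s1 s2, e]
        exact ⟨rfl, by congr 2; ring⟩
      · left
        rw [c1, e5, left_conj_zpow_mul s1 s2, e]
        exact ⟨by norm_num, by congr 2; ring⟩
  have R : ∀ h, P h → P (t₂ * h) := by
    rintro h ⟨k, a, b, c, d, ε, e1, e2, e3, e4, e5⟩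
    have c1 : ∀ t, (t₂ * h) * t * (t₂ * h)⁻¹ = t₂ * (h * t * h⁻¹) * t₂⁻¹ := fun t => by group
    refine ⟨-k - 2, a, -b - M.form y x * a, c, -d - M.form y x * c, -ε, ?_, ?_, ?_, ?_, ?_⟩
    · rw [rep_mul, e1, h₂.rep_apply]
      simp only [map_add, map_smul, h₂.isRoot.form_self, smul_eq_mul]
      module
    · rw [rep_mul, e2, h₂.rep_apply]
      simp only [map_add, map_smul, h₂.isRoot.form_self, smul_eq_mul]
      module
    · rw [← e3]; ring
    · rw [c1, e4, right_conj_zpow_mul s1 s2]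
    · rcases e5 with ⟨e, e5⟩ | ⟨e, e5⟩
      · right
        rw [c1, e5, right_conj_zpow_mul s1 s2, e]
        exact ⟨rfl, by congr 2; ring⟩
      · left
        rw [c1, e5, right_conj_zpow_mul s1 s2, e]
        exact ⟨by norm_num, by congr 2; ring⟩
  induction hh using Subgroup.closure_induction_left with
  | one =>
    refine ⟨0, 1, 0, 0, 1, 1, by simp, by simp, by norm_num, by simp, .inl ⟨rfl, ?_⟩⟩
    have i1 : t₁⁻¹ = t₁ := inv_eq_of_mul_eq_one_left s1
    have i2 : t₂⁻¹ = t₂ := inv_eq_of_mul_eq_one_left s2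
    rw [zero_sub, zpow_neg_one, mul_inv_rev, i1, i2, mul_assoc t₂, s1]
    simp
  | mul_left t ht h _ ih =>
    rcases ht with rfl | rfl
    · exact L h ih
    · exact R h ih
  | inv_mul_cancel t ht h _ ih =>
    rcases ht with rfl | rfl
    · rw [inv_eq_of_mul_eq_one_left s1]; exact L h ih
    · rw [inv_eq_of_mul_eq_one_left s2]; exact R h ih

end Dihedral

variable (cs) in
/-- The directed graph on the reflections defined by a skew-symmetric form. -/
def formEdge (ω : (B →₀ ℝ) →ₗ[ℝ] (B →₀ ℝ) →ₗ[ℝ] ℝ) (t t' : W) : Prop :=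
  ∃ (w : W) (i j : B), i ≠ j ∧ M.gram i j ≠ 0 ∧ t = w * cs.simple i * w⁻¹ ∧
    t' = w * cs.simple j * w⁻¹ ∧
    0 < ω (cs.rep w (Finsupp.single i 1)) (cs.rep w (Finsupp.single j 1))

/-- Neighbouring reflections in a rank-two parabolic subgroup are conjugate to the canonical
generators. -/
theorem IsCanonicalPair.exists_of_adjacent {x y : B →₀ ℝ} {t₁ t₂ : W}
    (h : cs.IsCanonicalPair x y) (h₁ : cs.HasRoot t₁ x) (h₂ : cs.HasRoot t₂ y)
    {w : W} {i j : B} (hij : i ≠ j) (hg : M.gram i j ≠ 0)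
    (hi : w * cs.simple i * w⁻¹ ∈ Subgroup.closure {t₁, t₂})
    (hj : w * cs.simple j * w⁻¹ ∈ Subgroup.closure {t₁, t₂}) :
    ∃ (k : ℤ) (a b c d : ℝ), cs.rep w (Finsupp.single i 1) = a • x + b • y ∧
      cs.rep w (Finsupp.single j 1) = c • x + d • y ∧
      w * cs.simple i * w⁻¹ = (t₁ * t₂) ^ k * t₁ ∧
      ((a * d - b * c = 1 ∧ w * cs.simple j * w⁻¹ = (t₁ * t₂) ^ (k - 1) * t₁) ∨
        (a * d - b * c = -1 ∧ w * cs.simple j * w⁻¹ = (t₁ * t₂) ^ (k + 1) * t₁)) := by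
  have hwi : cs.HasRoot (w * cs.simple i * w⁻¹) (cs.rep w (Finsupp.single i 1)) := ⟨w, i, rfl, rfl⟩
  have hwj : cs.HasRoot (w * cs.simple j * w⁻¹) (cs.rep w (Finsupp.single j 1)) := ⟨w, j, rfl, rfl⟩
  have mi := hwi.mem_span h₁ h₂ hi
  have mj := hwj.mem_span h₁ h₂ hj
  obtain ⟨v, u, hu, rfl, hv⟩ := exists_min_coset_rep (cs := cs) {i, j} w
  have hpair : cs.IsCanonicalPair (cs.rep v (Finsupp.single i 1)) (cs.rep v (Finsupp.single j 1)) :=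
    ⟨v, i, j, hij, hg, rfl, rfl, hv i (by simp), hv j (by simp)⟩
  have hvi : cs.HasRoot (v * cs.simple i * v⁻¹) (cs.rep v (Finsupp.single i 1)) := ⟨v, i, rfl, rfl⟩
  have hvj : cs.HasRoot (v * cs.simple j * v⁻¹) (cs.rep v (Finsupp.single j 1)) := ⟨v, j, rfl, rfl⟩
  have hu' : u⁻¹ ∈ Subgroup.closure {cs.simple i, cs.simple j} := by
    have := inv_mem hu
    rwa [standardParabolic, Set.image_pair] at this
  have back : ∀ z ∈ Submodule.span ℝ {Finsupp.single i (1 : ℝ), Finsupp.single j 1},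
      cs.rep v z ∈ Submodule.span ℝ {x, y} := by
    intro z hz
    have h3 := rep_mem_span (hasRoot_simple i) (hasRoot_simple j) hu' hz
    obtain ⟨p, q, e⟩ := Submodule.mem_span_pair.1 h3
    have : cs.rep v z = p • cs.rep (v * u) (Finsupp.single i 1) +
        q • cs.rep (v * u) (Finsupp.single j 1) := by
      rw [← map_smul, ← map_smul, ← map_add, e, rep_mul, rep_rep_inv]
    rw [this]
    exact add_mem (Submodule.smul_mem _ _ mi) (Submodule.smul_mem _ _ mj)
  -- The pair at the minimal representative v lies in the plane of x and y, so it is that pair up to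
  -- order.
  have key := h.eq_or_eq hpair (back _ (Submodule.subset_span (by simp)))
    (back _ (Submodule.subset_span (by simp)))
  have hh : v * u * v⁻¹ ∈ Subgroup.closure {v * cs.simple i * v⁻¹, v * cs.simple j * v⁻¹} := by
    rw [← map_conj_standardParabolic_pair]
    exact ⟨u, hu, rfl⟩
  have r : ∀ z, cs.rep (v * u) z = cs.rep (v * u * v⁻¹) (cs.rep v z) := fun z => by
    rw [← rep_mul]; simp
  have cj : ∀ s : W, v * u * s * (v * u)⁻¹ = (v * u * v⁻¹) * (v * s * v⁻¹) * (v * u * v⁻¹)⁻¹ :=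
    fun s => by group
  rcases key with ⟨ex, ey⟩ | ⟨ex, ey⟩
  · have f1 : v * cs.simple i * v⁻¹ = t₁ := hvi.unique (ex ▸ h₁)
    have f2 : v * cs.simple j * v⁻¹ = t₂ := hvj.unique (ey ▸ h₂)
    rw [f1, f2] at hh
    obtain ⟨k, a, b, c, d, ε, e1, e2, rfl, e4, e5⟩ := exists_conj_eq_zpow_mul h₁ h₂ hh
    refine ⟨k, a, b, c, d, ?_, ?_, ?_, ?_⟩
    · rw [r, ex, e1]
    · rw [r, ey, e2]
    · rw [cj, f1, e4]
    · rw [cj, f2]; exact e5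
  · have f1 : v * cs.simple i * v⁻¹ = t₂ := hvi.unique (ex ▸ h₂)
    have f2 : v * cs.simple j * v⁻¹ = t₁ := hvj.unique (ey ▸ h₁)
    rw [f1, f2, Set.pair_comm] at hh
    obtain ⟨k, a, b, c, d, ε, e1, e2, rfl, e4, e5⟩ := exists_conj_eq_zpow_mul h₁ h₂ hh
    -- With the roles exchanged, the determinant and the direction of the step both change sign.
    rcases e5 with ⟨e, e5⟩ | ⟨e, e5⟩
    · refine ⟨k - 1, c, d, a, b, by rw [r, ex, e2], by rw [r, ey, e1], by rw [cj, f1, e5],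
        .inr ⟨by linarith, ?_⟩⟩
      rw [cj, f2, e4]
      congr 2; ring
    · refine ⟨k + 1, c, d, a, b, by rw [r, ex, e2], by rw [r, ey, e1], by rw [cj, f1, e5],
        .inl ⟨by linarith, ?_⟩⟩
      rw [cj, f2, e4]
      congr 2; ring

/-! ### The reflections of a dihedral group in cyclic order -/

section Cycle

variable {x y : B →₀ ℝ} {t₁ t₂ : W}

theorem IsCanonicalPair.three_le_orderOf [Finite W] (h : cs.IsCanonicalPair x y)
    (h₁ : cs.HasRoot t₁ x) (h₂ : cs.HasRoot t₂ y) : 3 ≤ orderOf (t₁ * t₂) := by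
  have s1 := h₁.isReflection.mul_self
  have s2 := h₂.isReflection.mul_self
  have i1 := h₁.isReflection.inv
  have i2 := h₂.isReflection.inv
  have hpos := orderOf_pos (t₁ * t₂)
  have hdvd : ¬ (t₁ * t₂) ^ 2 = 1 := by
    intro hp
    apply h.not_commute h₁ h₂
    rw [pow_two] at hp
    have := eq_inv_of_mul_eq_one_left hp
    rw [mul_inv_rev, i1, i2] at this
    exact this
  by_contra hlt
  have : orderOf (t₁ * t₂) = 1 ∨ orderOf (t₁ * t₂) = 2 := by omega
  rcases this with h' | h'
  · rw [orderOf_eq_one_iff] at h'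
    exact hdvd (by rw [h', one_pow])
  · exact hdvd (by rw [← h', pow_orderOf_eq_one])

/-- Conjugation by t₁ sends the index k to −k and by t₂ to −k − 2. Together they shift it by 2, so
the indices 0 and 1 suffice. -/
theorem isReflection_zpow_mul (h₁ : cs.HasRoot t₁ x) (h₂ : cs.HasRoot t₂ y) (k : ℤ) :
    cs.IsReflection ((t₁ * t₂) ^ k * t₁) := by
  have s1 := h₁.isReflection.mul_self
  have s2 := h₂.isReflection.mul_self
  have P : ∀ k : ℤ, cs.IsReflection ((t₁ * t₂) ^ k * t₁) →
      cs.IsReflection ((t₁ * t₂) ^ (-k) * t₁) := fun k hk => by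
    rw [← left_conj_zpow_mul s1 s2]; exact hk.conj _
  have Q : ∀ k : ℤ, cs.IsReflection ((t₁ * t₂) ^ k * t₁) →
      cs.IsReflection ((t₁ * t₂) ^ (-k - 2) * t₁) := fun k hk => by
    rw [← right_conj_zpow_mul s1 s2]; exact hk.conj _
  have h0 : cs.IsReflection ((t₁ * t₂) ^ (0 : ℤ) * t₁) := by simpa using h₁.isReflection
  have h1 : cs.IsReflection ((t₁ * t₂) ^ (1 : ℤ) * t₁) := by
    have := h₂.isReflection.conj t₁
    rw [h₁.isReflection.inv] at this
    simpa using this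
  have step : ∀ k : ℤ, cs.IsReflection ((t₁ * t₂) ^ k * t₁) →
      cs.IsReflection ((t₁ * t₂) ^ (k + 2) * t₁) := fun k hk => by
    have := P _ (Q _ hk)
    rwa [show -(-k - 2) = k + 2 by ring] at this
  have step' : ∀ k : ℤ, cs.IsReflection ((t₁ * t₂) ^ k * t₁) →
      cs.IsReflection ((t₁ * t₂) ^ (k - 2) * t₁) := fun k hk => by
    have := Q _ (P _ hk)
    rwa [show -(-k) - 2 = k - 2 by ring] at this
  have both : ∀ k : ℤ, cs.IsReflection ((t₁ * t₂) ^ k * t₁) ∧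
      cs.IsReflection ((t₁ * t₂) ^ (k + 1) * t₁) := by
    intro k
    induction k using Int.induction_on with
    | zero => exact ⟨h0, h1⟩
    | succ n ih => exact ⟨ih.2, by simpa [add_assoc] using step _ ih.1⟩
    | pred n ih =>
      refine ⟨?_, by simpa using ih.1⟩
      have := step' _ ih.2
      rwa [show (-(n : ℤ) + 1 - 2) = -n - 1 by ring] at this
  exact (both k).1

theorem mem_closure_zpow_mul (t₁ t₂ : W) (k : ℤ) :
    (t₁ * t₂) ^ k * t₁ ∈ Subgroup.closure {t₁, t₂} := by
  have m1 : t₁ ∈ Subgroup.closure {t₁, t₂} := Subgroup.subset_closure (by simp)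
  have m2 : t₂ ∈ Subgroup.closure {t₁, t₂} := Subgroup.subset_closure (by simp)
  exact mul_mem (zpow_mem (mul_mem m1 m2) k) m1

/-- Every element of the dihedral group is a power of t₁t₂ or such a power times t₁. The first kind
is excluded by the parity of lengths. -/
theorem exists_eq_zpow_mul (h₁ : cs.HasRoot t₁ x) (h₂ : cs.HasRoot t₂ y) {t : W}
    (ht : cs.IsReflection t) (htH : t ∈ Subgroup.closure {t₁, t₂}) :
    ∃ k : ℤ, t = (t₁ * t₂) ^ k * t₁ := by
  have s1 := h₁.isReflection.mul_self
  have i1 := h₁.isReflection.inv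
  have i2 := h₂.isReflection.inv
  have L : ∀ k : ℤ, t₁ * (t₁ * t₂) ^ k = (t₁ * t₂) ^ (-k) * t₁ := fun k => by
    rw [← left_conj_zpow_mul s1 h₂.isReflection.mul_self]
    rw [i1, mul_assoc, mul_assoc, s1, mul_one]
  have key : (∃ k : ℤ, t = (t₁ * t₂) ^ k) ∨ ∃ k : ℤ, t = (t₁ * t₂) ^ k * t₁ := by
    clear ht
    have A : ∀ t, ((∃ k : ℤ, t = (t₁ * t₂) ^ k) ∨ ∃ k : ℤ, t = (t₁ * t₂) ^ k * t₁) →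
        ((∃ k : ℤ, t₁ * t = (t₁ * t₂) ^ k) ∨ ∃ k : ℤ, t₁ * t = (t₁ * t₂) ^ k * t₁) := by
      rintro t (⟨k, rfl⟩ | ⟨k, rfl⟩)
      · exact .inr ⟨-k, L k⟩
      · exact .inl ⟨-k, by rw [← mul_assoc, L, mul_assoc, s1, mul_one]⟩
    have A2 : ∀ t, ((∃ k : ℤ, t = (t₁ * t₂) ^ k) ∨ ∃ k : ℤ, t = (t₁ * t₂) ^ k * t₁) →
        ((∃ k : ℤ, t₂ * t = (t₁ * t₂) ^ k) ∨ ∃ k : ℤ, t₂ * t = (t₁ * t₂) ^ k * t₁) := by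
      intro t ht
      have e : t₂ * t = (t₁ * t₂) ^ (-1 : ℤ) * (t₁ * t) := by
        rw [zpow_neg_one, mul_inv_rev, i1, i2, mul_assoc, ← mul_assoc t₁, s1, one_mul]
      rw [e]
      rcases A t ht with ⟨k, e⟩ | ⟨k, e⟩ <;> rw [e]
      · exact .inl ⟨-1 + k, (zpow_add _ _ _).symm⟩
      · exact .inr ⟨-1 + k, by rw [zpow_add, mul_assoc]⟩
    induction htH using Subgroup.closure_induction_left with
    | one => exact .inl ⟨0, by simp⟩
    | mul_left t ht h _ ih =>
      rcases ht with rfl | rfl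
      · exact A h ih
      · exact A2 h ih
    | inv_mul_cancel t ht h _ ih =>
      rcases ht with rfl | rfl
      · rw [i1]; exact A h ih
      · rw [i2]; exact A2 h ih
  refine key.resolve_left ?_
  rintro ⟨k, rfl⟩
  have e1 := isReflection_zpow_mul h₁ h₂ k
  have o1 := ht.odd_length
  have o2 := e1.odd_length
  have o3 := h₁.isReflection.odd_length
  have := cs.length_mul_mod_two ((t₁ * t₂) ^ k) t₁
  rw [Nat.odd_iff] at o1 o2 o3
  omega

variable (t₁ t₂) in
theorem zpow_mul_eq_iff (k l : ℤ) : (t₁ * t₂) ^ k * t₁ = (t₁ * t₂) ^ l * t₁ ↔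
    (k : ZMod (orderOf (t₁ * t₂))) = l := by
  rw [mul_left_inj, zpow_eq_zpow_iff_modEq, ZMod.intCast_eq_intCast_iff]

/-- The reflections of a dihedral group in their cyclic order. -/
noncomputable def reflEquiv (h₁ : cs.HasRoot t₁ x) (h₂ : cs.HasRoot t₂ y) :
    ZMod (orderOf (t₁ * t₂)) ≃ {t | cs.IsReflection t ∧ t ∈ Subgroup.closure {t₁, t₂}} :=
  Equiv.ofBijective (fun k => ⟨(t₁ * t₂) ^ (k.cast : ℤ) * t₁, isReflection_zpow_mul h₁ h₂ _,
    mem_closure_zpow_mul _ _ _⟩) <| by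
    constructor
    · intro k l hkl
      have := (zpow_mul_eq_iff t₁ t₂ _ _).1 (congrArg Subtype.val hkl)
      simpa using this
    · rintro ⟨t, ht, htH⟩
      obtain ⟨k, rfl⟩ := exists_eq_zpow_mul h₁ h₂ ht htH
      exact ⟨k, Subtype.ext ((zpow_mul_eq_iff t₁ t₂ _ _).2 (by simp))⟩

theorem coe_reflEquiv_intCast (h₁ : cs.HasRoot t₁ x) (h₂ : cs.HasRoot t₂ y) (k : ℤ) :
    (reflEquiv h₁ h₂ k : W) = (t₁ * t₂) ^ k * t₁ :=
  (zpow_mul_eq_iff t₁ t₂ _ _).2 (by simp)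

theorem coe_reflEquiv_zero (h₁ : cs.HasRoot t₁ x) (h₂ : cs.HasRoot t₂ y) :
    (reflEquiv h₁ h₂ 0 : W) = t₁ := by
  have := coe_reflEquiv_intCast h₁ h₂ 0
  simpa using this

theorem coe_reflEquiv_neg_one (h₁ : cs.HasRoot t₁ x) (h₂ : cs.HasRoot t₂ y) :
    (reflEquiv h₁ h₂ (-1) : W) = t₂ := by
  have := coe_reflEquiv_intCast h₁ h₂ (-1)
  rw [zpow_neg_one, mul_inv_rev, h₁.isReflection.inv, h₂.isReflection.inv, mul_assoc,
    h₁.isReflection.mul_self, mul_one] at this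
  simpa using this

end Cycle

end CoxeterSystem

/-! ### The two directions of an orientation -/

namespace CoxeterSystem

variable {B W : Type*} [Group W] {M : CoxeterMatrix B} {cs : CoxeterSystem M W}

/-- A walk by single steps that never turns back keeps its direction. -/
theorem forall_eq_sub_one_or_forall_eq_add_one {m : ℕ} [NeZero m] {σ : ZMod m → ZMod m}
    (h : ∀ k, σ k = k - 1 ∨ σ k = k + 1) (h2 : ∀ k, σ (σ k) ≠ k) :
    (∀ k, σ k = k - 1) ∨ (∀ k, σ k = k + 1) := by
  rcases h 0 with h0 | h0
  · left
    have key : ∀ n : ℕ, σ (-(n : ZMod m)) = -(n : ZMod m) - 1 := by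
      intro n
      induction n with
      | zero => simpa using h0
      | succ n ih =>
        have e : -((n + 1 : ℕ) : ZMod m) = -(n : ZMod m) - 1 := by push_cast; ring
        rw [e]
        refine (h _).resolve_right fun h3 => h2 (-(n : ZMod m)) ?_
        rw [ih, h3]; ring
    intro k
    have := key (-k).val
    simpa using this
  · right
    have key : ∀ n : ℕ, σ (n : ZMod m) = (n : ZMod m) + 1 := by
      intro n
      induction n with
      | zero => simpa using h0
      | succ n ih =>
        have e : ((n + 1 : ℕ) : ZMod m) = (n : ZMod m) + 1 := by push_cast; ring
        rw [e]
        refine (h _).resolve_left fun h3 => h2 (n : ZMod m) ?_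
        rw [ih, h3]; ring
    intro k
    have := key k.val
    simpa using this

theorem natCast_ne_zero_of_lt {m : ℕ} {j : ℕ} (h0 : j ≠ 0) (h : j < m) : (j : ZMod m) ≠ 0 := by
  rw [Ne, ZMod.natCast_eq_zero_iff]
  exact Nat.not_dvd_of_pos_of_lt (Nat.pos_of_ne_zero h0) h

theorem two_ne_zero_zmod {m : ℕ} (h : 3 ≤ m) : (2 : ZMod m) ≠ 0 := by
  exact_mod_cast natCast_ne_zero_of_lt (m := m) (j := 2) (by norm_num) (by omega)

theorem conj_simple_ne {i j : B} (hij : i ≠ j) (w : W) :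
    w * cs.simple i * w⁻¹ ≠ w * cs.simple j * w⁻¹ := fun h =>
  hij (cs.simple_injective (mul_left_cancel (mul_right_cancel h)))

section

variable [Finite W] {x y : B →₀ ℝ} {t₁ t₂ : W}

/-- An orientation runs through a rank-two parabolic subgroup in one of two directions. -/
theorem IsOrientation.edge_iff_or_edge_iff {E : W → W → Prop} (hE : cs.IsOrientation E)
    (h : cs.IsCanonicalPair x y) (h₁ : cs.HasRoot t₁ x) (h₂ : cs.HasRoot t₂ y) :
    (∀ k l, E (reflEquiv h₁ h₂ k) (reflEquiv h₁ h₂ l) ↔ l = k - 1) ∨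
      (∀ k l, E (reflEquiv h₁ h₂ k) (reflEquiv h₁ h₂ l) ↔ l = k + 1) := by
  obtain ⟨n, e, he⟩ := hE.cycle _ (h.isIrreducibleRankTwoParabolic h₁ h₂)
  have h3 := h.three_le_orderOf h₁ h₂
  set m := orderOf (t₁ * t₂) with hm
  have : NeZero m := ⟨by omega⟩
  have hn : n = m := by
    have := Nat.card_congr (e.trans (reflEquiv h₁ h₂).symm)
    rwa [Nat.card_zmod, Nat.card_zmod] at this
  subst hn
  set φ := reflEquiv h₁ h₂ with hφ
  -- The index of the successor of reflection k along the given cycle. Edges join adjacent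
  -- reflections, so σ moves by one step.
  let σ : ZMod m → ZMod m := fun k => φ.symm (e (e.symm (φ k) + 1))
  have hσ : ∀ k l, E (φ k) (φ l) ↔ l = σ k := by
    intro k l
    have := he (e.symm (φ k)) (e.symm (φ l))
    rw [e.apply_symm_apply, e.apply_symm_apply, e.symm_apply_eq] at this
    rw [this]
    simp only [σ]
    rw [Equiv.eq_symm_apply]
  have hσ1 : ∀ k, σ k = k - 1 ∨ σ k = k + 1 := by
    intro k
    obtain ⟨⟨hne, w, i, j, ei, ej⟩, hc⟩ := hE.adjacent _ _ ((hσ k (σ k)).2 rfl)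
    have hij : i ≠ j := by
      rintro rfl
      exact hne (ei.trans ej.symm)
    rw [ei, ej, Commute.conj_iff, commute_simple_iff hij] at hc
    have mi : w * cs.simple i * w⁻¹ ∈ Subgroup.closure {t₁, t₂} := by rw [← ei]; exact (φ k).2.2
    have mj : w * cs.simple j * w⁻¹ ∈ Subgroup.closure {t₁, t₂} := by
      rw [← ej]; exact (φ (σ k)).2.2
    obtain ⟨l, a, b, c, d, -, -, e3, e4⟩ := h.exists_of_adjacent h₁ h₂ hij hc mi mj
    have ek : k = (l : ZMod m) := φ.injective (Subtype.ext (by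
      rw [ei, e3, hφ, coe_reflEquiv_intCast]))
    rcases e4 with ⟨-, e4⟩ | ⟨-, e4⟩
    · left
      refine φ.injective (Subtype.ext ?_)
      have := coe_reflEquiv_intCast h₁ h₂ (l - 1)
      push_cast at this
      rw [ej, e4, ek, hφ, this]
    · right
      refine φ.injective (Subtype.ext ?_)
      have := coe_reflEquiv_intCast h₁ h₂ (l + 1)
      push_cast at this
      rw [ej, e4, ek, hφ, this]
  -- Turning back would mean 2 = 0 modulo m, but m ≥ 3 as t₁ and t₂ do not commute.
  have hσ2 : ∀ k, σ (σ k) ≠ k := by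
    intro k hk
    simp only [σ, Equiv.apply_symm_apply, Equiv.symm_apply_apply] at hk
    rw [Equiv.symm_apply_eq, ← Equiv.eq_symm_apply, add_assoc, add_eq_left, one_add_one_eq_two]
      at hk
    exact two_ne_zero_zmod h3 hk
  rcases forall_eq_sub_one_or_forall_eq_add_one hσ1 hσ2 with H | H
  · left
    intro k l
    rw [hσ, H]
  · right
    intro k l
    rw [hσ, H]

theorem IsOrientation.or_of_isCanonicalPair {E : W → W → Prop} (hE : cs.IsOrientation E)
    (h : cs.IsCanonicalPair x y) (h₁ : cs.HasRoot t₁ x) (h₂ : cs.HasRoot t₂ y) :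
    E t₁ t₂ ∨ E t₂ t₁ := by
  have e0 := coe_reflEquiv_zero h₁ h₂
  have e1 := coe_reflEquiv_neg_one h₁ h₂
  rcases hE.edge_iff_or_edge_iff h h₁ h₂ with H | H
  · left
    have := (H 0 (-1)).2 (by ring)
    rwa [e0, e1] at this
  · right
    have := (H (-1) 0).2 (by ring)
    rwa [e0, e1] at this

theorem IsOrientation.edge_iff {E : W → W → Prop} (hE : cs.IsOrientation E)
    (h : cs.IsCanonicalPair x y) (h₁ : cs.HasRoot t₁ x) (h₂ : cs.HasRoot t₂ y) (h12 : E t₁ t₂) :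
    ∀ k l, E (reflEquiv h₁ h₂ k) (reflEquiv h₁ h₂ l) ↔ l = k - 1 := by
  refine (hE.edge_iff_or_edge_iff h h₁ h₂).resolve_right fun H => ?_
  have h0 := H 0 (-1)
  rw [coe_reflEquiv_zero, coe_reflEquiv_neg_one] at h0
  have := h0.1 h12
  refine two_ne_zero_zmod (h.three_le_orderOf h₁ h₂) ?_
  linear_combination -this

theorem IsOrientation.asymm_of_isCanonicalPair {E : W → W → Prop} (hE : cs.IsOrientation E)
    (h : cs.IsCanonicalPair x y) (h₁ : cs.HasRoot t₁ x) (h₂ : cs.HasRoot t₂ y) (h12 : E t₁ t₂) :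
    ¬ E t₂ t₁ := by
  intro h21
  have h0 := hE.edge_iff h h₁ h₂ h12 (-1) 0
  rw [coe_reflEquiv_zero, coe_reflEquiv_neg_one] at h0
  have := h0.1 h21
  refine two_ne_zero_zmod (h.three_le_orderOf h₁ h₂) ?_
  linear_combination this

end

theorem IsOrientation.exists_isCanonicalPair {E : W → W → Prop} (hE : cs.IsOrientation E)
    {t t' : W} (h : E t t') : ∃ x y t₁ t₂, cs.IsCanonicalPair x y ∧ cs.HasRoot t₁ x ∧
      cs.HasRoot t₂ y ∧ t ∈ Subgroup.closure {t₁, t₂} ∧ t' ∈ Subgroup.closure {t₁, t₂} := by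
  obtain ⟨⟨hne, w, i, j, rfl, rfl⟩, hc⟩ := hE.adjacent _ _ h
  have hij : i ≠ j := by
    rintro rfl
    exact hne rfl
  have hH : cs.IsIrreducibleRankTwoParabolic
      ((cs.standardParabolic {i, j}).map (MulAut.conj w).toMonoidHom) :=
    ⟨w, i, j, hij, by rwa [Commute.conj_iff] at hc, rfl⟩
  obtain ⟨x, y, t₁, t₂, h, h₁, h₂, e⟩ := hH.exists_canonicalPair
  rw [map_conj_standardParabolic_pair] at e
  exact ⟨x, y, t₁, t₂, h, h₁, h₂, e ▸ Subgroup.subset_closure (by simp),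
    e ▸ Subgroup.subset_closure (by simp)⟩

/-- An orientation is determined by its edges between canonical generators. -/
theorem IsOrientation.ext [Finite W] {E E' : W → W → Prop} (hE : cs.IsOrientation E)
    (hE' : cs.IsOrientation E')
    (H : ∀ x y t₁ t₂, cs.IsCanonicalPair x y → cs.HasRoot t₁ x → cs.HasRoot t₂ y →
      E t₁ t₂ → E' t₁ t₂) : E = E' := by
  have key : ∀ x y t₁ t₂, cs.IsCanonicalPair x y → cs.HasRoot t₁ x → cs.HasRoot t₂ y →
      ∀ t t', cs.IsReflection t → cs.IsReflection t' → t ∈ Subgroup.closure {t₁, t₂} →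
      t' ∈ Subgroup.closure {t₁, t₂} → (E t t' ↔ E' t t') := by
    have main : ∀ x y t₁ t₂, cs.IsCanonicalPair x y → cs.HasRoot t₁ x → cs.HasRoot t₂ y →
        E t₁ t₂ → ∀ t t', cs.IsReflection t → cs.IsReflection t' → t ∈ Subgroup.closure {t₁, t₂} →
        t' ∈ Subgroup.closure {t₁, t₂} → (E t t' ↔ E' t t') := by
      intro x y t₁ t₂ h h₁ h₂ h12 t t' ht ht' hm hm'
      have r1 := hE.edge_iff h h₁ h₂ h12
      have r2 := hE'.edge_iff h h₁ h₂ (H x y t₁ t₂ h h₁ h₂ h12)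
      obtain ⟨k, hk⟩ := (reflEquiv h₁ h₂).surjective ⟨t, ht, hm⟩
      obtain ⟨l, hl⟩ := (reflEquiv h₁ h₂).surjective ⟨t', ht', hm'⟩
      have r3 := (r1 k l).trans (r2 k l).symm
      rwa [hk, hl] at r3
    intro x y t₁ t₂ h h₁ h₂ t t' ht ht' hm hm'
    rcases hE.or_of_isCanonicalPair h h₁ h₂ with h12 | h21
    · exact main x y t₁ t₂ h h₁ h₂ h12 t t' ht ht' hm hm'
    · rw [Set.pair_comm] at hm hm'
      exact main y x t₂ t₁ h.symm h₂ h₁ h21 t t' ht ht' hm hm'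
  ext t t'
  constructor
  · intro ht
    obtain ⟨x, y, t₁, t₂, h, h₁, h₂, m1, m2⟩ := hE.exists_isCanonicalPair ht
    obtain ⟨r1, r2⟩ := hE.isReflection _ _ ht
    exact (key x y t₁ t₂ h h₁ h₂ t t' r1 r2 m1 m2).1 ht
  · intro ht
    obtain ⟨x, y, t₁, t₂, h, h₁, h₂, m1, m2⟩ := hE'.exists_isCanonicalPair ht
    obtain ⟨r1, r2⟩ := hE'.isReflection _ _ ht
    exact (key x y t₁ t₂ h h₁ h₂ t t' r1 r2 m1 m2).2 ht

/-! ### Orientations from skew-symmetric forms -/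

section

variable {ω : (B →₀ ℝ) →ₗ[ℝ] (B →₀ ℝ) →ₗ[ℝ] ℝ} (hω : ∀ x y, ω x y = -ω y x)
include hω

theorem skew_comb (x y : B →₀ ℝ) (a b c d : ℝ) :
    ω (a • x + b • y) (c • x + d • y) = (a * d - b * c) * ω x y := by
  have hx : ω x x = 0 := by have := hω x x; linarith
  have hy : ω y y = 0 := by have := hω y y; linarith
  simp only [map_add, map_smul, LinearMap.add_apply, LinearMap.smul_apply, smul_eq_mul, hx, hy,
    hω y x]
  ring

/-- A reflection of the plane has determinant −1, so conjugation by t₁ or t₂ turns the edge at k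
into the edge at 1 − k or −k − 1. Together they shift by 2, so the edges at 0 and 1 suffice. -/
theorem IsCanonicalPair.formEdge_zpow_mul {x y : B →₀ ℝ} {t₁ t₂ : W} (h : cs.IsCanonicalPair x y)
    (h₁ : cs.HasRoot t₁ x) (h₂ : cs.HasRoot t₂ y) (hpos : 0 < ω x y) (k : ℤ) :
    cs.formEdge ω ((t₁ * t₂) ^ k * t₁) ((t₁ * t₂) ^ (k - 1) * t₁) := by
  have s1 := h₁.isReflection.mul_self
  have s2 := h₂.isReflection.mul_self
  -- conjugation by either generator reverses the edges
  have rev : ∀ s z, cs.HasRoot s z → z = x ∨ z = y → ∀ t t', t ∈ Subgroup.closure {t₁, t₂} →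
      t' ∈ Subgroup.closure {t₁, t₂} → cs.formEdge ω t t' →
      cs.formEdge ω (s * t' * s⁻¹) (s * t * s⁻¹) := by
    rintro s z hs hz t t' ht ht' ⟨w, i, j, hij, hg, rfl, rfl, hp⟩
    refine ⟨s * w, j, i, hij.symm, by rwa [M.gram_comm], by group, by group, ?_⟩
    have m1 := HasRoot.mem_span (cs := cs) ⟨w, i, rfl, rfl⟩ h₁ h₂ ht
    have m2 := HasRoot.mem_span (cs := cs) ⟨w, j, rfl, rfl⟩ h₁ h₂ ht'
    obtain ⟨a, b, e1⟩ := Submodule.mem_span_pair.1 m1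
    obtain ⟨c, d, e2⟩ := Submodule.mem_span_pair.1 m2
    rw [← e1, ← e2, skew_comb hω] at hp
    rw [rep_mul, rep_mul, ← e1, ← e2]
    have fx := h.isRoot_left.form_self
    have fy := h.isRoot_right.form_self
    rcases hz with rfl | rfl
    · have r1 : cs.rep s (c • z + d • y) = (-c - M.form z y * d) • z + d • y := by
        rw [hs.rep_apply]; simp only [map_add, map_smul, fx, smul_eq_mul]; module
      have r2 : cs.rep s (a • z + b • y) = (-a - M.form z y * b) • z + b • y := by
        rw [hs.rep_apply]; simp only [map_add, map_smul, fx, smul_eq_mul]; module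
      rw [r1, r2, skew_comb hω]
      linarith
    · have r1 : cs.rep s (c • x + d • z) = c • x + (-d - M.form z x * c) • z := by
        rw [hs.rep_apply]; simp only [map_add, map_smul, fy, smul_eq_mul]; module
      have r2 : cs.rep s (a • x + b • z) = a • x + (-b - M.form z x * a) • z := by
        rw [hs.rep_apply]; simp only [map_add, map_smul, fy, smul_eq_mul]; module
      rw [r1, r2, skew_comb hω]
      linarith
  let P : ℤ → Prop := fun k => cs.formEdge ω ((t₁ * t₂) ^ k * t₁) ((t₁ * t₂) ^ (k - 1) * t₁)
  have hP1 : ∀ k, P k → P (1 - k) := by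
    intro k hk
    have := rev t₁ x h₁ (.inl rfl) _ _ (mem_closure_zpow_mul _ _ _) (mem_closure_zpow_mul _ _ _) hk
    rw [left_conj_zpow_mul s1 s2, left_conj_zpow_mul s1 s2, show -(k - 1) = 1 - k by ring] at this
    simpa [P] using this
  have hP2 : ∀ k, P k → P (-k - 1) := by
    intro k hk
    have := rev t₂ y h₂ (.inr rfl) _ _ (mem_closure_zpow_mul _ _ _) (mem_closure_zpow_mul _ _ _) hk
    rw [right_conj_zpow_mul s1 s2, right_conj_zpow_mul s1 s2,
      show -(k - 1) - 2 = -k - 1 by ring] at this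
    simpa [P, show -k - 1 - 1 = -k - 2 by ring] using this
  have h0 : P 0 := by
    obtain ⟨g, i, j, hij, hg, rfl, rfl, -, -⟩ := h
    refine ⟨g, i, j, hij, hg, ?_, ?_, hpos⟩
    · rw [zpow_zero, one_mul]
      exact h₁.unique ⟨g, i, rfl, rfl⟩
    · rw [zero_sub, zpow_neg_one, mul_inv_rev, h₁.isReflection.inv, h₂.isReflection.inv, mul_assoc,
        s1, mul_one]
      exact h₂.unique ⟨g, j, rfl, rfl⟩
  have both : ∀ k, P k ∧ P (k + 1) := by
    intro k
    induction k using Int.induction_on with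
    | zero => exact ⟨h0, by simpa using hP1 0 h0⟩
    | succ n ih =>
      refine ⟨ih.2, ?_⟩
      have := hP1 _ (hP2 _ ih.1)
      rwa [show 1 - (-(n : ℤ) - 1) = n + 1 + 1 by ring] at this
    | pred n ih =>
      refine ⟨?_, by simpa using ih.1⟩
      have := hP2 _ (hP1 _ ih.2)
      rwa [show -(1 - (-(n : ℤ) + 1)) - 1 = -n - 1 by ring] at this
  exact (both k).1

/-- The determinant in `exists_of_adjacent` is 1 for a step down and −1 for a step up, and it is the
factor by which ω x y is multiplied. -/
theorem IsCanonicalPair.formEdge_iff [Finite W] {x y : B →₀ ℝ} {t₁ t₂ : W}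
    (h : cs.IsCanonicalPair x y) (h₁ : cs.HasRoot t₁ x) (h₂ : cs.HasRoot t₂ y)
    (hpos : 0 < ω x y) (k l) :
    cs.formEdge ω (reflEquiv h₁ h₂ k) (reflEquiv h₁ h₂ l) ↔ l = k - 1 := by
  constructor
  · rintro ⟨w, i, j, hij, hg, ei, ej, hp⟩
    obtain ⟨n, a, b, c, d, e1, e2, e3, e4⟩ := h.exists_of_adjacent h₁ h₂ hij hg
      (ei ▸ (reflEquiv h₁ h₂ k).2.2) (ej ▸ (reflEquiv h₁ h₂ l).2.2)
    rw [e1, e2, skew_comb hω] at hp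
    rcases e4 with ⟨e5, e4⟩ | ⟨e5, e4⟩
    · rw [← ei, ← coe_reflEquiv_intCast h₁ h₂] at e3
      rw [← ej, ← coe_reflEquiv_intCast h₁ h₂] at e4
      have r1 := (reflEquiv h₁ h₂).injective (Subtype.ext e3)
      have r2 := (reflEquiv h₁ h₂).injective (Subtype.ext e4)
      rw [r1, r2]
      push_cast
      rfl
    · rw [e5] at hp
      linarith
  · intro e
    have := h.formEdge_zpow_mul hω h₁ h₂ hpos k.cast
    rw [← coe_reflEquiv_intCast h₁ h₂, ← coe_reflEquiv_intCast h₁ h₂] at this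
    rw [e]
    simpa using this

theorem isOrientation_formEdge [Finite W]
    (hne : ∀ x y, cs.IsCanonicalPair x y → ω x y ≠ 0) : cs.IsOrientation (cs.formEdge ω) where
  isReflection := by
    rintro _ _ ⟨w, i, j, -, -, rfl, rfl, -⟩
    exact ⟨⟨w, i, rfl⟩, ⟨w, j, rfl⟩⟩
  adjacent := by
    rintro _ _ ⟨w, i, j, hij, hg, rfl, rfl, -⟩
    refine ⟨⟨conj_simple_ne hij w, w, i, j, rfl, rfl⟩, ?_⟩
    rwa [Commute.conj_iff, commute_simple_iff hij]
  cycle := by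
    have main : ∀ x y t₁ t₂, cs.IsCanonicalPair x y → cs.HasRoot t₁ x → cs.HasRoot t₂ y →
        0 < ω x y → IsDirectedCycleOn (cs.formEdge ω)
          {t | cs.IsReflection t ∧ t ∈ Subgroup.closure {t₁, t₂}} := by
      intro x y t₁ t₂ h h₁ h₂ hpos
      -- Edges lower the index, whereas a directed cycle raises it.
      refine ⟨orderOf (t₁ * t₂), (Equiv.neg _).trans (reflEquiv h₁ h₂), fun k l => ?_⟩
      rw [Equiv.trans_apply, Equiv.trans_apply, h.formEdge_iff hω h₁ h₂ hpos]
      change -l = -k - 1 ↔ _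
      constructor
      · intro e; linear_combination -e
      · intro e; linear_combination -e
    intro H hH
    obtain ⟨x, y, t₁, t₂, h, h₁, h₂, rfl⟩ := hH.exists_canonicalPair
    rcases lt_or_gt_of_ne (hne x y h) with h0 | h0
    · rw [Set.pair_comm]
      exact main y x t₂ t₁ h.symm h₂ h₁ (by rw [hω]; linarith)
    · exact main x y t₁ t₂ h h₁ h₂ h0

end

end CoxeterSystem

/-! ### The Euler form of a Coxeter element -/

namespace CoxeterMatrix

variable {B : Type*} (M : CoxeterMatrix B)

/-- The Euler form of a word in the simple generators. -/
noncomputable def eulerForm : List B → (B →₀ ℝ) →ₗ[ℝ] (B →₀ ℝ) →ₗ[ℝ] ℝ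
  | [] => 0
  | i :: a => eulerForm a + (Finsupp.lapply i +
      (a.map fun j => M.gram j i • (Finsupp.lapply j : (B →₀ ℝ) →ₗ[ℝ] ℝ)).sum).smulRight
        (Finsupp.lapply i)

theorem eulerForm_cons_apply (i : B) (a : List B) (x y : B →₀ ℝ) :
    M.eulerForm (i :: a) x y =
      M.eulerForm a x y + (x i + (a.map fun j => M.gram j i * x j).sum) * y i := by
  have : ∀ a : List B, (a.map fun j => M.gram j i • (Finsupp.lapply j : (B →₀ ℝ) →ₗ[ℝ] ℝ)).sum x =
      (a.map fun j => M.gram j i * x j).sum := by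
    intro a
    induction a with
    | nil => simp
    | cons k a ih => simp [ih]
  simp [eulerForm, this]

theorem eulerForm_append_apply (i : B) (a : List B) (x y : B →₀ ℝ) :
    M.eulerForm (a ++ [i]) x y =
      M.eulerForm a x y + x i * (y i + (a.map fun j => M.gram i j * y j).sum) := by
  induction a with
  | nil => simp [eulerForm]
  | cons k a ih =>
    rw [List.cons_append, eulerForm_cons_apply, eulerForm_cons_apply, ih]
    simp only [List.map_append, List.map_cons, List.map_nil, List.sum_append, List.sum_cons,
      List.sum_nil]
    ring

theorem eulerForm_congr {a : List B} {x x' y y' : B →₀ ℝ} (hx : ∀ i ∈ a, x i = x' i)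
    (hy : ∀ i ∈ a, y i = y' i) : M.eulerForm a x y = M.eulerForm a x' y' := by
  induction a with
  | nil => simp [eulerForm]
  | cons i a ih =>
    rw [eulerForm_cons_apply, eulerForm_cons_apply,
      ih (fun j hj => hx j (by simp [hj])) (fun j hj => hy j (by simp [hj])), hx i (by simp),
      hy i (by simp)]
    congr 4
    exact List.map_congr_left fun j hj => by rw [hx j (by simp [hj])]

/-- The skew-symmetric form of a word in the simple generators. -/
noncomputable def skewForm (a : List B) : (B →₀ ℝ) →ₗ[ℝ] (B →₀ ℝ) →ₗ[ℝ] ℝ :=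
  M.eulerForm a - (M.eulerForm a).flip

theorem skewForm_apply (a : List B) (x y : B →₀ ℝ) :
    M.skewForm a x y = M.eulerForm a x y - M.eulerForm a y x := rfl

theorem skewForm_skew (a : List B) (x y : B →₀ ℝ) : M.skewForm a x y = -M.skewForm a y x := by
  rw [skewForm_apply, skewForm_apply]
  ring

theorem apply_eq_sum {a : List B} (ha : a.Nodup) (f : (B →₀ ℝ) →ₗ[ℝ] ℝ) {x : B →₀ ℝ}
    (hx : ∀ i ∉ a, x i = 0) : f x = (a.map fun i => x i * f (Finsupp.single i 1)).sum := by
  induction a generalizing x with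
  | nil =>
    have : x = 0 := Finsupp.ext fun i => hx i (by simp)
    simp [this]
  | cons k a ih =>
    rw [List.nodup_cons] at ha
    have h1 := ih ha.2 (x := x - Finsupp.single k (x k)) (by
      intro i hi
      by_cases hik : i = k
      · simp [hik]
      · simp [hx i (by simp [hi, hik]), Ne.symm hik])
    have h2 : f x = f (x - Finsupp.single k (x k)) + x k * f (Finsupp.single k 1) := by
      rw [← smul_eq_mul, ← map_smul, ← map_add]
      simp
    rw [h2, h1, List.map_cons, List.sum_cons, add_comm]
    congr 2
    refine List.map_congr_left fun j hj => ?_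
    have : k ≠ j := by
      rintro rfl
      exact ha.1 hj
    simp [this]

theorem form_single_eq_sum {a : List B} (ha : a.Nodup) (i : B) {x : B →₀ ℝ}
    (hx : ∀ i ∉ a, x i = 0) :
    M.form (Finsupp.single i 1) x = (a.map fun j => M.gram j i * x j).sum := by
  rw [apply_eq_sum ha _ hx]
  congr 1
  refine List.map_congr_left fun j _ => ?_
  simp [M.gram_comm i j, mul_comm]

theorem form_single_eq_two_mul_add_sum {i : B} {a : List B} (ha : (i :: a).Nodup) {x : B →₀ ℝ}
    (hx : ∀ j ∉ i :: a, x j = 0) :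
    M.form (Finsupp.single i 1) x = 2 * x i + (a.map fun j => M.gram j i * x j).sum := by
  rw [M.form_single_eq_sum ha i hx, List.map_cons, List.sum_cons, M.gram_self]

theorem skewForm_cons_of_eq_zero {i : B} {a : List B} {x y : B →₀ ℝ} (hx : x i = 0)
    (hy : y i = 0) : M.skewForm (i :: a) x y = M.skewForm a x y := by
  simp [skewForm_apply, eulerForm_cons_apply, hx, hy]

theorem skewForm_single {i : B} {a : List B} (hi : i ∉ a) (y : B →₀ ℝ) :
    M.skewForm (i :: a) (Finsupp.single i 1) y = -(a.map fun j => M.gram j i * y j).sum := by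
  have h0 : ∀ j ∈ a, (Finsupp.single i 1 : B →₀ ℝ) j = (0 : B →₀ ℝ) j := by
    intro j hj
    have : i ≠ j := by
      rintro rfl
      exact hi hj
    simp [this]
  have h1 : (a.map fun j => M.gram j i * (Finsupp.single i 1 : B →₀ ℝ) j).sum = 0 := by
    rw [List.map_congr_left (g := fun _ => (0 : ℝ)) fun j hj => by rw [h0 j hj]; simp]
    simp
  rw [skewForm_apply, eulerForm_cons_apply, eulerForm_cons_apply, h1,
    M.eulerForm_congr h0 (fun _ _ => rfl), M.eulerForm_congr (fun _ _ => rfl) h0]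
  simp

/-- An initial letter acts as a source, because its Gram entries with the other letters are
nonpositive. -/
theorem skewForm_single_nonneg {i : B} {a : List B} (hi : i ∉ a) {y : B →₀ ℝ} (hy : 0 ≤ y) :
    0 ≤ M.skewForm (i :: a) (Finsupp.single i 1) y := by
  rw [M.skewForm_single hi, neg_nonneg]
  refine (List.sum_le_card_nsmul _ 0 fun r hr => ?_).trans_eq (smul_zero _)
  obtain ⟨j, hj, rfl⟩ := List.mem_map.1 hr
  have : j ≠ i := by
    rintro rfl
    exact hi hj
  exact mul_nonpos_of_nonpos_of_nonneg (M.gram_nonpos this) (hy j)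

theorem skewForm_single_eq {i : B} {a : List B} (ha : (i :: a).Nodup) {y : B →₀ ℝ}
    (hy : ∀ j ∉ i :: a, y j = 0) : M.skewForm (i :: a) (Finsupp.single i 1) y =
      2 * y i - M.form (Finsupp.single i 1) y := by
  rw [M.skewForm_single (List.nodup_cons.1 ha).1, M.form_single_eq_two_mul_add_sum ha hy]
  ring

end CoxeterMatrix

/-! ### Rotation of the Euler form and its independence of the word -/

namespace CoxeterSystem

variable {B W : Type*} [Group W] {M : CoxeterMatrix B} {cs : CoxeterSystem M W}

/-- Only coordinate i changes, from z_i to −z_i − Σ_z with Σ_z the sum over the other letters. Then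
x_i'(y_i' + Σ_y) = (x_i + Σ_x)y_i, the contribution of i at the front. -/
theorem eulerForm_rotate {i : B} {a : List B} (ha : (i :: a).Nodup) {x y : B →₀ ℝ}
    (hx : ∀ j ∉ i :: a, x j = 0) (hy : ∀ j ∉ i :: a, y j = 0) :
    M.eulerForm (a ++ [i]) (cs.rep (cs.simple i) x) (cs.rep (cs.simple i) y) =
      M.eulerForm (i :: a) x y := by
  have hne : ∀ j ∈ a, j ≠ i := by
    rintro j hj rfl
    exact (List.nodup_cons.1 ha).1 hj
  have h1 : ∀ z, ∀ j ∈ a, cs.rep (cs.simple i) z j = z j := fun z j hj =>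
    rep_simple_apply_of_ne (hne j hj) z
  have h2 : ∀ z, (∀ j ∉ i :: a, z j = 0) → cs.rep (cs.simple i) z i =
      -z i - (a.map fun j => M.gram j i * z j).sum := by
    intro z hz
    rw [rep_simple, M.form_single_eq_two_mul_add_sum ha hz]
    simp
    ring
  have h3 : (a.map fun j => M.gram i j * cs.rep (cs.simple i) y j).sum =
      (a.map fun j => M.gram j i * y j).sum := by
    congr 1
    exact List.map_congr_left fun j hj => by rw [h1 y j hj, M.gram_comm]
  rw [CoxeterMatrix.eulerForm_append_apply, CoxeterMatrix.eulerForm_cons_apply,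
    M.eulerForm_congr (h1 x) (h1 y), h2 x hx, h2 y hy, h3]
  ring

theorem skewForm_rotate {i : B} {a : List B} (ha : (i :: a).Nodup) {x y : B →₀ ℝ}
    (hx : ∀ j ∉ i :: a, x j = 0) (hy : ∀ j ∉ i :: a, y j = 0) :
    M.skewForm (a ++ [i]) (cs.rep (cs.simple i) x) (cs.rep (cs.simple i) y) =
      M.skewForm (i :: a) x y := by
  rw [CoxeterMatrix.skewForm_apply, CoxeterMatrix.skewForm_apply, eulerForm_rotate ha hx hy,
    eulerForm_rotate ha hy hx]

/-- For a word in all letters the right-hand side is the Tits form of x and y, so the Euler form is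
the Tits form composed with the inverse of 1 − c and sees only c. -/
theorem eulerForm_sub_rep {a : List B} (ha : a.Nodup) (x y : B →₀ ℝ) :
    M.eulerForm a (x - cs.rep (cs.wordProd a) x) y =
      (a.map fun i => y i * M.form x (Finsupp.single i 1)).sum := by
  induction a with
  | nil => simp [CoxeterMatrix.eulerForm]
  | cons i a ih =>
    have hi := (List.nodup_cons.1 ha).1
    have ha' := (List.nodup_cons.1 ha).2
    set u := x - cs.rep (cs.wordProd a) x with hu
    set f := M.form (Finsupp.single i 1) (cs.rep (cs.wordProd a) x) with hf
    have husupp : ∀ j ∉ a, u j = 0 := by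
      intro j hj
      have := rep_apply_of_notMem (cs := cs) (J := {j | j ∈ a})
        (wordProd_mem_standardParabolic (a := a) (by simp)) hj x
      simp [hu, this]
    have e : x - cs.rep (cs.wordProd (i :: a)) x = u + f • Finsupp.single i 1 := by
      rw [wordProd_cons, rep_mul, rep_simple, ← hf, hu]
      abel
    have hcoord : ∀ j ∈ a, (u + f • Finsupp.single i 1 : B →₀ ℝ) j = u j := by
      intro j hj
      have : i ≠ j := by
        rintro rfl
        exact hi hj
      simp [this]
    have hsum : (a.map fun j => M.gram j i * (u + f • Finsupp.single i 1 : B →₀ ℝ) j).sum =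
        M.form (Finsupp.single i 1) x - f := by
      rw [List.map_congr_left fun j hj => by rw [hcoord j hj],
        ← M.form_single_eq_sum ha' i husupp, hu, map_sub]
    rw [e, CoxeterMatrix.eulerForm_cons_apply, hsum, M.eulerForm_congr hcoord (fun _ _ => rfl),
      ih ha']
    simp only [Finsupp.add_apply, husupp i hi, Finsupp.smul_apply, Finsupp.single_eq_same,
      List.map_cons, List.sum_cons, M.form_comm x (Finsupp.single i 1), smul_eq_mul]
    ring

theorem finite_index [Finite W] (cs : CoxeterSystem M W) : Finite B :=
  Finite.of_injective _ cs.simple_injective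

theorem eulerForm_eq_of_wordProd_eq [Finite W] {a a' : List B} (ha : a.Nodup) (hf : ∀ i, i ∈ a)
    (ha' : a'.Nodup) (hf' : ∀ i, i ∈ a') (h : cs.wordProd a = cs.wordProd a') :
    M.eulerForm a = M.eulerForm a' := by
  have := cs.finite_index
  have hinj : Function.Injective
      (LinearMap.id - cs.rep (cs.wordProd a) : Module.End ℝ (B →₀ ℝ)) := by
    rw [← LinearMap.ker_eq_bot, LinearMap.ker_eq_bot']
    intro x hx
    refine eq_zero_of_rep_wordProd_eq_self (cs := cs) ha hf ?_
    exact (sub_eq_zero.1 hx).symm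
  have hsurj := LinearMap.injective_iff_surjective.1 hinj
  refine LinearMap.ext fun z => LinearMap.ext fun y => ?_
  obtain ⟨x, rfl⟩ := hsurj z
  change M.eulerForm a (x - cs.rep (cs.wordProd a) x) y =
    M.eulerForm a' (x - cs.rep (cs.wordProd a) x) y
  conv_rhs => rw [h]
  rw [eulerForm_sub_rep ha, eulerForm_sub_rep ha',
    ← CoxeterMatrix.apply_eq_sum ha _ (fun i hi => absurd (hf i) hi),
    ← CoxeterMatrix.apply_eq_sum ha' _ (fun i hi => absurd (hf' i) hi)]

/-! ### Words of Coxeter elements -/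

/-- The letters after i preserve coordinate i, so they cannot make α_i negative. -/
theorem isReduced_of_nodup {a : List B} (ha : a.Nodup) : cs.IsReduced a := by
  induction a with
  | nil => simp [IsReduced]
  | cons i a ih =>
    have hi := (List.nodup_cons.1 ha).1
    have h1 := ih (List.nodup_cons.1 ha).2
    have h2 : ¬ cs.length (cs.simple i * cs.wordProd a) < cs.length (cs.wordProd a) := by
      rw [length_simple_mul_lt_iff]
      intro h
      have h3 := h i
      rw [rep_apply_of_notMem (J := {j | j ∈ a})
        (inv_mem (wordProd_mem_standardParabolic (by simp))) hi] at h3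
      norm_num at h3
    rw [IsReduced, wordProd_cons, List.length_cons, ← h1.eq]
    rcases cs.length_simple_mul (cs.wordProd a) i with h | h <;> omega

/-- Some reduced word of c has all letters, so every word for c must use them all; a word of the
same length has no room for repetitions. -/
theorem IsReducedWordFor.nodup_and_mem {c : W} (hc : cs.IsCoxeterElement c) {a : List B}
    (ha : cs.IsReducedWordFor a c) : a.Nodup ∧ ∀ i, i ∈ a := by
  obtain ⟨b, ⟨hb, hbc⟩, hnd, hf⟩ := hc
  obtain ⟨ha, hac⟩ := ha
  have hmem : ∀ i, i ∈ a := by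
    intro i
    refine hb.mem_of_mem_standardParabolic (J := {j | j ∈ a}) ?_ i (hf i)
    rw [hbc, ← hac]
    exact wordProd_mem_standardParabolic (by simp)
  refine ⟨?_, hmem⟩
  have h1 := (List.subperm_of_subset hnd fun i _ => hmem i).perm_of_length_le (by
    rw [← ha.eq, ← hb.eq, hac, hbc])
  exact h1.nodup_iff.1 hnd

theorem isCoxeterElement_wordProd {a : List B} (ha : a.Nodup) (hf : ∀ i, i ∈ a) :
    cs.IsCoxeterElement (cs.wordProd a) :=
  ⟨a, ⟨isReduced_of_nodup ha, rfl⟩, ha, hf⟩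

theorem nodup_rotate {i : B} {a : List B} (h : (i :: a).Nodup) : (a ++ [i]).Nodup :=
  (List.perm_append_singleton i a).nodup_iff.2 h

theorem wordProd_rotate (i : B) (a : List B) :
    cs.wordProd (a ++ [i]) = cs.simple i * cs.wordProd (i :: a) * cs.simple i := by
  rw [wordProd_append, cs.wordProd_cons i a, cs.simple_mul_simple_cancel_left]
  simp [wordProd]

/-- The vector obtained by applying successively the first letters of the rotations of a word. -/
noncomputable def rotateRep (cs : CoxeterSystem M W) : ℕ → List B → (B →₀ ℝ) → (B →₀ ℝ)
  | 0, _, x => x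
  | _ + 1, [], x => x
  | n + 1, i :: a, x => rotateRep cs n (a ++ [i]) (cs.rep (cs.simple i) x)

theorem rotateRep_append (n : ℕ) (a b : List B) (x : B →₀ ℝ) :
    cs.rotateRep (a.length + n) (a ++ b) x =
      cs.rotateRep n (b ++ a) (cs.rep (cs.wordProd a)⁻¹ x) := by
  induction a generalizing b x with
  | nil => simp
  | cons i a ih =>
    rw [List.length_cons, Nat.add_right_comm, List.cons_append, rotateRep, List.append_assoc, ih,
      wordProd_cons, mul_inv_rev, inv_simple, rep_mul]
    simp

theorem rotateRep_mul_length (k : ℕ) (a : List B) (x : B →₀ ℝ) :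
    cs.rotateRep (k * a.length) a x = cs.rep ((cs.wordProd a)⁻¹ ^ k) x := by
  induction k generalizing x with
  | zero => simp [rotateRep]
  | succ k ih =>
    have := rotateRep_append (cs := cs) (k * a.length) a [] x
    rw [List.append_nil, List.nil_append] at this
    rw [Nat.succ_mul, Nat.add_comm, this, ih, pow_succ, rep_mul]

theorem IsCanonicalPair.rep_simple {x y : B →₀ ℝ} (h : cs.IsCanonicalPair x y) {i : B}
    (hx : x ≠ Finsupp.single i 1) (hy : y ≠ Finsupp.single i 1) :
    cs.IsCanonicalPair (cs.rep (cs.simple i) x) (cs.rep (cs.simple i) y) := by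
  have hx0 := h.isRoot_left.rep_simple_nonneg h.nonneg_left hx
  have hy0 := h.isRoot_right.rep_simple_nonneg h.nonneg_right hy
  obtain ⟨g, j, k, hjk, hg, rfl, rfl, -, -⟩ := h
  exact ⟨cs.simple i * g, j, k, hjk, hg, (cs.rep_mul _ _ _).symm, (cs.rep_mul _ _ _).symm, hx0, hy0⟩

/-- Moving the first letter of a Coxeter word to its end, every canonical pair of roots will
eventually contain the root of the first letter. -/
theorem IsCanonicalPair.rotation_induction [Finite W]
    {P : List B → (B →₀ ℝ) → (B →₀ ℝ) → Prop}
    (left : ∀ i a y, (i :: a).Nodup → (∀ j, j ∈ i :: a) →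
      cs.IsCanonicalPair (Finsupp.single i 1) y → P (i :: a) (Finsupp.single i 1) y)
    (right : ∀ i a x, (i :: a).Nodup → (∀ j, j ∈ i :: a) →
      cs.IsCanonicalPair x (Finsupp.single i 1) → P (i :: a) x (Finsupp.single i 1))
    (rotate : ∀ i a x y, (i :: a).Nodup → (∀ j, j ∈ i :: a) → cs.IsCanonicalPair x y →
      cs.IsCanonicalPair (cs.rep (cs.simple i) x) (cs.rep (cs.simple i) y) →
      P (a ++ [i]) (cs.rep (cs.simple i) x) (cs.rep (cs.simple i) y) → P (i :: a) x y)
    {a : List B} {x y : B →₀ ℝ} (ha : a.Nodup) (hf : ∀ i, i ∈ a) (h : cs.IsCanonicalPair x y) :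
    P a x y := by
  -- One full turn of rotations applies c⁻¹, and k turns make x negative. A simple reflection does
  -- this only to its own root, so the first letter must hit x or y within k turns.
  obtain ⟨k, hk⟩ := exists_rep_pow_not_nonneg ha hf h.isRoot_left
  rw [← rotateRep_mul_length] at hk
  generalize k * a.length = n at hk
  induction n generalizing a x y with
  | zero => exact absurd h.nonneg_left hk
  | succ n ih =>
    match a with
    | [] =>
      obtain ⟨-, i, -⟩ := h.isRoot_left
      exact absurd (hf i) (by simp)
    | i :: a =>
      by_cases hx : x = Finsupp.single i 1
      · subst hx
        exact left i a y ha hf h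
      by_cases hy : y = Finsupp.single i 1
      · subst hy
        exact right i a x ha hf h
      have h' := h.rep_simple hx hy
      exact rotate i a x y ha hf h h' (ih (nodup_rotate ha) (fun j => by
        have := hf j
        simp only [List.mem_cons, List.mem_append, List.not_mem_nil, or_false] at this ⊢
        tauto) h' hk)

theorem IsCanonicalPair.skewForm_pos {i : B} {a : List B} {y : B →₀ ℝ} (ha : (i :: a).Nodup)
    (hf : ∀ j, j ∈ i :: a) (h : cs.IsCanonicalPair (Finsupp.single i 1) y) :
    0 < M.skewForm (i :: a) (Finsupp.single i 1) y := by
  rw [M.skewForm_single_eq ha fun j hj => absurd (hf j) hj]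
  have h1 := h.form_neg
  have h2 : 0 ≤ y i := h.nonneg_right i
  linarith

/-- Rotation preserves the value until the pair contains the root of the first letter, where the
sign is known. -/
theorem IsCanonicalPair.skewForm_ne_zero [Finite W] {a : List B} {x y : B →₀ ℝ} (ha : a.Nodup)
    (hf : ∀ i, i ∈ a) (h : cs.IsCanonicalPair x y) : M.skewForm a x y ≠ 0 := by
  refine h.rotation_induction (P := fun a x y => M.skewForm a x y ≠ 0) ?_ ?_ ?_ ha hf
  · intro i a y ha hf h
    exact (h.skewForm_pos ha hf).ne'
  · intro i a x ha hf h
    rw [M.skewForm_skew, neg_ne_zero]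
    exact (h.symm.skewForm_pos ha hf).ne'
  · intro i a x y ha hf _ _ h
    rwa [skewForm_rotate ha (fun j hj => absurd (hf j) hj) (fun j hj => absurd (hf j) hj)] at h

end CoxeterSystem

/-! ### The family of orientations -/

namespace CoxeterSystem

variable {B W : Type*} [Group W] {M : CoxeterMatrix B} {cs : CoxeterSystem M W}

theorem IsCanonicalPair.formEdge {ω : (B →₀ ℝ) →ₗ[ℝ] (B →₀ ℝ) →ₗ[ℝ] ℝ} {x y : B →₀ ℝ}
    {t₁ t₂ : W} (h : cs.IsCanonicalPair x y) (h₁ : cs.HasRoot t₁ x) (h₂ : cs.HasRoot t₂ y)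
    (hpos : 0 < ω x y) : cs.formEdge ω t₁ t₂ := by
  obtain ⟨g, i, j, hij, hg, rfl, rfl, -, -⟩ := h
  exact ⟨g, i, j, hij, hg, h₁.unique ⟨g, i, rfl, rfl⟩, h₂.unique ⟨g, j, rfl, rfl⟩, hpos⟩

theorem isOrientation_formEdge_skewForm [Finite W] {a : List B} (ha : a.Nodup)
    (hf : ∀ i, i ∈ a) : cs.IsOrientation (cs.formEdge (M.skewForm a)) :=
  isOrientation_formEdge (M.skewForm_skew a) fun _ _ h => h.skewForm_ne_zero ha hf

/-- An edge may be witnessed by roots other than x and y, so the forward direction goes through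
nonvanishing and the asymmetry of orientations. -/
theorem IsCanonicalPair.formEdge_iff_pos [Finite W] {a : List B} (ha : a.Nodup)
    (hf : ∀ i, i ∈ a) {x y : B →₀ ℝ} {t₁ t₂ : W} (h : cs.IsCanonicalPair x y)
    (h₁ : cs.HasRoot t₁ x) (h₂ : cs.HasRoot t₂ y) :
    cs.formEdge (M.skewForm a) t₁ t₂ ↔ 0 < M.skewForm a x y := by
  refine ⟨fun h12 => ?_, h.formEdge h₁ h₂⟩
  by_contra hle
  have hlt : M.skewForm a x y < 0 := lt_of_le_of_ne (not_lt.1 hle) (h.skewForm_ne_zero ha hf)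
  refine (isOrientation_formEdge_skewForm ha hf).asymm_of_isCanonicalPair h h₁ h₂ h12 ?_
  refine h.symm.formEdge h₂ h₁ ?_
  rw [M.skewForm_skew]
  linarith

variable (cs) in
/-- The `c`-orientation. -/
noncomputable def cOrientation (c : {c : W // cs.IsCoxeterElement c}) : W → W → Prop :=
  cs.formEdge (M.skewForm c.2.choose)

theorem cOrientation_eq [Finite W] (c : {c : W // cs.IsCoxeterElement c}) {a : List B}
    (ha : cs.IsReducedWordFor a (c : W)) : cs.cOrientation c = cs.formEdge (M.skewForm a) := by
  obtain ⟨h1, h2, h3⟩ := c.2.choose_spec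
  obtain ⟨h4, h5⟩ := ha.nodup_and_mem c.2
  rw [cOrientation, CoxeterMatrix.skewForm, CoxeterMatrix.skewForm,
    eulerForm_eq_of_wordProd_eq (cs := cs) h2 h3 h4 h5 (h1.2.trans ha.2.symm)]

theorem mem_rotate {i : B} {a : List B} (hf : ∀ j, j ∈ i :: a) : ∀ j, j ∈ a ++ [i] := fun j =>
  (List.perm_append_singleton i a).mem_iff.2 (hf j)

theorem isCOrientationFamily_cOrientation [Finite W] : cs.IsCOrientationFamily cs.cOrientation where
  isOrientation c := by
    obtain ⟨a, ha, -⟩ := c.2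
    obtain ⟨h1, h2⟩ := ha.nodup_and_mem c.2
    rw [cOrientation_eq c ha]
    exact isOrientation_formEdge_skewForm h1 h2
  initial := by
    rintro c i ⟨a, ha⟩ H hH t hcan
    obtain ⟨h3, h4⟩ := ha.nodup_and_mem c.2
    rw [cOrientation_eq c ha]
    obtain ⟨x, y, t₁, t₂, h, h₁, h₂, rfl⟩ := hH.exists_canonicalPair
    rw [h.canonicalGenerators_eq h₁ h₂, Set.pair_eq_pair_iff] at hcan
    rcases hcan with ⟨rfl, rfl⟩ | ⟨rfl, rfl⟩
    · have hx := h₁.eq (hasRoot_simple i) h.nonneg_left (by simp)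
      subst hx
      exact h.formEdge h₁ h₂ (h.skewForm_pos h3 h4)
    · have hy := h₂.eq (hasRoot_simple i) h.nonneg_right (by simp)
      subst hy
      exact h.symm.formEdge h₂ h₁ (h.symm.skewForm_pos h3 h4)
  conj := by
    rintro c c' i ⟨a, ha⟩ hc t₁ t₂ ht
    obtain ⟨h3, h4⟩ := ha.nodup_and_mem c.2
    have ha' : cs.IsReducedWordFor (a ++ [i]) (c' : W) :=
      ⟨isReduced_of_nodup (nodup_rotate h3), by rw [wordProd_rotate, ha.2, hc]⟩
    rw [cOrientation_eq c ha] at ht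
    rw [cOrientation_eq c' ha']
    obtain ⟨w, j, k, hjk, hg, rfl, rfl, hpos⟩ := ht
    refine ⟨cs.simple i * w, j, k, hjk, hg, by simp [mul_assoc], by simp [mul_assoc], ?_⟩
    rwa [rep_mul, rep_mul, skewForm_rotate h3 (fun j hj => absurd (h4 j) hj)
      (fun j hj => absurd (h4 j) hj)]

theorem IsCOrientationFamily.edge_of_skewForm_pos [Finite W]
    {O : {c : W // cs.IsCoxeterElement c} → W → W → Prop} (hO : cs.IsCOrientationFamily O)
    {a : List B} (ha : a.Nodup) (hf : ∀ i, i ∈ a) {x y : B →₀ ℝ} (h : cs.IsCanonicalPair x y) :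
    ∀ c : {c : W // cs.IsCoxeterElement c}, (c : W) = cs.wordProd a → ∀ t₁ t₂, cs.HasRoot t₁ x →
      cs.HasRoot t₂ y → 0 < M.skewForm a x y → O c t₁ t₂ := by
  refine h.rotation_induction (P := fun a x y => ∀ c : {c : W // cs.IsCoxeterElement c},
    (c : W) = cs.wordProd a → ∀ t₁ t₂, cs.HasRoot t₁ x → cs.HasRoot t₂ y →
      0 < M.skewForm a x y → O c t₁ t₂) ?_ ?_ ?_ ha hf
  · intro i a y ha hf h c hc t₁ t₂ h₁ h₂ _
    have := h₁.unique (hasRoot_simple i)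
    subst this
    exact hO.initial c i ⟨a, isReduced_of_nodup ha, hc.symm⟩ _
      (h.isIrreducibleRankTwoParabolic h₁ h₂) t₂ (h.canonicalGenerators_eq h₁ h₂)
  · intro i a x ha hf h c hc t₁ t₂ h₁ h₂ hpos
    have := h.symm.skewForm_pos ha hf
    rw [M.skewForm_skew] at this
    linarith
  · intro i a x y ha hf h h' ih c hc t₁ t₂ h₁ h₂ hpos
    rw [← skewForm_rotate (cs := cs) ha (fun j hj => absurd (hf j) hj)
      (fun j hj => absurd (hf j) hj)] at hpos
    let c' : {c : W // cs.IsCoxeterElement c} :=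
      ⟨cs.wordProd (a ++ [i]), isCoxeterElement_wordProd (nodup_rotate ha) (mem_rotate hf)⟩
    have h12 := ih c' rfl _ _ (h₁.conj_simple i) (h₂.conj_simple i) hpos
    -- The axiom only carries edges from c to the rotated element, so the wrong direction at c is
    -- refuted there.
    refine ((hO.isOrientation c).or_of_isCanonicalPair h h₁ h₂).resolve_right fun h21 => ?_
    refine (hO.isOrientation c').asymm_of_isCanonicalPair h' (h₁.conj_simple i)
      (h₂.conj_simple i) h12 ?_
    refine hO.conj c c' i ⟨a, isReduced_of_nodup ha, hc.symm⟩ ?_ _ _ h21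
    rw [hc]
    exact wordProd_rotate i a

theorem IsCOrientationFamily.eq_cOrientation [Finite W]
    {O : {c : W // cs.IsCoxeterElement c} → W → W → Prop} (hO : cs.IsCOrientationFamily O) :
    O = cs.cOrientation := by
  funext c
  obtain ⟨a, ha, -⟩ := id c.2
  obtain ⟨h1, h2⟩ := ha.nodup_and_mem c.2
  rw [cOrientation_eq c ha]
  refine ((isOrientation_formEdge_skewForm h1 h2).ext (hO.isOrientation c) ?_).symm
  intro x y t₁ t₂ h h₁ h₂ h12
  exact hO.edge_of_skewForm_pos h1 h2 h c ha.2.symm t₁ t₂ h₁ h₂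
    ((h.formEdge_iff_pos h1 h2 h₁ h₂).1 h12)

/-! ### Alignment in terms of roots -/

variable (cs) in
/-- Alignment with respect to the orientation defined by the skew-symmetric form of a word, in terms
of roots. -/
def IsRootAligned (a : List B) (w : W) : Prop :=
  ∀ x y, cs.IsCanonicalPair x y → (∀ i ∉ a, x i = 0) → (∀ i ∉ a, y i = 0) →
    0 < M.skewForm a x y → cs.rep w⁻¹ (x - M.form x y • y) ≤ 0 → cs.rep w⁻¹ x ≤ 0

theorem IsCanonicalPair.rep_right_eq {x y : B →₀ ℝ} {t : W} (ht : cs.HasRoot t y) :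
    cs.rep t x = x - M.form x y • y := by
  rw [ht.rep_apply, M.form_comm]

theorem IsCanonicalPair.reflected_nonneg {x y : B →₀ ℝ} (h : cs.IsCanonicalPair x y) :
    0 ≤ x - M.form x y • y := by
  have := nonneg_comb h.nonneg_left h.nonneg_right zero_le_one (neg_nonneg.2 h.form_neg.le)
  rwa [one_smul, neg_smul, ← sub_eq_add_neg] at this

theorem IsCanonicalPair.isRoot_reflected {x y : B →₀ ℝ} (h : cs.IsCanonicalPair x y) :
    cs.IsRoot (x - M.form x y • y) := by
  obtain ⟨t, ht⟩ := h.isRoot_right.exists_hasRoot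
  rw [← rep_right_eq ht]
  exact h.isRoot_left.rep t

/-- The reflection t₂t₁t₂ has the positive root x − (x, y)y. -/
theorem isAligned_formEdge_iff [Finite W] {a : List B} (ha : a.Nodup) (hf : ∀ i, i ∈ a) (w : W) :
    cs.IsAligned (cs.formEdge (M.skewForm a)) w ↔ cs.IsRootAligned a w := by
  have conj : ∀ {x y t₁ t₂}, cs.HasRoot t₁ x → cs.HasRoot t₂ y →
      cs.HasRoot (t₂ * t₁ * t₂) (x - M.form x y • y) := by
    intro x y t₁ t₂ h₁ h₂
    have := h₁.conj t₂
    rwa [h₂.isReflection.inv, IsCanonicalPair.rep_right_eq h₂] at this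
  constructor
  · intro H x y h _ _ hpos hz
    obtain ⟨t₁, h₁⟩ := h.isRoot_left.exists_hasRoot
    obtain ⟨t₂, h₂⟩ := h.isRoot_right.exists_hasRoot
    have := H _ (h.isIrreducibleRankTwoParabolic h₁ h₂) t₁ t₂ (h.canonicalGenerators_eq h₁ h₂)
      (h.formEdge h₁ h₂ hpos) (((conj h₁ h₂).isLeftInversion_iff h.reflected_nonneg).2 hz)
    exact (h₁.isLeftInversion_iff h.nonneg_left).1 this
  · intro H K hK r₁ r₂ hcan hedge hinv
    have main : ∀ x y t₁ t₂, cs.IsCanonicalPair x y → cs.HasRoot t₁ x → cs.HasRoot t₂ y →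
        cs.formEdge (M.skewForm a) t₁ t₂ → cs.IsLeftInversion w (t₂ * t₁ * t₂) →
        cs.IsLeftInversion w t₁ := by
      intro x y t₁ t₂ h h₁ h₂ h12 hinv
      rw [(conj h₁ h₂).isLeftInversion_iff h.reflected_nonneg] at hinv
      rw [h₁.isLeftInversion_iff h.nonneg_left]
      exact H x y h (fun i hi => absurd (hf i) hi) (fun i hi => absurd (hf i) hi)
        ((h.formEdge_iff_pos ha hf h₁ h₂).1 h12) hinv
    obtain ⟨x, y, t₁, t₂, h, h₁, h₂, rfl⟩ := hK.exists_canonicalPair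
    rw [h.canonicalGenerators_eq h₁ h₂, Set.pair_eq_pair_iff] at hcan
    rcases hcan with ⟨rfl, rfl⟩ | ⟨rfl, rfl⟩
    · exact main x y _ _ h h₁ h₂ hedge hinv
    · exact main y x _ _ h.symm h₂ h₁ hedge hinv

end CoxeterSystem

/-! ### Recursive sortability and alignment -/

namespace CoxeterSystem

variable {B W : Type*} [Group W] {M : CoxeterMatrix B} {cs : CoxeterSystem M W}

variable (cs) in
/-- The recursive characterization of sortable elements with respect to a word. -/
inductive IsRecSortable : List B → W → Prop
  | nil : IsRecSortable [] 1
  | descent (i : B) (a : List B) (w : W) : cs.length (cs.simple i * w) < cs.length w →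
      IsRecSortable (a ++ [i]) (cs.simple i * w) → IsRecSortable (i :: a) w
  | notDescent (i : B) (a : List B) (w : W) : ¬ cs.length (cs.simple i * w) < cs.length w →
      IsRecSortable a w → IsRecSortable (i :: a) w

/-- The positive roots of the reflections in the left inversion sequence of a word. -/
noncomputable def invRoots (cs : CoxeterSystem M W) : List B → List (B →₀ ℝ)
  | [] => []
  | i :: b => Finsupp.single i 1 :: (invRoots cs b).map (cs.rep (cs.simple i))

theorem invRoots_append_singleton (b : List B) (r : B) : cs.invRoots (b ++ [r]) =
    cs.invRoots b ++ [cs.rep (cs.wordProd b) (Finsupp.single r 1)] := by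
  induction b with
  | nil => simp [invRoots]
  | cons i b ih => simp [invRoots, ih, wordProd_cons]

theorem rep_simple_supported {i : B} {a : List B} {x : B →₀ ℝ} (hi : i ∈ a)
    (hx : ∀ j ∉ a, x j = 0) : ∀ j ∉ a, cs.rep (cs.simple i) x j = 0 := by
  intro j hj
  rw [rep_simple_apply_of_ne (by rintro rfl; exact hj hi), hx j hj]

theorem supported_of_inversion {a : List B} {w : W} (hw : w ∈ cs.standardParabolic {j | j ∈ a})
    {z : B →₀ ℝ} (hz0 : 0 ≤ z) (hz : cs.rep w⁻¹ z ≤ 0) : ∀ i ∉ a, z i = 0 := by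
  intro i hi
  have h1 := hz i
  rw [rep_apply_of_notMem (inv_mem hw) hi] at h1
  exact le_antisymm h1 (hz0 i)

theorem IsCanonicalPair.eq_zero_of_reflected {x y : B →₀ ℝ} (h : cs.IsCanonicalPair x y) {i : B}
    (hz : (x - M.form x y • y) i = 0) : x i = 0 ∧ y i = 0 := by
  have h1 : 0 ≤ x i := h.nonneg_left i
  have h2 : 0 ≤ y i := h.nonneg_right i
  have h3 := h.form_neg
  simp only [Finsupp.sub_apply, Finsupp.smul_apply, smul_eq_mul] at hz
  have h4 : 0 ≤ -M.form x y * y i := mul_nonneg (by linarith) h2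
  refine ⟨by linarith, ?_⟩
  have h5 : M.form x y * y i = 0 := by linarith
  exact (mul_eq_zero.1 h5).resolve_left h3.ne

/-- Prepend the missing letters: they contribute nothing on these roots and complete the word. -/
theorem IsCanonicalPair.skewForm_ne_zero_of_supported [Finite W] {a : List B} {x y : B →₀ ℝ}
    (ha : a.Nodup) (hx : ∀ i ∉ a, x i = 0) (hy : ∀ i ∉ a, y i = 0)
    (h : cs.IsCanonicalPair x y) : M.skewForm a x y ≠ 0 := by
  classical
  have := cs.finite_index
  have := Fintype.ofFinite B
  have key : ∀ b : List B, (∀ i ∈ b, i ∉ a) → M.skewForm (b ++ a) x y = M.skewForm a x y := by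
    intro b hb
    induction b with
    | nil => rfl
    | cons i b ih =>
      rw [List.cons_append, CoxeterMatrix.skewForm_cons_of_eq_zero _ (hx i (hb i (by simp)))
        (hy i (hb i (by simp))), ih fun j hj => hb j (by simp [hj])]
  have hb := key (Finset.univ.filter (· ∉ a)).toList (by simp)
  rw [← hb]
  refine h.skewForm_ne_zero ?_ ?_
  · refine List.Nodup.append (Finset.nodup_toList _) ha ?_
    intro i hi
    simpa using hi
  · intro i
    simp only [List.mem_append, Finset.mem_toList, Finset.mem_filter, Finset.mem_univ, true_and]
    tauto

theorem rep_simple_reflected (i : B) (x y : B →₀ ℝ) : cs.rep (cs.simple i) (x - M.form x y • y) =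
    cs.rep (cs.simple i) x -
      M.form (cs.rep (cs.simple i) x) (cs.rep (cs.simple i) y) • cs.rep (cs.simple i) y := by
  rw [form_rep_rep, map_sub, map_smul]

theorem rep_inv_simple_mul (i : B) (w : W) (x : B →₀ ℝ) :
    cs.rep (cs.simple i * w)⁻¹ x = cs.rep w⁻¹ (cs.rep (cs.simple i) x) := by
  rw [mul_inv_rev, inv_simple, rep_mul]

/-- Pairs without α_i are carried along by s_i. If x = α_i the conclusion is `hw`, and y = α_i has
the wrong sign. -/
theorem isRootAligned_of_rotate {i : B} {a : List B} (ha : (i :: a).Nodup) {w : W}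
    (hw : cs.rep w⁻¹ (Finsupp.single i 1) ≤ 0)
    (h : cs.IsRootAligned (a ++ [i]) (cs.simple i * w)) : cs.IsRootAligned (i :: a) w := by
  have hmem : ∀ j, j ∈ a ++ [i] ↔ j ∈ i :: a := fun j =>
    (List.perm_append_singleton i a).mem_iff
  intro x y hxy hx hy hpos hz
  by_cases hxi : x = Finsupp.single i 1
  · rwa [hxi]
  by_cases hyi : y = Finsupp.single i 1
  · subst hyi
    rw [M.skewForm_skew] at hpos
    have := M.skewForm_single_nonneg (List.nodup_cons.1 ha).1 hxy.nonneg_left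
    linarith
  have h' := hxy.rep_simple hxi hyi
  have hx' := rep_simple_supported (cs := cs) (i := i) (by simp) hx
  have hy' := rep_simple_supported (cs := cs) (i := i) (by simp) hy
  have := h _ _ h' (fun j hj => hx' j (by rwa [hmem] at hj))
    (fun j hj => hy' j (by rwa [hmem] at hj)) (by rwa [skewForm_rotate ha hx hy])
    (by rwa [← rep_simple_reflected, rep_inv_simple_mul, rep_simple_rep_simple])
  rwa [rep_inv_simple_mul, rep_simple_rep_simple] at this

/-- With i moved to the end, x = α_i has the wrong sign. For y = α_i the hypothesis says that w⁻¹x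
is negative, and s_i x is x plus a nonnegative multiple of α_i, so alignment is not needed. -/
theorem IsRootAligned.rotate {i : B} {a : List B} (ha : (i :: a).Nodup) {w : W}
    (hw : cs.rep w⁻¹ (Finsupp.single i 1) ≤ 0) (h : cs.IsRootAligned (i :: a) w) :
    cs.IsRootAligned (a ++ [i]) (cs.simple i * w) := by
  have hmem : ∀ j, j ∈ a ++ [i] ↔ j ∈ i :: a := fun j =>
    (List.perm_append_singleton i a).mem_iff
  intro x y hxy hx hy hpos hz
  have hx : ∀ j ∉ i :: a, x j = 0 := fun j hj => hx j (by rwa [hmem])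
  have hy : ∀ j ∉ i :: a, y j = 0 := fun j hj => hy j (by rwa [hmem])
  have hx' := rep_simple_supported (cs := cs) (i := i) (by simp) hx
  have hy' := rep_simple_supported (cs := cs) (i := i) (by simp) hy
  rw [rep_inv_simple_mul] at hz ⊢
  have hrot := skewForm_rotate (cs := cs) ha hx' hy'
  rw [rep_simple_rep_simple, rep_simple_rep_simple] at hrot
  by_cases hxi : x = Finsupp.single i 1
  · subst hxi
    have hne : y ≠ Finsupp.single i 1 := hxy.ne.symm
    have := M.skewForm_single_nonneg (List.nodup_cons.1 ha).1
      (hxy.isRoot_right.rep_simple_nonneg hxy.nonneg_right hne)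
    rw [hrot, rep_simple_self, map_neg, LinearMap.neg_apply] at hpos
    linarith
  by_cases hyi : y = Finsupp.single i 1
  · subst hyi
    have e : cs.rep (cs.simple i) x = x - M.form x (Finsupp.single i 1) • Finsupp.single i 1 := by
      rw [rep_simple, M.form_comm]
    rw [← e, rep_simple_rep_simple] at hz
    rw [e, map_sub, map_smul, sub_nonpos, ← neg_smul_neg]
    exact hz.trans (smul_nonneg (neg_nonneg.2 hxy.form_neg.le) (neg_nonneg.2 hw))
  have h' := hxy.rep_simple hxi hyi
  have := h _ _ h' hx' hy' (by rwa [← hrot]) (by rwa [← rep_simple_reflected])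
  exact this

theorem IsRecSortable.mem_and_isRootAligned {a : List B} {w : W} (h : cs.IsRecSortable a w)
    (ha : a.Nodup) : w ∈ cs.standardParabolic {j | j ∈ a} ∧ cs.IsRootAligned a w := by
  induction h with
  | nil =>
    refine ⟨one_mem _, fun x y hxy _ _ _ hz => ?_⟩
    exact absurd (by simpa using hz) (hxy.isRoot_reflected.not_nonpos hxy.reflected_nonneg)
  | descent i a w hd _ ih =>
    obtain ⟨h1, h2⟩ := ih (nodup_rotate ha)
    rw [length_simple_mul_lt_iff] at hd
    refine ⟨?_, isRootAligned_of_rotate ha hd h2⟩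
    rw [← cs.simple_mul_simple_cancel_left i (w := w)]
    refine mul_mem (simple_mem_standardParabolic (by simp)) (standardParabolic_mono ?_ h1)
    intro j hj
    exact (List.perm_append_singleton i a).mem_iff.1 hj
  | notDescent i a w hd _ ih =>
    have hi := (List.nodup_cons.1 ha).1
    obtain ⟨h1, h2⟩ := ih (List.nodup_cons.1 ha).2
    refine ⟨standardParabolic_mono (by intro j hj; simp at hj ⊢; tauto) h1, ?_⟩
    intro x y hxy hx hy hpos hz
    -- An inversion of w involves only letters of a, hence so do both roots that it combines.
    have h3 := supported_of_inversion h1 hxy.reflected_nonneg hz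
    have h4 := fun j hj => hxy.eq_zero_of_reflected (h3 j hj)
    refine h2 x y hxy (fun j hj => (h4 j hj).1) (fun j hj => (h4 j hj).2) ?_ hz
    rwa [M.skewForm_cons_of_eq_zero (h4 i hi).1 (h4 i hi).2] at hpos

/-- The inversions of a sortable element have a natural order that is compatible with the
skew-symmetric form. -/
theorem IsRecSortable.exists_word {a : List B} {u : W} (h : cs.IsRecSortable a u) (ha : a.Nodup) :
    ∃ b : List B, u = cs.wordProd b ∧ (∀ r ∈ b, r ∈ a) ∧
      (cs.invRoots b).Pairwise (fun x y => 0 ≤ M.skewForm a x y) ∧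
      ∀ z ∈ cs.invRoots b, cs.IsRoot z ∧ 0 ≤ z ∧ cs.rep u⁻¹ z ≤ 0 ∧ ∀ i ∉ a, z i = 0 := by
  induction h with
  | nil => exact ⟨[], by simp, by simp, by simp [invRoots], by simp [invRoots]⟩
  | descent i a w hd _ ih =>
    have hmem : ∀ j, j ∈ a ++ [i] ↔ j ∈ i :: a := fun j =>
      (List.perm_append_singleton i a).mem_iff
    obtain ⟨b, hb, hba, hp, hz⟩ := ih (nodup_rotate ha)
    rw [length_simple_mul_lt_iff] at hd
    have hz' : ∀ z ∈ cs.invRoots b, cs.IsRoot (cs.rep (cs.simple i) z) ∧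
        0 ≤ cs.rep (cs.simple i) z ∧ cs.rep w⁻¹ (cs.rep (cs.simple i) z) ≤ 0 ∧
        (∀ j ∉ i :: a, z j = 0) ∧ ∀ j ∉ i :: a, cs.rep (cs.simple i) z j = 0 := by
      intro z hzm
      obtain ⟨r1, r2, r3, r4⟩ := hz z hzm
      rw [rep_inv_simple_mul] at r3
      have r4' : ∀ j ∉ i :: a, z j = 0 := fun j hj => r4 j (by rwa [hmem])
      refine ⟨r1.rep _, r1.rep_simple_nonneg r2 ?_, r3, r4',
        rep_simple_supported (by simp) r4'⟩
      -- As α_i is an inversion of w, it is not one of s_i w.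
      rintro rfl
      rw [rep_simple_self, map_neg] at r3
      exact ((isRoot_single i).rep w⁻¹).not_nonpos (neg_nonpos.1 r3) hd
    refine ⟨i :: b, ?_, ?_, ?_, ?_⟩
    · rw [wordProd_cons, ← hb, cs.simple_mul_simple_cancel_left]
    · intro r hr
      rcases List.mem_cons.1 hr with rfl | hr
      · simp
      · exact (hmem r).1 (hba r hr)
    · rw [invRoots, List.pairwise_cons, List.pairwise_map]
      constructor
      · intro z hzm
        obtain ⟨z', hzm', rfl⟩ := List.mem_map.1 hzm
        exact M.skewForm_single_nonneg (List.nodup_cons.1 ha).1 (hz' z' hzm').2.1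
      · refine List.Pairwise.imp_of_mem ?_ hp
        intro y z hy hz h0
        rw [← skewForm_rotate (cs := cs) ha (hz' y hy).2.2.2.2 (hz' z hz).2.2.2.2]
        simpa using h0
    · intro z hzm
      rw [invRoots, List.mem_cons] at hzm
      rcases hzm with rfl | hzm
      · refine ⟨isRoot_single i, by simp, hd, fun j hj => ?_⟩
        have : i ≠ j := by
          rintro rfl
          simp at hj
        simp [this]
      · obtain ⟨z', hzm', rfl⟩ := List.mem_map.1 hzm
        obtain ⟨r1, r2, r3, -, r5⟩ := hz' z' hzm'
        exact ⟨r1, r2, r3, r5⟩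
  | notDescent i a w hd _ ih =>
    have hi := (List.nodup_cons.1 ha).1
    obtain ⟨b, hb, hba, hp, hz⟩ := ih (List.nodup_cons.1 ha).2
    refine ⟨b, hb, fun r hr => by simp [hba r hr], ?_, ?_⟩
    · refine List.Pairwise.imp_of_mem ?_ hp
      intro y z hy hzm h0
      rwa [M.skewForm_cons_of_eq_zero ((hz y hy).2.2.2 i hi) ((hz z hzm).2.2.2 i hi)]
    · intro z hzm
      obtain ⟨r1, r2, r3, r4⟩ := hz z hzm
      exact ⟨r1, r2, r3, fun j hj => r4 j (by simp at hj; tauto)⟩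

/-- Each letter r ≠ i adds a nonnegative multiple of the next root in `invRoots`. -/
theorem skewForm_rep_wordProd_nonneg (ω : (B →₀ ℝ) →ₗ[ℝ] (B →₀ ℝ) →ₗ[ℝ] ℝ) {i : B}
    {β : B →₀ ℝ} (h0 : 0 ≤ ω (Finsupp.single i 1) β) (b : List B) (hb : i ∉ b)
    (h : ∀ z ∈ cs.invRoots b, 0 ≤ ω z β) :
    0 ≤ ω (cs.rep (cs.wordProd b) (Finsupp.single i 1)) β := by
  induction b using List.reverseRecOn with
  | nil => simpa using h0
  | append_singleton b r ih =>
    rw [invRoots_append_singleton] at h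
    have h1 := ih (fun hi => hb (by simp [hi])) fun z hz => h z (by simp [hz])
    have h2 := h (cs.rep (cs.wordProd b) (Finsupp.single r 1)) (by simp)
    have hr : r ≠ i := by
      rintro rfl
      exact hb (by simp)
    have hg := M.gram_nonpos hr
    rw [wordProd_append, rep_mul, wordProd_cons, wordProd_nil, mul_one, CoxeterSystem.rep_simple,
      CoxeterMatrix.form_single_single, map_sub, map_smul, map_sub, map_smul, LinearMap.sub_apply,
      LinearMap.smul_apply, smul_eq_mul]
    nlinarith

/-- An aligned element whose parabolic component is sortable stays in the parabolic subgroup. -/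
theorem IsRootAligned.rep_not_nonpos [Finite W] {i : B} {a : List B} (ha : (i :: a).Nodup) {w : W}
    (hw : ¬ cs.rep w⁻¹ (Finsupp.single i 1) ≤ 0) (h : cs.IsRootAligned (i :: a) w) (b : List B)
    (hba : ∀ r ∈ b, r ∈ a) (hp : (cs.invRoots b).Pairwise (fun x y => 0 ≤ M.skewForm a x y))
    (hz : ∀ z ∈ cs.invRoots b, cs.IsRoot z ∧ 0 ≤ z ∧ ∀ i ∉ a, z i = 0) :
    ¬ cs.rep w⁻¹ (cs.rep (cs.wordProd b) (Finsupp.single i 1)) ≤ 0 := by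
  have hi := (List.nodup_cons.1 ha).1
  induction b using List.reverseRecOn with
  | nil => simpa using hw
  | append_singleton b r ih =>
    rw [invRoots_append_singleton] at hp hz
    obtain ⟨hp1, -, hp2⟩ := List.pairwise_append.1 hp
    have hba' : ∀ s ∈ b, s ∈ a := fun s hs => hba s (by simp [hs])
    have h1 := ih hba' hp1 fun z hzm => hz z (by simp [hzm])
    set β := cs.rep (cs.wordProd b) (Finsupp.single r 1) with hβ
    set θ := cs.rep (cs.wordProd b) (Finsupp.single i 1) with hθ
    have hra : r ∈ a := hba r (by simp)
    have hir : i ≠ r := by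
      rintro rfl
      exact hi hra
    -- The letter r replaces θ by the reflected root of the pair θ, β. Once ω(θ, β) > 0 is known,
    -- alignment passes negativity back to θ.
    have e : cs.rep (cs.wordProd (b ++ [r])) (Finsupp.single i 1) = θ - M.gram i r • β := by
      rw [wordProd_append, rep_mul, wordProd_cons, wordProd_nil, mul_one, CoxeterSystem.rep_simple,
        CoxeterMatrix.form_single_single, map_sub, map_smul, M.gram_comm r i, one_mul,
        one_mul]
    rw [e]
    by_cases hg : M.gram i r = 0
    · rwa [hg, zero_smul, sub_zero]
    have hbW : cs.wordProd b ∈ cs.standardParabolic {j | j ∈ a} :=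
      wordProd_mem_standardParabolic hba'
    obtain ⟨-, hβ0, hβs⟩ := hz β (by simp)
    have hθ0 : 0 ≤ θ := by
      have hroot : cs.IsRoot θ := (isRoot_single i).rep _
      rw [← hroot.not_nonpos_iff]
      intro hneg
      have := hneg i
      rw [hθ, rep_apply_of_notMem hbW hi] at this
      norm_num at this
    have hpair : cs.IsCanonicalPair θ β := ⟨cs.wordProd b, i, r, hir, hg, rfl, rfl, hθ0, hβ0⟩
    have hform : M.form θ β = M.gram i r := by
      rw [hθ, hβ, form_rep_rep]
      simp
    have hθs : ∀ j ∉ i :: a, θ j = 0 := by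
      intro j hj
      have hji : i ≠ j := by
        rintro rfl
        simp at hj
      rw [hθ, rep_apply_of_notMem hbW (by simp at hj; exact hj.2)]
      simp [hji]
    have hβs' : ∀ j ∉ i :: a, β j = 0 := fun j hj => hβs j (by simp at hj; exact hj.2)
    have hskew : 0 ≤ M.skewForm (i :: a) θ β := by
      refine skewForm_rep_wordProd_nonneg _ (M.skewForm_single_nonneg hi hβ0) b
        (fun hib => hi (hba' i hib)) fun z hzm => ?_
      rw [M.skewForm_cons_of_eq_zero ((hz z (by simp [hzm])).2.2 i hi) (hβs i hi)]
      exact hp2 z hzm β (by simp)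
    have hpos := lt_of_le_of_ne hskew (hpair.skewForm_ne_zero_of_supported ha hθs hβs').symm
    intro hneg
    exact h1 (h θ β hpair hθs hβs' hpos (by rwa [hform]))

/-- Induction on the length of the word, then of w. Rotation shortens w; without a descent a letter
is dropped, and the point is to prove v = 1. -/
theorem isRecSortable_of_isRootAligned [Finite W] {a : List B} (ha : a.Nodup) {w : W}
    (hw : w ∈ cs.standardParabolic {j | j ∈ a}) (h : cs.IsRootAligned a w) :
    cs.IsRecSortable a w := by
  induction hn : a.length using Nat.strong_induction_on generalizing a w with
  | _ n ihn =>
  induction hm : cs.length w using Nat.strong_induction_on generalizing a w with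
  | _ m ihm =>
  subst hn hm
  match a with
  | [] =>
    have : w = 1 := by simpa [standardParabolic] using hw
    subst this
    exact .nil
  | i :: a =>
    have hi := (List.nodup_cons.1 ha).1
    have ha' := (List.nodup_cons.1 ha).2
    by_cases hd : cs.length (cs.simple i * w) < cs.length w
    · refine .descent i a w hd ?_
      have hd' := hd
      rw [length_simple_mul_lt_iff] at hd'
      refine ihm _ hd (nodup_rotate ha) ?_ (h.rotate ha hd') (by simp) rfl
      refine mul_mem (simple_mem_standardParabolic (by simp)) (standardParabolic_mono ?_ hw)
      intro j hj
      exact (List.perm_append_singleton i a).mem_iff.2 hj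
    · refine .notDescent i a w hd ?_
      obtain ⟨u, v, hu, e, hv⟩ := exists_min_coset_rep' (cs := cs) {j | j ∈ a} w
      have hwv : ∀ z, cs.rep w⁻¹ z = cs.rep v⁻¹ (cs.rep u⁻¹ z) := fun z => by
        rw [e, mul_inv_rev, rep_mul]
      have hsupp : ∀ z : B →₀ ℝ, (∀ j ∉ a, z j = 0) → ∀ j ∉ a, cs.rep u⁻¹ z j = 0 :=
        fun z hz j hj => by rw [rep_apply_of_notMem (inv_mem hu) hj, hz j hj]
      -- On roots supported in a, v⁻¹ preserves signs, so w and u have the same inversions there and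
      -- u inherits alignment.
      have hiff : ∀ z, cs.IsRoot z → (∀ j ∉ a, z j = 0) →
          (cs.rep w⁻¹ z ≤ 0 ↔ cs.rep u⁻¹ z ≤ 0) := by
        intro z hz hza
        rw [hwv]
        constructor
        · intro h1
          by_contra h2
          rw [(hz.rep u⁻¹).not_nonpos_iff] at h2
          exact ((hz.rep u⁻¹).rep v⁻¹).not_nonpos
            (rep_nonneg_of_supported hv h2 (hsupp z hza)) h1
        · intro h1
          rw [← neg_nonneg, ← map_neg]
          refine rep_nonneg_of_supported hv (neg_nonneg.2 h1) fun j hj => ?_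
          rw [Finsupp.neg_apply, hsupp z hza j hj, neg_zero]
      have hual : cs.IsRootAligned a u := by
        intro x y hxy hx hy hpos hz
        have hzs : ∀ j ∉ a, (x - M.form x y • y) j = 0 := fun j hj => by
          simp [hx j hj, hy j hj]
        rw [← hiff x hxy.isRoot_left hx]
        refine h x y hxy (fun j hj => hx j (by simp at hj; exact hj.2))
          (fun j hj => hy j (by simp at hj; exact hj.2)) ?_
          ((hiff _ hxy.isRoot_reflected hzs).2 hz)
        rwa [M.skewForm_cons_of_eq_zero (hx i hi) (hy i hi)]
      have hus := ihn a.length (by simp) ha' hu hual rfl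
      by_cases hv1 : v = 1
      · rwa [e, hv1, mul_one]
      exfalso
      obtain ⟨k, hk⟩ := cs.exists_leftDescent_of_ne_one hv1
      rw [IsLeftDescent, length_simple_mul_lt_iff] at hk
      have hvW : v ∈ cs.standardParabolic {j | j ∈ i :: a} := by
        have : v = u⁻¹ * w := by rw [e]; group
        rw [this]
        exact mul_mem (inv_mem (standardParabolic_mono (by intro j hj; simp at hj ⊢; tauto) hu)) hw
      -- By minimality of v no letter of a is a left descent of it.
      have hki : k = i := by
        by_contra hne
        by_cases hka : k ∈ a
        · exact ((isRoot_single k).rep v⁻¹).not_nonpos (hv k hka) hk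
        · have := supported_of_inversion hvW (by simp) hk k (by simp [hka, hne])
          simp at this
      subst hki
      obtain ⟨b, hb, hba, hp, hz⟩ := hus.exists_word ha'
      rw [length_simple_mul_lt_iff] at hd
      refine h.rep_not_nonpos ha hd b hba hp (fun z hzm => ⟨(hz z hzm).1, (hz z hzm).2.1,
        (hz z hzm).2.2.2⟩) ?_
      rwa [← hb, hwv, rep_inv_rep]

end CoxeterSystem

/-! ### The recursion for sorting words -/

namespace CoxeterSystem

variable {B W : Type*} [Group W] {M : CoxeterMatrix B} {cs : CoxeterSystem M W}

/-- The strong exchange property: reading b from the left, x stays positive until it equals the root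
of the next letter, and that letter is cancelled by t. -/
theorem HasRoot.exists_eraseIdx {t : W} {x : B →₀ ℝ} (h : cs.HasRoot t x) (h0 : 0 ≤ x) {b : List B}
    (hb : cs.rep (cs.wordProd b)⁻¹ x ≤ 0) :
    ∃ k < b.length, t * cs.wordProd b = cs.wordProd (b.eraseIdx k) := by
  induction b generalizing t x with
  | nil => exact absurd (by simpa using hb) (h.isRoot.not_nonpos h0)
  | cons j b ih =>
    by_cases hx : x = Finsupp.single j 1
    · subst hx
      refine ⟨0, by simp, ?_⟩
      rw [h.unique (hasRoot_simple j), wordProd_cons, cs.simple_mul_simple_cancel_left]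
      rfl
    · obtain ⟨k, hk, e⟩ := ih (h.conj_simple j) (h.isRoot.rep_simple_nonneg h0 hx)
        (by rwa [← rep_inv_simple_mul, ← wordProd_cons])
      refine ⟨k + 1, by simpa using hk, ?_⟩
      rw [List.eraseIdx_cons_succ, wordProd_cons, wordProd_cons, ← e]
      simp [mul_assoc]

theorem map_lt_map_iff_of_strictMono {α β : Type*} [LinearOrder α] [LinearOrder β] {f : α → β}
    (hf : StrictMono f) (p q : List α) : p.map f < q.map f ↔ p < q := by
  induction p generalizing q with
  | nil => cases q <;> simp
  | cons x p ih =>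
    cases q with
    | nil => simp
    | cons y q => simp [List.cons_lt_cons_iff, ih, hf.lt_iff_lt, hf.injective.eq_iff]

theorem map_le_map_iff_of_strictMono {α β : Type*} [LinearOrder α] [LinearOrder β] {f : α → β}
    (hf : StrictMono f) (p q : List α) : p.map f ≤ q.map f ↔ p ≤ q := by
  rw [← not_lt, ← not_lt, map_lt_map_iff_of_strictMono hf]

theorem exists_map_of_forall_mem_range {α β : Type*} {f : α → β} {q : List β}
    (h : ∀ x ∈ q, x ∈ Set.range f) : ∃ p : List α, p.map f = q := by
  have : q ∈ Set.range (List.map f) := by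
    rw [Set.range_list_map]
    exact h
  exact this

theorem isReducedSubword_map_iff {a a' : List B} {f : InftyPos a' → InftyPos a}
    (hf : StrictMono f) (hl : ∀ x, inftyLetter a (f x) = inftyLetter a' x) (w : W)
    (p : List (InftyPos a')) :
    cs.IsReducedSubword a w (p.map f) ↔ cs.IsReducedSubword a' w p := by
  have : inftyLetter a ∘ f = inftyLetter a' := funext hl
  simp only [IsReducedSubword, List.pairwise_map, hf.lt_iff_lt, List.map_map, this]

/-- Positions of the half-infinite word of `a` as positions for `i :: a`. -/
def consPos (i : B) (a : List B) (x : InftyPos a) : InftyPos (i :: a) :=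
  toLex ((ofLex x).1, (ofLex x).2.succ)

theorem consPos_strictMono (i : B) (a : List B) : StrictMono (consPos i a) := by
  intro x y h
  rw [Prod.Lex.lt_iff] at h
  rw [consPos, consPos, Prod.Lex.toLex_lt_toLex]
  simpa [Fin.succ_lt_succ_iff] using h

theorem inftyLetter_consPos (i : B) (a : List B) (x : InftyPos a) :
    inftyLetter (i :: a) (consPos i a x) = inftyLetter a x := rfl

theorem mem_range_consPos {i : B} {a : List B} {y : InftyPos (i :: a)}
    (h : inftyLetter (i :: a) y ≠ i) : y ∈ Set.range (consPos i a) := by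
  obtain ⟨⟨r, j⟩, rfl⟩ := toLex.surjective y
  induction j using Fin.cases with
  | zero => exact absurd rfl h
  | succ j => exact ⟨toLex (r, j), rfl⟩

/-- The first position of the half-infinite word of `i :: a`. -/
def firstPos (i : B) (a : List B) : InftyPos (i :: a) := toLex (0, ⟨0, by simp⟩)

theorem inftyLetter_firstPos (i : B) (a : List B) : inftyLetter (i :: a) (firstPos i a) = i := rfl

theorem firstPos_le (i : B) (a : List B) (x : InftyPos (i :: a)) : firstPos i a ≤ x := by
  obtain ⟨⟨r, j⟩, rfl⟩ := toLex.surjective x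
  rw [firstPos, Prod.Lex.toLex_le_toLex]
  rcases Nat.eq_zero_or_pos r with rfl | h
  · exact .inr ⟨rfl, Fin.mk_le_of_le_val (Nat.zero_le _)⟩
  · exact .inl h

theorem firstPos_lt {i : B} {a : List B} {x : InftyPos (i :: a)} (h : x ≠ firstPos i a) :
    firstPos i a < x :=
  lt_of_le_of_ne (firstPos_le i a x) h.symm

theorem eq_firstPos {i : B} {a : List B} (ha : (i :: a).Nodup) {x : InftyPos (i :: a)}
    (h : inftyLetter (i :: a) x = i) (h0 : (ofLex x).1 = 0) : x = firstPos i a := by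
  obtain ⟨⟨r, j⟩, rfl⟩ := toLex.surjective x
  induction j using Fin.cases with
  | zero =>
    change r = 0 at h0
    rw [h0]
    rfl
  | succ j =>
    exfalso
    refine (List.nodup_cons.1 ha).1 ?_
    rw [← h]
    exact List.get_mem a j

/-- Positions of the half-infinite word of `a ++ [i]` as positions for `i :: a`, omitting the
first one. -/
def rotatePos (i : B) (a : List B) (x : InftyPos (a ++ [i])) : InftyPos (i :: a) :=
  if h : (ofLex x).2.val < a.length then
    toLex ((ofLex x).1, ⟨(ofLex x).2.val + 1, by simpa using h⟩)
  -- The closing i of copy r is the opening i of copy r + 1.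
  else toLex ((ofLex x).1 + 1, ⟨0, by simp⟩)

theorem rotatePos_of_lt {i : B} {a : List B} {x : InftyPos (a ++ [i])}
    (h : (ofLex x).2.val < a.length) : rotatePos i a x =
      toLex ((ofLex x).1, ⟨(ofLex x).2.val + 1, by simpa using h⟩) := dif_pos h

theorem rotatePos_of_not_lt {i : B} {a : List B} {x : InftyPos (a ++ [i])}
    (h : ¬ (ofLex x).2.val < a.length) : rotatePos i a x =
      toLex ((ofLex x).1 + 1, ⟨0, by simp⟩) := dif_neg h

theorem rotatePos_strictMono (i : B) (a : List B) : StrictMono (rotatePos i a) := by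
  intro x y h
  rw [Prod.Lex.lt_iff] at h
  have hx := (ofLex x).2.2
  have hy := (ofLex y).2.2
  simp only [List.length_append, List.length_singleton] at hx hy
  have h' : (ofLex x).1 < (ofLex y).1 ∨
      (ofLex x).1 = (ofLex y).1 ∧ (ofLex x).2.val < (ofLex y).2.val := h
  by_cases h1 : (ofLex x).2.val < a.length <;> by_cases h2 : (ofLex y).2.val < a.length
  · rw [rotatePos_of_lt h1, rotatePos_of_lt h2, Prod.Lex.toLex_lt_toLex]
    simp only [Fin.mk_lt_mk]
    omega
  · rw [rotatePos_of_lt h1, rotatePos_of_not_lt h2, Prod.Lex.toLex_lt_toLex]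
    simp only [Fin.mk_lt_mk]
    omega
  · rw [rotatePos_of_not_lt h1, rotatePos_of_lt h2, Prod.Lex.toLex_lt_toLex]
    simp only [Fin.mk_lt_mk]
    omega
  · rw [rotatePos_of_not_lt h1, rotatePos_of_not_lt h2, Prod.Lex.toLex_lt_toLex]
    simp only [Fin.mk_lt_mk]
    omega

theorem inftyLetter_of_lt {i : B} {a : List B} {x : InftyPos (a ++ [i])}
    (h : (ofLex x).2.val < a.length) : inftyLetter (a ++ [i]) x = a[(ofLex x).2.val] := by
  simp [inftyLetter, List.getElem_append_left h]

theorem inftyLetter_of_not_lt {i : B} {a : List B} {x : InftyPos (a ++ [i])}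
    (h : ¬ (ofLex x).2.val < a.length) : inftyLetter (a ++ [i]) x = i := by
  simp [inftyLetter, List.getElem_append_right (not_lt.1 h)]

theorem inftyLetter_rotatePos (i : B) (a : List B) (x : InftyPos (a ++ [i])) :
    inftyLetter (i :: a) (rotatePos i a x) = inftyLetter (a ++ [i]) x := by
  by_cases h : (ofLex x).2.val < a.length
  · rw [rotatePos_of_lt h, inftyLetter_of_lt h]
    rfl
  · rw [rotatePos_of_not_lt h, inftyLetter_of_not_lt h]
    rfl

theorem firstPos_lt_rotatePos (i : B) (a : List B) (x : InftyPos (a ++ [i])) :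
    firstPos i a < rotatePos i a x := by
  refine firstPos_lt fun h => ?_
  by_cases hx : (ofLex x).2.val < a.length
  · rw [rotatePos_of_lt hx] at h
    have := congrArg (fun z => (ofLex z).2.val) h
    simp [firstPos] at this
  · rw [rotatePos_of_not_lt hx] at h
    have := congrArg (fun z => (ofLex z).1) h
    simp [firstPos] at this

theorem mem_range_rotatePos {i : B} {a : List B} {y : InftyPos (i :: a)}
    (h : firstPos i a < y) : y ∈ Set.range (rotatePos i a) := by
  obtain ⟨⟨r, j⟩, rfl⟩ := toLex.surjective y
  induction j using Fin.cases with
  | zero =>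
    cases r with
    | zero => exact absurd h (lt_irrefl _)
    | succ r =>
      refine ⟨toLex (r, ⟨a.length, by simp⟩), ?_⟩
      rw [rotatePos_of_not_lt (by simp)]
      rfl
  | succ j =>
    let x : InftyPos (a ++ [i]) :=
      toLex (r, ⟨j.val, by rw [List.length_append]; exact Nat.lt_add_right _ j.2⟩)
    have hx : (ofLex x).2.val < a.length := j.2
    exact ⟨x, rotatePos_of_lt hx⟩

theorem block_map_consPos (i : B) (a : List B) (p : List (InftyPos a)) (r : ℕ) :
    block (i :: a) (p.map (consPos i a)) r = block a p r := by
  ext k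
  simp only [block, List.mem_map, exists_exists_and_eq_and, inftyLetter_consPos, Set.mem_ofPred_eq]
  rfl

theorem mem_block_zero (i : B) (a : List B) (p : List (InftyPos (a ++ [i]))) :
    i ∈ block (i :: a) (firstPos i a :: p.map (rotatePos i a)) 0 :=
  ⟨firstPos i a, by simp, rfl, rfl⟩

theorem mem_block_succ_iff {i : B} {a : List B} (ha : (i :: a).Nodup)
    (p : List (InftyPos (a ++ [i]))) (r : ℕ) :
    i ∈ block (i :: a) (firstPos i a :: p.map (rotatePos i a)) (r + 1) ↔
      i ∈ block (a ++ [i]) p r := by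
  constructor
  · rintro ⟨x, hx, hr, hl⟩
    rcases List.mem_cons.1 hx with rfl | hx
    · simp [firstPos] at hr
    · obtain ⟨y, hy, rfl⟩ := List.mem_map.1 hx
      rw [inftyLetter_rotatePos] at hl
      refine ⟨y, hy, ?_, hl⟩
      have h : ¬ (ofLex y).2.val < a.length := fun h => by
        rw [inftyLetter_of_lt h] at hl
        exact (List.nodup_cons.1 ha).1 (hl ▸ List.getElem_mem h)
      rw [rotatePos_of_not_lt h] at hr
      simpa using hr
  · rintro ⟨y, hy, hr, hl⟩
    refine ⟨rotatePos i a y, List.mem_cons_of_mem _ (List.mem_map_of_mem hy), ?_,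
      by rw [inftyLetter_rotatePos, hl]⟩
    have h : ¬ (ofLex y).2.val < a.length := fun h => by
      rw [inftyLetter_of_lt h] at hl
      exact (List.nodup_cons.1 ha).1 (hl ▸ List.getElem_mem h)
    rw [rotatePos_of_not_lt h]
    simpa using hr

theorem mem_block_iff_of_ne {i k : B} {a : List B} (hk : k ≠ i)
    (p : List (InftyPos (a ++ [i]))) (r : ℕ) :
    k ∈ block (i :: a) (firstPos i a :: p.map (rotatePos i a)) r ↔
      k ∈ block (a ++ [i]) p r := by
  constructor
  · rintro ⟨x, hx, hr, hl⟩
    rcases List.mem_cons.1 hx with rfl | hx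
    · exact absurd hl.symm hk
    · obtain ⟨y, hy, rfl⟩ := List.mem_map.1 hx
      rw [inftyLetter_rotatePos] at hl
      refine ⟨y, hy, ?_, hl⟩
      have h : (ofLex y).2.val < a.length := by
        by_contra h
        rw [inftyLetter_of_not_lt h] at hl
        exact hk hl.symm
      rw [rotatePos_of_lt h] at hr
      simpa using hr
  · rintro ⟨y, hy, hr, hl⟩
    refine ⟨rotatePos i a y, List.mem_cons_of_mem _ (List.mem_map_of_mem hy), ?_,
      by rw [inftyLetter_rotatePos, hl]⟩
    have h : (ofLex y).2.val < a.length := by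
      by_contra h
      rw [inftyLetter_of_not_lt h] at hl
      exact hk hl.symm
    rw [rotatePos_of_lt h]
    simpa using hr

/-- Rotation shifts the copies of i by one and leaves those of the other letters. The only new
condition is that copy 0 contains i, which the first position provides. -/
theorem block_succ_subset_iff {i : B} {a : List B} (ha : (i :: a).Nodup)
    (p : List (InftyPos (a ++ [i]))) :
    (∀ r, block (i :: a) (firstPos i a :: p.map (rotatePos i a)) (r + 1) ⊆
      block (i :: a) (firstPos i a :: p.map (rotatePos i a)) r) ↔
      ∀ r, block (a ++ [i]) p (r + 1) ⊆ block (a ++ [i]) p r := by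
  constructor
  · intro h r k hk
    by_cases hki : k = i
    · subst hki
      rw [← mem_block_succ_iff ha] at hk ⊢
      exact h _ hk
    · rw [← mem_block_iff_of_ne hki] at hk ⊢
      exact h _ hk
  · intro h r k hk
    by_cases hki : k = i
    · subst hki
      cases r with
      | zero => exact mem_block_zero _ _ _
      | succ r =>
        rw [mem_block_succ_iff ha] at hk ⊢
        exact h _ hk
    · rw [mem_block_iff_of_ne hki] at hk ⊢
      exact h _ hk

theorem isReducedSubword_firstPos_cons_iff {i : B} {a : List B} {w : W}
    (hd : cs.length (cs.simple i * w) < cs.length w) (p : List (InftyPos (a ++ [i]))) :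
    cs.IsReducedSubword (i :: a) w (firstPos i a :: p.map (rotatePos i a)) ↔
      cs.IsReducedSubword (a ++ [i]) (cs.simple i * w) p := by
  rw [← isReducedSubword_map_iff (rotatePos_strictMono i a) (inftyLetter_rotatePos i a)]
  have hlen : cs.length (cs.simple i * w) + 1 = cs.length w := by
    rcases cs.length_simple_mul w i with h | h <;> omega
  set q := p.map (rotatePos i a) with hq
  have hfirst : ∀ x ∈ q, firstPos i a < x := by
    intro x hx
    obtain ⟨y, -, rfl⟩ := List.mem_map.1 hx
    exact firstPos_lt_rotatePos i a y
  rw [IsReducedSubword, IsReducedSubword, List.pairwise_cons, List.map_cons, inftyLetter_firstPos]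
  simp only [IsReducedWordFor, IsReduced, wordProd_cons, List.length_cons]
  constructor
  · rintro ⟨⟨-, h1⟩, h2, rfl⟩
    rw [cs.simple_mul_simple_cancel_left] at hlen ⊢
    exact ⟨h1, by omega, rfl⟩
  · rintro ⟨h1, h2, h3⟩
    rw [h3, cs.simple_mul_simple_cancel_left]
    rw [h3] at h2
    exact ⟨⟨hfirst, h1⟩, by omega, rfl⟩

/-- A reduced subword that begins with the first letter. -/
theorem exists_eq_firstPos_cons {i : B} {a : List B} {w : W} {p : List (InftyPos (i :: a))}
    (hp : cs.IsReducedSubword (i :: a) w (firstPos i a :: p)) :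
    ∃ q : List (InftyPos (a ++ [i])), p = q.map (rotatePos i a) := by
  obtain ⟨q, hq⟩ := exists_map_of_forall_mem_range (f := rotatePos i a) (q := p) fun x hx =>
    mem_range_rotatePos ((List.pairwise_cons.1 hp.1).1 x hx)
  exact ⟨q, hq.symm⟩

theorem IsReducedSubword.length_lt {i : B} {a : List B} {w : W} {p : List (InftyPos (i :: a))}
    (hp : cs.IsReducedSubword (i :: a) w (firstPos i a :: p)) :
    cs.length (cs.simple i * w) < cs.length w := by
  obtain ⟨-, h1, h2⟩ := hp
  rw [← h2, h1.eq, List.map_cons, wordProd_cons, inftyLetter_firstPos,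
    cs.simple_mul_simple_cancel_left]
  exact (cs.length_wordProd_le _).trans_lt (by simp)

theorem isReducedSubword_ne_nil {a : List B} {i : B} {w : W}
    (hd : cs.length (cs.simple i * w) < cs.length w) : ¬ cs.IsReducedSubword a w [] := by
  rintro ⟨-, -, h⟩
  rw [List.map_nil, wordProd_nil] at h
  subst h
  simp at hd

/-- If the first position is unused, the exchange property deletes a letter in return for it. -/
theorem IsReducedSubword.exists_firstPos_cons {i : B} {a : List B} {w : W}
    (hd : cs.length (cs.simple i * w) < cs.length w) {p : List (InftyPos (i :: a))}
    (hp : cs.IsReducedSubword (i :: a) w p) :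
    ∃ q, cs.IsReducedSubword (i :: a) w (firstPos i a :: q) := by
  by_cases hmem : firstPos i a ∈ p
  · match p with
    | [] => simp at hmem
    | x :: p =>
      have : x = firstPos i a := by
        rcases List.mem_cons.1 hmem with h | h
        · exact h.symm
        · exact absurd ((List.pairwise_cons.1 hp.1).1 _ h) (not_lt.2 (firstPos_le i a x))
      subst this
      exact ⟨p, hp⟩
  · obtain ⟨h1, h2, rfl⟩ := hp
    have hd' := hd
    rw [length_simple_mul_lt_iff] at hd'
    obtain ⟨k, hk, e⟩ := (hasRoot_simple i).exists_eraseIdx (by simp) hd'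
    have hsub : (p.eraseIdx k).Sublist p := List.eraseIdx_sublist p k
    refine ⟨p.eraseIdx k, ?_, ?_, ?_⟩
    · rw [List.pairwise_cons]
      refine ⟨fun x hx => firstPos_lt ?_, h1.sublist hsub⟩
      rintro rfl
      exact hmem (hsub.subset hx)
    · rw [List.map_cons, inftyLetter_firstPos, IsReduced, wordProd_cons, ← List.eraseIdx_map, ← e,
        cs.simple_mul_simple_cancel_left, h2.eq, List.length_cons, List.length_eraseIdx_add_one hk]
    · rw [List.map_cons, inftyLetter_firstPos, wordProd_cons, ← List.eraseIdx_map, ← e,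
        cs.simple_mul_simple_cancel_left]

theorem isSortable_cons_iff_of_descent {i : B} {a : List B} (ha : (i :: a).Nodup) {w : W}
    (hd : cs.length (cs.simple i * w) < cs.length w) :
    cs.IsSortable (i :: a) w ↔ cs.IsSortable (a ++ [i]) (cs.simple i * w) := by
  have hmono := rotatePos_strictMono i a
  constructor
  · rintro ⟨p, ⟨hp, hmin⟩, hblock⟩
    obtain ⟨q, hq⟩ := hp.exists_firstPos_cons hd
    match p with
    | [] => exact absurd hp (isReducedSubword_ne_nil hd)
    | x :: p =>
      have hx : x = firstPos i a := by
        -- A reduced subword starting at the first position exists, and it precedes all those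
        -- starting later.
        by_contra hx
        exact not_lt.2 (hmin _ hq) (List.cons_lt_cons_iff.2 (.inl (firstPos_lt hx)))
      subst hx
      obtain ⟨p, rfl⟩ := exists_eq_firstPos_cons hp
      refine ⟨p, ⟨(isReducedSubword_firstPos_cons_iff hd p).1 hp, fun q hq => ?_⟩,
        (block_succ_subset_iff ha p).1 hblock⟩
      have := hmin _ ((isReducedSubword_firstPos_cons_iff hd q).2 hq)
      rw [← not_lt] at this ⊢
      intro hlt
      exact this (List.cons_lt_cons_iff.2
        (.inr ⟨rfl, (map_lt_map_iff_of_strictMono hmono _ _).2 hlt⟩))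
  · rintro ⟨p, ⟨hp, hmin⟩, hblock⟩
    refine ⟨firstPos i a :: p.map (rotatePos i a),
      ⟨(isReducedSubword_firstPos_cons_iff hd p).2 hp, fun q hq => ?_⟩,
      (block_succ_subset_iff ha p).2 hblock⟩
    match q with
    | [] => exact absurd hq (isReducedSubword_ne_nil hd)
    | x :: q =>
      by_cases hx : x = firstPos i a
      · subst hx
        obtain ⟨q, rfl⟩ := exists_eq_firstPos_cons hq
        have := hmin q ((isReducedSubword_firstPos_cons_iff hd q).1 hq)
        rw [← not_lt] at this ⊢
        intro hlt
        rw [List.cons_lt_cons_iff] at hlt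
        rcases hlt with hlt | ⟨-, hlt⟩
        · exact lt_irrefl _ hlt
        · exact this ((map_lt_map_iff_of_strictMono hmono _ _).1 hlt)
      · exact (List.cons_lt_cons_iff.2 (.inl (firstPos_lt hx))).le

theorem isSortable_cons_iff_of_not_descent {i : B} {a : List B} (ha : (i :: a).Nodup) {w : W}
    (hd : ¬ cs.length (cs.simple i * w) < cs.length w) :
    cs.IsSortable (i :: a) w ↔ cs.IsSortable a w := by
  have hmono := consPos_strictMono i a
  have hmap := isReducedSubword_map_iff (cs := cs) hmono (inftyLetter_consPos i a) w
  constructor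
  · rintro ⟨p, ⟨hp, hmin⟩, hblock⟩
    have hfirst : firstPos i a ∉ p := by
      intro hmem
      match p with
      | [] => simp at hmem
      | x :: p =>
        have : x = firstPos i a := by
          rcases List.mem_cons.1 hmem with h | h
          · exact h.symm
          · exact absurd ((List.pairwise_cons.1 hp.1).1 _ h) (not_lt.2 (firstPos_le i a x))
        subst this
        exact hd hp.length_lt
    -- The first copy does not use i, so decreasing blocks exclude it from every copy.
    have hi : ∀ r, i ∉ block (i :: a) p r := by
      intro r
      induction r with
      | zero =>
        rintro ⟨x, hx, hr, hl⟩
        exact hfirst (eq_firstPos ha hl hr ▸ hx)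
      | succ r ih => exact fun h => ih (hblock r h)
    obtain ⟨p, rfl⟩ := exists_map_of_forall_mem_range (f := consPos i a) (q := p) fun x hx =>
      mem_range_consPos fun h => hi _ ⟨x, hx, rfl, h⟩
    refine ⟨p, ⟨(hmap p).1 hp, fun q hq => ?_⟩, fun r => ?_⟩
    · exact (map_le_map_iff_of_strictMono hmono p q).1 (hmin _ ((hmap q).2 hq))
    · rw [← block_map_consPos i a, ← block_map_consPos i a]
      exact hblock r
  · rintro ⟨p, ⟨hp, hmin⟩, hblock⟩
    refine ⟨p.map (consPos i a), ⟨(hmap p).2 hp, fun q hq => ?_⟩, fun r => ?_⟩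
    -- No reduced word of w contains i, so all competing subwords avoid the copies of i.
    · have hw : w ∈ cs.standardParabolic {j | j ∈ a} := by
        rw [← hp.2.2]
        refine wordProd_mem_standardParabolic fun j hj => ?_
        obtain ⟨x, -, rfl⟩ := List.mem_map.1 hj
        exact List.get_mem a _
      have hmem := hq.2.1.mem_of_mem_standardParabolic (by rwa [hq.2.2])
      obtain ⟨q, rfl⟩ := exists_map_of_forall_mem_range (f := consPos i a) (q := q) fun x hx =>
        mem_range_consPos fun h =>
          (List.nodup_cons.1 ha).1 (h ▸ hmem _ (List.mem_map_of_mem hx))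
      exact (map_le_map_iff_of_strictMono hmono p q).2 (hmin _ ((hmap q).1 hq))
    · rw [block_map_consPos, block_map_consPos]
      exact hblock r

theorem isSortable_nil_iff (w : W) : cs.IsSortable [] w ↔ w = 1 := by
  have hnil : ∀ p : List (InftyPos ([] : List B)), p = [] := by
    intro p
    match p with
    | [] => rfl
    | x :: p => exact (ofLex x).2.elim0
  constructor
  · rintro ⟨p, ⟨hp, -⟩, -⟩
    have := hp.2.2
    rw [hnil p] at this
    simpa using this.symm
  · rintro rfl
    refine ⟨[], ⟨⟨by simp, by simp [IsReducedWordFor, IsReduced]⟩, fun q _ => ?_⟩, fun r => ?_⟩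
    · rw [hnil q]
    · rintro k ⟨x, hx, -⟩
      simp at hx

theorem isRecSortable_cons_iff_of_descent {i : B} {a : List B} {w : W}
    (hd : cs.length (cs.simple i * w) < cs.length w) :
    cs.IsRecSortable (i :: a) w ↔ cs.IsRecSortable (a ++ [i]) (cs.simple i * w) := by
  refine ⟨fun h => ?_, .descent i a w hd⟩
  cases h with
  | descent _ _ _ _ h => exact h
  | notDescent _ _ _ h _ => exact absurd hd h

theorem isRecSortable_cons_iff_of_not_descent {i : B} {a : List B} {w : W}
    (hd : ¬ cs.length (cs.simple i * w) < cs.length w) :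
    cs.IsRecSortable (i :: a) w ↔ cs.IsRecSortable a w := by
  refine ⟨fun h => ?_, .notDescent i a w hd⟩
  cases h with
  | descent _ _ _ h _ => exact absurd h hd
  | notDescent _ _ _ _ h => exact h

theorem isSortable_iff_isRecSortable {a : List B} (ha : a.Nodup) (w : W) :
    cs.IsSortable a w ↔ cs.IsRecSortable a w := by
  induction hn : a.length using Nat.strong_induction_on generalizing a w with
  | _ n ihn =>
  induction hm : cs.length w using Nat.strong_induction_on generalizing a w with
  | _ m ihm =>
  subst hn hm
  match a with
  | [] =>
    rw [isSortable_nil_iff]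
    refine ⟨?_, ?_⟩
    · rintro rfl
      exact .nil
    · rintro ⟨⟩
      rfl
  | i :: a =>
    by_cases hd : cs.length (cs.simple i * w) < cs.length w
    · rw [isSortable_cons_iff_of_descent ha hd, isRecSortable_cons_iff_of_descent hd]
      exact ihm _ hd (nodup_rotate ha) _ (by simp) rfl
    · rw [isSortable_cons_iff_of_not_descent ha hd, isRecSortable_cons_iff_of_not_descent hd]
      exact ihn a.length (by simp) (List.nodup_cons.1 ha).2 _ rfl

theorem isSortable_iff_isRootAligned [Finite W] {a : List B} (ha : a.Nodup) (hf : ∀ i, i ∈ a)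
    (w : W) : cs.IsSortable a w ↔ cs.IsRootAligned a w := by
  rw [isSortable_iff_isRecSortable ha]
  refine ⟨fun h => (h.mem_and_isRootAligned ha).2, isRecSortable_of_isRootAligned ha ?_⟩
  obtain ⟨b, rfl⟩ := cs.wordProd_surjective w
  exact wordProd_mem_standardParabolic fun i _ => hf i

end CoxeterSystem

/-! ### The theorem -/

theorem theorem4p1 {B W : Type*} [Group W] [Finite W] {M : CoxeterMatrix B}
    (cs : CoxeterSystem M W) :
    (∃! O : {c : W // cs.IsCoxeterElement c} → W → W → Prop, cs.IsCOrientationFamily O) ∧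
      ∀ O : {c : W // cs.IsCoxeterElement c} → W → W → Prop, cs.IsCOrientationFamily O →
        ∀ (c : {c : W // cs.IsCoxeterElement c}) (a : List B), cs.IsReducedWordFor a (c : W) →
          ∀ w : W, cs.IsSortable a w ↔ cs.IsAligned (O c) w := by
  refine ⟨⟨cs.cOrientation, CoxeterSystem.isCOrientationFamily_cOrientation,
    fun O hO => hO.eq_cOrientation⟩, fun O hO c a ha w => ?_⟩
  obtain ⟨h1, h2⟩ := ha.nodup_and_mem c.2
  rw [hO.eq_cOrientation, CoxeterSystem.cOrientation_eq c ha,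
    CoxeterSystem.isAligned_formEdge_iff h1 h2, CoxeterSystem.isSortable_iff_isRootAligned h1 h2]
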